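/- Conventions. Let $I$ be a set. A (symmetric, coloured) operad $T$ with set of colours $I$ consists of sets $T((i_j)_{1\le j\le n};i)$ of arrows $\alpha:(i_j)_j\to i$ for all $n\ge 0$ and $i_1,\dots,i_n,i\in I$, with symmetric group actions $\alpha\mapsto\alpha\rho:(i_{\rho j})_j\to i$, units $1_i:(i)\to i$ and substitutions $\alpha(\beta_j)_j$, subject to the usual associativity, unit and equivariance axioms. Let $\mathbf{Cat}/I$ be the 2-category of small categories with a functor to the discrete category $I$; for $H\in\mathbf{Cat}/I$ write $H_i$ for the fibre over $i\in I$. Let $\mathrm{Mnd}(\mathbf{Cat}/I)$ be the 2-category of 2-monads on $\mathbf{Cat}/I$, strict morphisms of 2-monads, and modifications compatible with units and multiplications. The operad $T$ determines a 2-monad on $\mathbf{Cat}/I$, also denoted $T$. The objects of $TX$ over $i$ are the pairs $(\alpha,(x_j)_j)$ with $\alpha:(i_j)_j\to i$ in $T$ and $x_j$ an object of $X$ over $i_j$. An arrow $(\alpha,(x_j)_j)\to(\beta,(y_j)_j)$ is a pair $(\rho,(\gamma_j)_j)$ with $\rho$ a permutation such that $\alpha=\beta\rho$ and $\gamma_j:x_j\to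 y_{\rho j}$ in $X$. The unit is $x\mapsto(1_i,(x))$ and the multiplication is given by substitution. An arrow $(\rho,(\gamma_j)_j)$ is permutative if all $\gamma_j$ are identities, and levelwise if $\rho$ is. The full subcategories $T^{[1]}_\Sigma X\subseteq (TX)^{[1]}$ of the arrow categories, on the permutative arrows, form a 2-monad $T^{[1]}_\Sigma$. Domain and codomain form morphisms of 2-monads $d_T,c_T:T^{[1]}_\Sigma\to T$, and the permutative arrows themselves are the components of a 2-cell $\alpha_T:d_T\Rightarrow c_T$ of $\mathrm{Mnd}(\mathbf{Cat}/I)$. A coidentifier of $\alpha_T$ is a morphism $q_T:T\to T/\Sigma$ of 2-monads such that $q_T\alpha_T$ is an identity and such that, for every 2-monad $R$, composition with $q_T$ is an isomorphism of categories from $\mathrm{Mnd}(\mathbf{Cat}/I)(T/\Sigma,R)$ onto the full subcategory of $\mathrm{Mnd}(\mathbf{Cat}/I)(T,R)$ on those $h$ for which $h\alpha_T$ is an identity. It is called reflexive if there is a morphism of 2-monads $s:T\to T^{[1]}_\Sigma$ with $d_Ts=c_Ts=1_T$ and $\alpha_Ts$ an identity. A lax morphism $H:T\to\underline{\mathbf{Cat}}$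 consists of categories $H_i$ ($i\in I$), functors $H_\alpha:\prod_jH_{i_j}\to H_i$ for $\alpha:(i_j)_j\to i$ in $T$, and natural transformations $$\xi_{\alpha,\rho}:H_{\alpha\rho}c_\rho\to H_\alpha,\qquad \nu_i:1_{H_i}\to H_{1_i},\qquad \sigma_{\alpha,(\beta_j)_j}:H_\alpha\Big(\prod_jH_{\beta_j}\Big)\to H_{\alpha(\beta_j)_j}$$ (symmetries, units, substitutions), where $c_\rho$ permutes the factors of the product, such that: - $\xi_{\alpha,1}=\mathrm{id}$ and $\xi_{\alpha,\rho_1\rho_2}=\xi_{\alpha,\rho_1}(\xi_{\alpha\rho_1,\rho_2}c_{\rho_1})$; - the composites $H_\alpha\to H_\alpha\prod_jH_{1_{i_j}}\to H_{\alpha(1_{i_j})_j}=H_\alpha$ and $H_\alpha\to H_{1_i}H_\alpha\to H_{1_i(\alpha)}=H_\alpha$ are identities; - the two composites $H_\alpha\prod_jH_{\beta_j}\prod_{j,k}H_{\gamma_{jk}}\to H_{\alpha(\beta_j(\gamma_{jk})_k)_j}$ of substitutions agree; - substitutions are compatible with symmetries, modulo $(\alpha\rho)(\beta_{\rho j}\rho_j)_j=(\alpha(\beta_j)_j)(\rho(\rho_j)_j)$.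 It is a pseudo (respectively strict) morphism if all $\nu_i$ and $\sigma_{\alpha,(\beta_j)_j}$ are invertible (respectively identities), and commutative if all symmetries are identities. Theorem. Let $T$ be an operad with set of colours $I$. 1. The 2-cell $\alpha_T$ is reflexive and has a coidentifier in $\mathrm{Mnd}(\mathbf{Cat}/I)$. For the remaining parts, let $q_T:T\to T/\Sigma$ be any such coidentifier. 2. For every $H\in\mathbf{Cat}/I$ there is a bijection between lax $T/\Sigma$-algebra structures $(a,\bar a_0,\bar a_2)$ on $H$ and commutative lax morphisms $T\to\underline{\mathbf{Cat}}$ whose underlying categories are the fibres $H_i$. Under it, pseudo algebra structures correspond to pseudo morphisms, and strict algebra structures to strict morphisms. The bijection is given as follows: the functors $H_\alpha$ are the values of $a\,q_{T,H}:TH\to H$ at the objects $(\alpha,(x_j)_j)$ and at the levelwise arrows; the symmetries are its values at permutative arrows; and the units and substitutions are the components of $\bar a_0$, and those of $\bar a_2$ at the images of the objects $(\alpha,(\beta_j,(x_{jk})_k)_j)$ of $TTH$. 3. On $I$-indexed families of sets, regarded as objects of $\mathbf{Cat}/I$ with discrete fibres, $T/\Sigma$ agrees with the standard monad of the operad, given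 by $$X\longmapsto\Big(\coprod_{n\in\mathbb N}\Big(\coprod_{i_1,\dots,i_n}T((i_j)_j;i)\times\prod_{j=1}^nX_{i_j}\Big)\Big/\Sigma_n\Big)_{i\in I}$$ with unit and multiplication induced by the units and substitution of $T$. That is, there are isomorphisms in $\mathbf{Cat}/I$ between the two, natural in $X$, compatible with the units and multiplications of the monads, and identifying $q_T$ on objects with the map sending $(\alpha,(x_j)_j)$ to its orbit. -/

import Mathlib

open CategoryTheory Bicategory

universe w v u

set_option linter.unusedVariables false

namespace CatOperads

/-! ## Strict equality of arrows -/

section Arrows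

variable {C : Type u} [Category.{v} C]

/-- The arrow `f` is an identity: its source and target coincide, and modulo this coincidence
`f` is the identity arrow. -/
def IsIdentity {x y : C} (f : x ⟶ y) : Prop :=
  ∃ h : x = y, f = eqToHom h

/-- The arrows `f` and `g` coincide: they have the same source, the same target, and are equal. -/
def SameArrow {x y x' y' : C} (f : x ⟶ y) (g : x' ⟶ y') : Prop :=
  Arrow.mk f = Arrow.mk g

lemma SameArrow.functor_ext {D : Type*} [Category* D] {F G : D ⥤ C}
    (h : ∀ {x y : D} (f : x ⟶ y), SameArrow (F.map f) (G.map f)) : F = G := by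
  refine CategoryTheory.Functor.ext (fun x => congrArg Comma.left (h (𝟙 x))) fun x y f => ?_
  obtain ⟨h₁, h₂, h₃⟩ := (Arrow.mk_eq_mk_iff _ _).1 (h f)
  exact h₃

lemma SameArrow.isIdentity_iff {x y x' y' : C} {f : x ⟶ y} {g : x' ⟶ y'} (h : SameArrow f g) :
    IsIdentity f ↔ IsIdentity g := by
  obtain ⟨h₁, h₂, rfl⟩ := (Arrow.mk_eq_mk_iff _ _).1 h
  subst h₁ h₂
  simp

lemma SameArrow.map {D : Type*} [Category* D] (F : C ⥤ D) {x y x' y' : C} {f : x ⟶ y} {g : x' ⟶ y'}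
    (h : SameArrow f g) : SameArrow (F.map f) (F.map g) := by
  obtain ⟨h₁, h₂, rfl⟩ := (Arrow.mk_eq_mk_iff _ _).1 h
  subst h₁ h₂
  simp [SameArrow]

lemma SameArrow.comp {x y z x' y' z' : C} {f : x ⟶ y} {g : x' ⟶ y'} {k : y ⟶ z} {l : y' ⟶ z'}
    (h : SameArrow f g) (h' : SameArrow k l) : SameArrow (f ≫ k) (g ≫ l) := by
  obtain ⟨h₁, h₂, rfl⟩ := (Arrow.mk_eq_mk_iff _ _).1 h
  obtain ⟨h₃, h₄, rfl⟩ := (Arrow.mk_eq_mk_iff _ _).1 h'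
  subst h₁ h₂ h₄
  simp [SameArrow]

lemma SameArrow.functor_map {D : Type*} [Category* D] {F G : D ⥤ C} (h : F = G) {x y : D}
    (f : x ⟶ y) : SameArrow (F.map f) (G.map f) := by
  subst h; rfl

lemma SameArrow.rfl {x y : C} {f : x ⟶ y} : SameArrow f f := Eq.refl _

lemma SameArrow.of_eq {x y : C} {f g : x ⟶ y} (h : f = g) : SameArrow f g := congrArg Arrow.mk h

lemma sameArrow_eqToHom {x y z : C} (h : x = y) (h' : x = z) :
    SameArrow (eqToHom h) (eqToHom h') := by
  subst h h'; rfl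

lemma sameArrow_eqToHom_comp {x y z : C} (h : x = y) (f : y ⟶ z) :
    SameArrow (eqToHom h ≫ f) f := by
  subst h; simp [SameArrow]

lemma sameArrow_comp_eqToHom {x y z : C} (f : x ⟶ y) (h : y = z) :
    SameArrow (f ≫ eqToHom h) f := by
  subst h; simp [SameArrow]

end Arrows

/-! ## 2-monads on a strict 2-category -/

section TwoMonads

variable (K : Type u) [Bicategory.{w, v} K] [Bicategory.Strict K]

/-- A 2-monad on the 2-category `K`: a 2-functor `T : K ⥤ K` with 2-natural transformations
`unit : 1 ⟶ T` and `mult : T T ⟶ T` satisfying the strict monad laws. -/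
structure TwoMonad where
  T : StrictPseudofunctor K K
  unit (X : K) : X ⟶ T.obj X
  unit_naturality {X Y : K} (f : X ⟶ Y) : f ≫ unit Y = unit X ≫ T.map f
  unit_naturality₂ {X Y : K} {f g : X ⟶ Y} (θ : f ⟶ g) :
    SameArrow (θ ▷ unit Y) (unit X ◁ T.map₂ θ)
  mult (X : K) : T.obj (T.obj X) ⟶ T.obj X
  mult_naturality {X Y : K} (f : X ⟶ Y) : T.map (T.map f) ≫ mult Y = mult X ≫ T.map f
  mult_naturality₂ {X Y : K} {f g : X ⟶ Y} (θ : f ⟶ g) :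
    SameArrow (T.map₂ (T.map₂ θ) ▷ mult Y) (mult X ◁ T.map₂ θ)
  unit_mult (X : K) : unit (T.obj X) ≫ mult X = 𝟙 (T.obj X)
  map_unit_mult (X : K) : T.map (unit X) ≫ mult X = 𝟙 (T.obj X)
  assoc (X : K) : T.map (mult X) ≫ mult X = mult (T.obj X) ≫ mult X

variable {K}

namespace TwoMonad

/-- 1-cells of the 2-category `Mnd(K)`: (strict) morphisms of 2-monads, i.e. 2-natural
transformations compatible with units and multiplications. -/
@[ext]
structure Hom (S T : TwoMonad K) where
  app (X : K) : S.T.obj X ⟶ T.T.obj X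
  naturality {X Y : K} (f : X ⟶ Y) : S.T.map f ≫ app Y = app X ≫ T.T.map f
  naturality₂ {X Y : K} {f g : X ⟶ Y} (θ : f ⟶ g) :
    SameArrow (S.T.map₂ θ ▷ app Y) (app X ◁ T.T.map₂ θ)
  unit_app (X : K) : S.unit X ≫ app X = T.unit X
  mult_app (X : K) : S.mult X ≫ app X = S.T.map (app X) ≫ app (T.T.obj X) ≫ T.mult X

/-- 2-cells of the 2-category `Mnd(K)` (2-monad 2-cells): modifications compatible with
units and multiplications. -/
@[ext]
structure Cell {S T : TwoMonad K} (φ ψ : Hom S T) where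
  app (X : K) : φ.app X ⟶ ψ.app X
  naturality {X Y : K} (f : X ⟶ Y) : SameArrow (S.T.map f ◁ app Y) (app X ▷ T.T.map f)
  unit_app (X : K) : IsIdentity (S.unit X ◁ app X)
  mult_app (X : K) :
    SameArrow (S.mult X ◁ app X)
      (S.T.map₂ (app X) ▷ (φ.app (T.T.obj X) ≫ T.mult X) ≫
        S.T.map (ψ.app X) ◁ (app (T.T.obj X) ▷ T.mult X))

end TwoMonad
end TwoMonads

/-! ## The 2-category `Cat/I` for a set `I` -/

/-- An object of `Cat/I`: a small category with a functor to the discrete category on `I`. -/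
structure CatOver (I : Type u) where
  carrier : Type u
  [cat : Category.{u} carrier]
  proj : carrier ⥤ Discrete I

namespace CatOver

variable {I : Type u}

instance : CoeSort (CatOver I) (Type u) := ⟨carrier⟩

instance (X : CatOver I) : Category.{u} X := X.cat

/-- The element of `I` over which the object `x` lives. -/
def col (X : CatOver I) (x : X) : I := (X.proj.obj x).as

/-- A 1-cell of `Cat/I`: a functor commuting strictly with the projections to `I`. -/
@[ext]
structure Hom (X Y : CatOver I) where
  functor : X ⥤ Y
  w : functor ⋙ Y.proj = X.proj

/-- A 2-cell of `Cat/I`: a natural transformation. (It lies over the identity of the projection to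
`I` automatically, since `I` is discrete.) -/
@[ext]
structure Cell {X Y : CatOver I} (F G : Hom X Y) where
  nat : F.functor ⟶ G.functor

instance : CategoryStruct (CatOver I) where
  Hom := Hom
  id X := ⟨𝟭 X, rfl⟩
  comp F G := ⟨F.functor ⋙ G.functor, by rw [Functor.assoc, G.w, F.w]⟩

instance (X Y : CatOver I) : Category (X ⟶ Y) where
  Hom F G := Cell F G
  id F := ⟨𝟙 F.functor⟩
  comp θ θ' := ⟨θ.nat ≫ θ'.nat⟩
  id_comp _ := Cell.ext (Category.id_comp _)
  comp_id _ := Cell.ext (Category.comp_id _)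
  assoc _ _ _ := Cell.ext (Category.assoc _ _ _)

section
variable {X Y Z : CatOver I}

@[simp] lemma id_functor : Hom.functor (𝟙 X) = 𝟭 X := rfl
@[simp] lemma comp_functor (F : X ⟶ Y) (G : Y ⟶ Z) :
    Hom.functor (F ≫ G) = F.functor ⋙ G.functor := rfl
@[simp] lemma id_nat (F : X ⟶ Y) : Cell.nat (𝟙 F) = 𝟙 F.functor := rfl
@[simp] lemma comp_nat {F G H : X ⟶ Y} (θ : F ⟶ G) (θ' : G ⟶ H) :
    Cell.nat (θ ≫ θ') = θ.nat ≫ θ'.nat := rfl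

lemma hom_ext {F G : X ⟶ Y} (h : F.functor = G.functor) : F = G := Hom.ext h

lemma cell_ext {F G : X ⟶ Y} {θ θ' : F ⟶ G} (h : ∀ x, θ.nat.app x = θ'.nat.app x) : θ = θ' :=
  Cell.ext (NatTrans.ext (funext h))

end

/-- Whiskering of a 2-cell by a 1-cell on the side of its source. -/
def whiskL {X Y Z : CatOver I} (F : X ⟶ Y) {G H : Y ⟶ Z} (θ : G ⟶ H) : (F ≫ G) ⟶ (F ≫ H) :=
  Cell.mk (Functor.whiskerLeft F.functor θ.nat)

/-- Whiskering of a 2-cell by a 1-cell on the side of its target. -/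
def whiskR {X Y Z : CatOver I} {F G : X ⟶ Y} (θ : F ⟶ G) (H : Y ⟶ Z) : (F ≫ H) ⟶ (G ≫ H) :=
  Cell.mk (Functor.whiskerRight θ.nat H.functor)

instance : Bicategory (CatOver I) where
  homCategory X Y := inferInstance
  whiskerLeft F _ _ θ := whiskL F θ
  whiskerRight θ G := whiskR θ G
  associator F G H := Iso.refl (F ≫ G ≫ H)
  leftUnitor F := Iso.refl F
  rightUnitor F := Iso.refl F
  whiskerLeft_id _ _ := cell_ext fun _ => rfl
  whiskerLeft_comp _ _ _ _ _ _ := cell_ext fun _ => rfl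
  id_whiskerLeft _ := cell_ext fun _ => ((Category.id_comp _).trans (Category.comp_id _)).symm
  comp_whiskerLeft _ _ _ _ _ := cell_ext fun _ => ((Category.id_comp _).trans (Category.comp_id _)).symm
  id_whiskerRight _ H := cell_ext fun _ => H.functor.map_id _
  comp_whiskerRight _ _ H := cell_ext fun _ => H.functor.map_comp _ _
  whiskerRight_id _ := cell_ext fun _ => ((Category.id_comp _).trans (Category.comp_id _)).symm
  whiskerRight_comp _ _ _ := cell_ext fun _ => ((Category.id_comp _).trans (Category.comp_id _)).symm
  whisker_assoc _ _ _ _ _ := cell_ext fun _ => ((Category.id_comp _).trans (Category.comp_id _)).symm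
  whisker_exchange θ η := cell_ext fun _ => (η.nat.naturality _).symm
  pentagon F G H L := cell_ext fun x => by
    change (L.functor.map (𝟙 _) ≫ 𝟙 _ ≫ 𝟙 _ : _ ⟶ _) = 𝟙 _ ≫ 𝟙 _
    simp
  triangle F G := cell_ext fun x => by
    change (𝟙 _ ≫ 𝟙 _ : _ ⟶ _) = G.functor.map (𝟙 _)
    simp

@[simp] lemma whiskerLeft_nat {X Y Z : CatOver I} (F : X ⟶ Y) {G H : Y ⟶ Z} (θ : G ⟶ H) :
    Cell.nat (F ◁ θ) = Functor.whiskerLeft F.functor θ.nat := rfl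
@[simp] lemma whiskerRight_nat {X Y Z : CatOver I} {F G : X ⟶ Y} (θ : F ⟶ G) (H : Y ⟶ Z) :
    Cell.nat (θ ▷ H) = Functor.whiskerRight θ.nat H.functor := rfl

lemma sameArrow_cell {X Y : CatOver I} {F G F' G' : X ⟶ Y} {θ : F ⟶ G} {θ' : F' ⟶ G'}
    (hF : F.functor = F'.functor) (hG : G.functor = G'.functor)
    (h : ∀ x, SameArrow (θ.nat.app x) (θ'.nat.app x)) : SameArrow θ θ' := by
  obtain rfl : F = F' := hom_ext hF
  obtain rfl : G = G' := hom_ext hG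
  obtain rfl : θ = θ' := cell_ext fun x => Arrow.mk_injective _ _ (h x)
  rfl

instance : Bicategory.Strict (CatOver I) where
  id_comp _ := rfl
  comp_id _ := rfl
  assoc _ _ _ := rfl
  leftUnitor_eqToIso _ := rfl
  rightUnitor_eqToIso _ := rfl
  associator_eqToIso _ _ _ := rfl

end CatOver

/-! ## Operads -/

/-- The colour function of the concatenation of the sequences `d j`, `j = 1, …, n`. -/
def concatFun {n : ℕ} {m : Fin n → ℕ} {A : Type u} (d : ∀ j, Fin (m j) → A) :
    Fin (∑ j, m j) → A :=
  fun l => d (finSigmaFinEquiv.symm l).1 (finSigmaFinEquiv.symm l).2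

/-- The block permutation `ρ(ρ_j)_j` of concatenated sequences: permute the blocks with `ρ`, and
the elements inside the blocks with the `ρ_j`. -/
def blockPerm {n n' : ℕ} {m : Fin n → ℕ} {m' : Fin n' → ℕ} (ρ : Fin n' ≃ Fin n)
    (ρs : ∀ j, Fin (m' j) ≃ Fin (m (ρ j))) : Fin (∑ j, m' j) ≃ Fin (∑ j, m j) :=
  finSigmaFinEquiv.symm.trans ((Equiv.sigmaCongr ρ ρs).trans finSigmaFinEquiv)

/-- An arrow of a family of sets `T((c_j)_j; i)`, together with its source and its target. -/
structure Arr {I : Type u} (A : {n : ℕ} → (Fin n → I) → I → Type u) where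
  n : ℕ
  src : Fin n → I
  tgt : I
  hom : A src tgt

/-- An arrow, regarded together with its source and its target. -/
abbrev toArr {I : Type u} {A : {n : ℕ} → (Fin n → I) → I → Type u} {n : ℕ} {c : Fin n → I} {i : I}
    (α : A c i) : Arr A := ⟨n, c, i, α⟩

/-- A (symmetric, coloured) operad with set of colours `I`. The symmetric group actions
`α ↦ αρ` are indexed by the bijections `ρ : Fin m ≃ Fin n`; these exist only for `m = n`.
An equality `toArr α = toArr β` says that `α` and `β` have the same source and the same target
and that they are equal. -/
structure Operad (I : Type u) where
  Hom {n : ℕ} (c : Fin n → I) (i : I) : Type u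
  act {m n : ℕ} {c : Fin n → I} {i : I} (ρ : Fin m ≃ Fin n) (α : Hom c i) : Hom (c ∘ ρ) i
  act_refl {n : ℕ} {c : Fin n → I} {i : I} (α : Hom c i) : act (Equiv.refl (Fin n)) α = α
  act_act {l m n : ℕ} {c : Fin n → I} {i : I} (α : Hom c i) (ρ₁ : Fin m ≃ Fin n)
    (ρ₂ : Fin l ≃ Fin m) : act ρ₂ (act ρ₁ α) = act (ρ₂.trans ρ₁) α
  one (i : I) : Hom (fun _ : Fin 1 => i) i
  comp {n : ℕ} {c : Fin n → I} {i : I} {m : Fin n → ℕ} {d : ∀ j, Fin (m j) → I}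
    (α : Hom c i) (β : ∀ j, Hom (d j) (c j)) : Hom (concatFun d) i
  one_comp {n : ℕ} {c : Fin n → I} {i : I} (α : Hom c i) :
    toArr (A := Hom) (comp (one i) (fun _ => α)) = toArr α
  comp_one {n : ℕ} {c : Fin n → I} {i : I} (α : Hom c i) :
    toArr (A := Hom) (comp α (fun j => one (c j))) = toArr α
  comp_comp {n : ℕ} {c : Fin n → I} {i : I} {m : Fin n → ℕ} {d : ∀ j, Fin (m j) → I}
    {p : ∀ j, Fin (m j) → ℕ} {e : ∀ j k, Fin (p j k) → I}
    (α : Hom c i) (β : ∀ j, Hom (d j) (c j)) (γ : ∀ j k, Hom (e j k) (d j k)) :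
    toArr (A := Hom) (comp α (fun j => comp (β j) (γ j))) =
      toArr (comp (comp α β)
        (fun l => γ (finSigmaFinEquiv.symm l).1 (finSigmaFinEquiv.symm l).2))
  comp_act {n n' : ℕ} {c : Fin n → I} {i : I} {m : Fin n → ℕ} {d : ∀ j, Fin (m j) → I}
    {m' : Fin n' → ℕ} (α : Hom c i) (β : ∀ j, Hom (d j) (c j))
    (ρ : Fin n' ≃ Fin n) (ρs : ∀ j, Fin (m' j) ≃ Fin (m (ρ j))) :
    toArr (A := Hom) (comp (act ρ α) (fun j => act (ρs j) (β (ρ j)))) =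
      toArr (act (blockPerm ρ ρs) (comp α β))

namespace Operad

variable {I : Type u} (T : Operad I)

end Operad

/-! ## The 2-monad of an operad -/

section Arithmetic

lemma finSigma_lt_iff {n : ℕ} {m : Fin n → ℕ} (x y : Σ j, Fin (m j)) :
    finSigmaFinEquiv x < finSigmaFinEquiv y ↔
      x.1 < y.1 ∨ (x.1 = y.1 ∧ x.2.val < y.2.val) := by
  have key : ∀ x y : Σ j, Fin (m j), x.1 < y.1 → finSigmaFinEquiv x < finSigmaFinEquiv y := by
    rintro ⟨j, k⟩ ⟨j', k'⟩ h
    rw [Fin.lt_def, finSigmaFinEquiv_apply, finSigmaFinEquiv_apply]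
    have h' : j.val + 1 ≤ j'.val := h
    have := Finset.sum_le_sum_of_subset (f := fun i : ℕ => if hi : i < n then m ⟨i, hi⟩ else 0)
      (Finset.range_mono h')
    rw [Finset.sum_range_succ, Finset.sum_range, Finset.sum_range] at this
    have e : ∀ a : Fin n, ∑ i : Fin a.val, m (Fin.castLE a.2.le i) =
        ∑ i : Fin a.val, if hi : i.val < n then m ⟨i.val, hi⟩ else 0 := by
      intro a
      refine Finset.sum_congr rfl fun i _ => ?_
      rw [dif_pos (i.2.trans a.2)]
      rfl
    have hk := k.2
    rw [dif_pos j.2] at this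
    rw [e, e]
    exact lt_of_lt_of_le (Nat.add_lt_add_left hk _) (this.trans (Nat.le_add_right _ _))
  constructor
  · intro h
    rcases lt_trichotomy x.1 y.1 with h' | h' | h'
    · exact Or.inl h'
    · refine Or.inr ⟨h', ?_⟩
      obtain ⟨j, k⟩ := x
      obtain ⟨j', k'⟩ := y
      obtain rfl : j = j' := h'
      rw [Fin.lt_def, finSigmaFinEquiv_apply, finSigmaFinEquiv_apply] at h
      simpa using h
    · exact absurd (key _ _ h') h.asymm
  · rintro (h | ⟨h, h'⟩)
    · exact key _ _ h
    · obtain ⟨j, k⟩ := x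
      obtain ⟨j', k'⟩ := y
      obtain rfl : j = j' := h
      rw [Fin.lt_def, finSigmaFinEquiv_apply, finSigmaFinEquiv_apply]
      simpa using h'

lemma val_eq_of_lt_iff {A : Type*} {n m : ℕ} (e : A ≃ Fin n) (f : A ≃ Fin m)
    (h : ∀ a b, e a < e b ↔ f a < f b) (a : A) : (e a).val = (f a).val := by
  classical
  have : Fintype A := Fintype.ofEquiv _ e.symm
  have h₁ : ∀ {k : ℕ} (g : A ≃ Fin k), (g a).val = (Finset.univ.filter fun b => g b < g a).card := by
    intro k g
    rw [← Finset.card_map g.toEmbedding, ← Fin.card_Iio]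
    congr 1
    ext x
    simp only [Finset.mem_Iio, Finset.mem_map, Finset.mem_filter, Finset.mem_univ, true_and]
    exact ⟨fun hx => ⟨g.symm x, by simpa using hx, by simp⟩, by rintro ⟨b, hb, rfl⟩; exact hb⟩
  rw [h₁ e, h₁ f]
  simp only [h]

lemma finSigma_assoc_aux {n : ℕ} {m : Fin n → ℕ} {p : ∀ j, Fin (m j) → ℕ} (x y : Σ j, Fin (m j))
    (l : Fin (p x.1 x.2)) (l' : Fin (p y.1 y.2)) :
    ((x.1 < y.1 ∨ x.1 = y.1 ∧ x.2.val < y.2.val) ∨ x = y ∧ l.val < l'.val) ↔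
      (x.1 < y.1 ∨ x.1 = y.1 ∧
        (finSigmaFinEquiv (⟨x.2, l⟩ : Σ k, Fin (p x.1 k))).val <
        (finSigmaFinEquiv (⟨y.2, l'⟩ : Σ k, Fin (p y.1 k))).val) := by
  obtain ⟨j, k⟩ := x
  obtain ⟨j', k'⟩ := y
  dsimp only at l l' ⊢
  constructor
  · rintro ((h | ⟨h, h'⟩) | ⟨h, h'⟩)
    · exact Or.inl h
    · obtain rfl : j = j' := h
      exact Or.inr ⟨rfl, by rw [← Fin.lt_def, finSigma_lt_iff]; exact Or.inl h'⟩
    · obtain ⟨rfl, h⟩ := Sigma.mk.inj h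
      obtain rfl := eq_of_heq h
      refine Or.inr ⟨rfl, ?_⟩
      rw [← Fin.lt_def, finSigma_lt_iff]
      exact Or.inr ⟨rfl, h'⟩
  · rintro (h | ⟨h, h'⟩)
    · exact Or.inl (Or.inl h)
    · obtain rfl : j = j' := h
      rw [← Fin.lt_def, finSigma_lt_iff] at h'
      rcases h' with h' | ⟨h', h''⟩
      · exact Or.inl (Or.inr ⟨rfl, h'⟩)
      · obtain rfl : k = k' := h'
        exact Or.inr ⟨rfl, h''⟩

/-- Concatenation of sequences of sequences of sequences is associative. -/
lemma finSigma_assoc {n : ℕ} {m : Fin n → ℕ} {p : ∀ j, Fin (m j) → ℕ} (a : Fin (∑ j, m j))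
    (l : Fin (p (finSigmaFinEquiv.symm a).1 (finSigmaFinEquiv.symm a).2)) :
    (finSigmaFinEquiv (⟨a, l⟩ : Σ a : Fin (∑ j, m j),
        Fin (p (finSigmaFinEquiv.symm a).1 (finSigmaFinEquiv.symm a).2))).val =
      (finSigmaFinEquiv (⟨(finSigmaFinEquiv.symm a).1,
        finSigmaFinEquiv ⟨(finSigmaFinEquiv.symm a).2, l⟩⟩ : Σ j, Fin (∑ k, p j k))).val := by
  let f : (Σ a : Fin (∑ j, m j),
      Fin (p (finSigmaFinEquiv.symm a).1 (finSigmaFinEquiv.symm a).2)) ≃ Fin (∑ j, ∑ k, p j k) :=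
    ((Equiv.sigmaCongrLeft (β := fun x : Σ j, Fin (m j) => Fin (p x.1 x.2))
      (finSigmaFinEquiv (n := m)).symm).trans (Equiv.sigmaAssoc fun j k => Fin (p j k))).trans
    ((Equiv.sigmaCongrRight fun j => finSigmaFinEquiv (n := p j)).trans finSigmaFinEquiv)
  have hf : ∀ x, f x = finSigmaFinEquiv ⟨(finSigmaFinEquiv.symm x.1).1,
      finSigmaFinEquiv ⟨(finSigmaFinEquiv.symm x.1).2, x.2⟩⟩ := fun x => rfl
  refine val_eq_of_lt_iff finSigmaFinEquiv f (fun x y => ?_) ⟨a, l⟩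
  rw [hf, hf]
  obtain ⟨a, l⟩ := x
  obtain ⟨b, l'⟩ := y
  have h₁ := finSigma_lt_iff (finSigmaFinEquiv.symm a) (finSigmaFinEquiv.symm b)
  rw [Equiv.apply_symm_apply, Equiv.apply_symm_apply] at h₁
  have h₂ : a = b ↔ finSigmaFinEquiv.symm a = finSigmaFinEquiv.symm b :=
    (EmbeddingLike.apply_eq_iff_eq _).symm
  rw [finSigma_lt_iff, finSigma_lt_iff]
  dsimp only at l l' ⊢
  rw [h₁, h₂]
  exact finSigma_assoc_aux _ _ l l'

end Arithmetic

namespace Operad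

variable {I : Type u} (T : Operad I)

/-- The action of bijections on arrows with arbitrary source and target. -/
def actArr (a : Arr T.Hom) {m : ℕ} (ρ : Fin m ≃ Fin a.n) : Arr T.Hom := toArr (T.act ρ a.hom)

/-- Composition of arrows with arbitrary source and target. -/
def compArr (a : Arr T.Hom) (b : Fin a.n → Arr T.Hom) (h : ∀ j, (b j).tgt = a.src j) :
    Arr T.Hom :=
  toArr (T.comp (d := fun j => (b j).src) a.hom fun j => h j ▸ (b j).hom)

variable {T}

lemma actArr_refl (a : Arr T.Hom) : T.actArr a (Equiv.refl _) = a := by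
  obtain ⟨n, c, i, α⟩ := a
  exact congrArg (fun α => Arr.mk n c i α) (T.act_refl α)

lemma actArr_actArr (a : Arr T.Hom) {m l : ℕ} (ρ₁ : Fin m ≃ Fin a.n) (ρ₂ : Fin l ≃ Fin m) :
    T.actArr (T.actArr a ρ₁) ρ₂ = T.actArr a (ρ₂.trans ρ₁) := by
  obtain ⟨n, c, i, α⟩ := a
  exact congrArg (fun α => Arr.mk l _ i α) (T.act_act α ρ₁ ρ₂)

lemma arr_eq_trans {a b c : Arr T.Hom} {ρ : Fin a.n ≃ Fin b.n} {σ : Fin b.n ≃ Fin c.n}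
    (h : a = T.actArr b ρ) (h' : b = T.actArr c σ) : a = T.actArr c (ρ.trans σ) := by
  rw [← actArr_actArr c σ]
  have key : ∀ (b' : Arr T.Hom) (e : b = b'), T.actArr b ρ = T.actArr b' (e ▸ ρ) := by
    rintro b' rfl; rfl
  refine (h.trans (key _ h')).trans ?_
  congr 1
  have key₂ : ∀ (b' : Arr T.Hom) (e : b = b') (e' : Fin a.n ≃ Fin b'.n), (∀ x, (e' x).val = (ρ x).val) →
      e ▸ ρ = e' := by
    rintro b' rfl e' h
    exact Equiv.ext fun x => Fin.ext (h x).symm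
  exact key₂ _ h' ρ fun _ => rfl

lemma exists_rep {n : ℕ} {c : Fin n → I} (b : Fin n → Arr T.Hom) (h : ∀ j, (b j).tgt = c j) :
    ∃ (m : Fin n → ℕ) (d : ∀ j, Fin (m j) → I) (β : ∀ j, T.Hom (d j) (c j)),
      b = fun j => Arr.mk (m j) (d j) (c j) (β j) := by
  have key : ∀ (a : Arr T.Hom) (i : I) (h : a.tgt = i), a = ⟨a.n, a.src, i, h ▸ a.hom⟩ := by
    rintro a i rfl
    rfl
  exact ⟨fun j => (b j).n, fun j => (b j).src, fun j => h j ▸ (b j).hom,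
    funext fun j => key _ _ (h j)⟩

lemma compArr_mk {n : ℕ} {c : Fin n → I} {i : I} (α : T.Hom c i) {m : Fin n → ℕ}
    {d : ∀ j, Fin (m j) → I} (β : ∀ j, T.Hom (d j) (c j)) :
    T.compArr ⟨n, c, i, α⟩ (fun j => ⟨m j, d j, c j, β j⟩) (fun _ => rfl) =
      toArr (T.comp α β) := rfl

lemma compArr_one (a : Arr T.Hom) :
    T.compArr a (fun j => toArr (T.one (a.src j))) (fun _ => rfl) = a := by
  obtain ⟨n, c, i, α⟩ := a
  exact T.comp_one α

lemma one_compArr (a : Arr T.Hom) {i : I} (h : a.tgt = i) :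
    T.compArr (toArr (T.one i)) (fun _ => a) (fun _ => h) = a := by
  obtain ⟨n, c, i, α⟩ := a
  obtain rfl := h
  exact T.one_comp α

lemma compArr_compArr (a : Arr T.Hom) (b : Fin a.n → Arr T.Hom) (h : ∀ j, (b j).tgt = a.src j)
    (e : ∀ j, Fin (b j).n → Arr T.Hom) (h' : ∀ j k, (e j k).tgt = (b j).src k) :
    T.compArr a (fun j => T.compArr (b j) (e j) (h' j)) h =
      T.compArr (T.compArr a b h)
        (fun l => e (finSigmaFinEquiv.symm l).1 (finSigmaFinEquiv.symm l).2) (fun _ => h' _ _) := by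
  obtain ⟨n, c, i, α⟩ := a
  obtain ⟨m, d, β, rfl⟩ := exists_rep b h
  have : ∃ (p : ∀ j, Fin (m j) → ℕ) (d' : ∀ j k, Fin (p j k) → I)
      (γ : ∀ j k, T.Hom (d' j k) (d j k)), e = fun j k => Arr.mk (p j k) (d' j k) (d j k) (γ j k) := by
    choose p d' γ hγ using fun j => exists_rep (e j) (h' j)
    exact ⟨p, d', γ, funext hγ⟩
  obtain ⟨p, d', γ, rfl⟩ := this
  exact T.comp_comp α β γ

lemma compArr_actArr (a : Arr T.Hom) (b : Fin a.n → Arr T.Hom) (h : ∀ j, (b j).tgt = a.src j)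
    {n' : ℕ} (ρ : Fin n' ≃ Fin a.n) {m' : Fin n' → ℕ} (ρs : ∀ j, Fin (m' j) ≃ Fin (b (ρ j)).n) :
    T.compArr (T.actArr a ρ) (fun j => T.actArr (b (ρ j)) (ρs j)) (fun j => h (ρ j)) =
      T.actArr (T.compArr a b h) (blockPerm ρ ρs) := by
  obtain ⟨n, c, i, α⟩ := a
  obtain ⟨m, d, β, rfl⟩ := exists_rep b h
  exact T.comp_act α β ρ ρs

lemma compArr_congr {a a' : Arr T.Hom} {b : Fin a.n → Arr T.Hom} {b' : Fin a'.n → Arr T.Hom}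
    {h : ∀ j, (b j).tgt = a.src j} {h' : ∀ j, (b' j).tgt = a'.src j} (e : a = a')
    (e' : ∀ j, b j = b' (Fin.cast (by rw [e]) j)) : T.compArr a b h = T.compArr a' b' h' := by
  subst e
  obtain rfl : b = b' := funext e'
  rfl

variable (T)

/-- An operation of `T` labelled in `X`: a pair `(α, (x_j)_j)` where `α : (i_j)_j ⟶ i` is an arrow
of `T` and `x_j` is an object of `X` over `i_j`. -/
structure Lab (X : CatOver I) where
  arr : Arr T.Hom
  label : Fin arr.n → X
  col_label (j : Fin arr.n) : X.col (label j) = arr.src j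

variable {T}

/-- A morphism `(α, (x_j)_j) ⟶ (β, (y_j)_j)` of labelled operations: a pair `(ρ, (γ_j)_j)` where `ρ`
is a permutation such that `α = βρ`, and `γ_j : x_j ⟶ y_{ρ j}`. -/
structure Lab.Hom {X : CatOver I} (a b : T.Lab X) where
  perm : Fin a.arr.n ≃ Fin b.arr.n
  hom (j : Fin a.arr.n) : a.label j ⟶ b.label (perm j)
  arr_eq : a.arr = T.actArr b.arr perm

namespace Lab

variable {X Y Z : CatOver I}

lemma ext' {a b : T.Lab X} (h : a.arr = b.arr)
    (h' : ∀ j k, j.val = k.val → a.label j = b.label k) : a = b := by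
  obtain ⟨_, l, _⟩ := a
  obtain ⟨_, l', _⟩ := b
  obtain rfl := h
  obtain rfl : l = l' := funext fun j => h' j j rfl
  rfl

lemma Hom.ext' {a b : T.Lab X} {f g : Hom a b} (h : ∀ j, f.perm j = g.perm j)
    (h' : ∀ j, SameArrow (f.hom j) (g.hom j)) : f = g := by
  obtain ⟨p, l, _⟩ := f
  obtain ⟨p', l', _⟩ := g
  obtain rfl : p = p' := Equiv.ext h
  obtain rfl : l = l' := funext fun j => Arrow.mk_injective _ _ (h' j)
  rfl

instance : Category.{u} (T.Lab X) where
  Hom := Hom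
  id a := ⟨Equiv.refl _, fun _ => 𝟙 _, (actArr_refl _).symm⟩
  comp {a b c} f g := ⟨f.perm.trans g.perm, fun j => f.hom j ≫ g.hom (f.perm j),
    arr_eq_trans f.arr_eq g.arr_eq⟩
  id_comp f := Hom.ext' (fun _ => rfl) fun _ => SameArrow.of_eq (Category.id_comp _)
  comp_id f := Hom.ext' (fun _ => rfl) fun _ => SameArrow.of_eq (Category.comp_id _)
  assoc f g h := Hom.ext' (fun _ => rfl) fun _ => SameArrow.of_eq (Category.assoc _ _ _)

@[simp] lemma id_perm (a : T.Lab X) : Hom.perm (𝟙 a) = Equiv.refl _ := rfl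
@[simp] lemma id_hom (a : T.Lab X) (j) : Hom.hom (𝟙 a) j = 𝟙 (a.label j) := rfl
@[simp] lemma comp_perm {a b c : T.Lab X} (f : a ⟶ b) (g : b ⟶ c) :
    Hom.perm (f ≫ g) = f.perm.trans g.perm := rfl
@[simp] lemma comp_hom {a b c : T.Lab X} (f : a ⟶ b) (g : b ⟶ c) (j) :
    Hom.hom (f ≫ g) j = f.hom j ≫ g.hom (f.perm j) := rfl

lemma hom_ext {a b : T.Lab X} {f g : a ⟶ b} (h : ∀ j, f.perm j = g.perm j)
    (h' : ∀ j, SameArrow (f.hom j) (g.hom j)) : f = g := Hom.ext' h h'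

lemma Hom.tgt_eq {a b : T.Lab X} (f : a ⟶ b) : a.arr.tgt = b.arr.tgt :=
  (congrArg Arr.tgt f.arr_eq :)

/-- Criterion for arrows between labelled operations to coincide. -/
lemma sameArrow {a b a' b' : T.Lab X} {f : a ⟶ b} {f' : a' ⟶ b'}
    (ha : a.arr = a'.arr) (hb : b.arr = b'.arr)
    (h : ∀ j k, j.val = k.val → (f.perm j).val = (f'.perm k).val)
    (h' : ∀ j k, j.val = k.val → SameArrow (f.hom j) (f'.hom k)) : SameArrow f f' := by
  obtain rfl : a = a' := ext' ha fun j k hjk => congrArg Comma.left (h' j k hjk)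
  obtain rfl : b = b' := ext' hb fun j k hjk => by
    obtain ⟨j, rfl⟩ := f.perm.surjective j
    have := congrArg Comma.right (h' j j rfl)
    obtain rfl : f'.perm j = k := Fin.ext ((h j j rfl).symm.trans hjk)
    exact this
  obtain rfl : f = f' := hom_ext (fun j => Fin.ext (h j j rfl)) fun j => h' j j rfl
  rfl

end Lab

variable (T)

/-- The category of operations of `T` labelled in `X`, regarded as an object of `Cat/I` via the
targets of the operations. -/
abbrev labOver (X : CatOver I) : CatOver I where
  carrier := T.Lab X
  proj :=
    { obj a := ⟨a.arr.tgt⟩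
      map f := Discrete.eqToHom (Lab.Hom.tgt_eq f)
      map_id _ := Subsingleton.elim _ _
      map_comp _ _ := Subsingleton.elim _ _ }

/-- The functor `TX ⟶ TY` induced by `F : X ⟶ Y`. -/
def labMap {X Y : CatOver I} (F : X ⟶ Y) : T.labOver X ⟶ T.labOver Y where
  functor :=
    { obj a := ⟨a.arr, fun j => F.functor.obj (a.label j), fun j =>
        (congrArg Discrete.as (Functor.congr_obj F.w (a.label j))).trans (a.col_label j)⟩
      map f := ⟨f.perm, fun j => F.functor.map (f.hom j), f.arr_eq⟩
      map_id a := Lab.hom_ext (fun _ => rfl) fun j => by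
        dsimp; rw [F.functor.map_id]; exact SameArrow.rfl
      map_comp f g := Lab.hom_ext (fun _ => rfl) fun j => by
        dsimp; rw [F.functor.map_comp]; exact SameArrow.rfl }
  w := rfl

/-- The natural transformation `TF ⟶ TG` induced by `θ : F ⟶ G`. -/
def labMap₂ {X Y : CatOver I} {F G : X ⟶ Y} (θ : F ⟶ G) : T.labMap F ⟶ T.labMap G :=
  CatOver.Cell.mk
    { app a := ⟨Equiv.refl _, fun j => θ.nat.app (a.label j), (actArr_refl _).symm⟩
      naturality a b f := Lab.hom_ext (fun _ => rfl) fun j => by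
        change SameArrow (F.functor.map (f.hom j) ≫ θ.nat.app _) (θ.nat.app _ ≫ G.functor.map (f.hom j))
        rw [θ.nat.naturality]; exact SameArrow.rfl }

end Operad

namespace Operad

variable {I : Type u} (T : Operad I)

/-- The unit of the 2-monad `T`, given by `x ↦ (1_i, (x))`. -/
def labUnit (X : CatOver I) : X ⟶ T.labOver X where
  functor :=
    { obj x := ⟨toArr (T.one (X.col x)), fun _ => x, fun _ => rfl⟩
      map {x y} f := ⟨Equiv.refl _, fun _ => f, by
        have : X.col x = X.col y := Discrete.eq_of_hom (X.proj.map f)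
        dsimp only
        rw [this]
        exact (actArr_refl _).symm⟩
      map_id _ := rfl
      map_comp _ _ := rfl }
  w := CategoryTheory.Functor.ext (fun _ => rfl) fun _ _ _ => Subsingleton.elim _ _

section
variable {T} {X : CatOver I}

lemma Lab.flat_label {z' : T.labOver (T.labOver X)} (p : Σ j, Fin (z'.label j).arr.n) :
    (z'.label p.1).label p.2 =
      (z'.label (finSigmaFinEquiv.symm (finSigmaFinEquiv p)).1).label
        (finSigmaFinEquiv.symm (finSigmaFinEquiv p)).2 :=
  (congrArg (fun p : Σ j, Fin (z'.label j).arr.n => (z'.label p.1).label p.2)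
    (Equiv.symm_apply_apply finSigmaFinEquiv p)).symm

lemma Lab.flat_hom {z z' : T.labOver (T.labOver X)} (f : z ⟶ z')
    (p : Σ j, Fin (z.label j).arr.n) :
    SameArrow ((f.hom p.1).hom p.2)
      ((f.hom (finSigmaFinEquiv.symm (finSigmaFinEquiv p)).1).hom
        (finSigmaFinEquiv.symm (finSigmaFinEquiv p)).2) :=
  (congrArg (fun p : Σ j, Fin (z.label j).arr.n => Arrow.mk ((f.hom p.1).hom p.2))
    (Equiv.symm_apply_apply finSigmaFinEquiv p)).symm

lemma blockPerm_apply {n n' : ℕ} {m : Fin n → ℕ} {m' : Fin n' → ℕ} (ρ : Fin n' ≃ Fin n)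
    (ρs : ∀ j, Fin (m' j) ≃ Fin (m (ρ j))) (l : Fin (∑ j, m' j)) :
    blockPerm ρ ρs l = finSigmaFinEquiv (⟨ρ (finSigmaFinEquiv.symm l).1,
      ρs _ (finSigmaFinEquiv.symm l).2⟩ : Σ j, Fin (m j)) := rfl

end

/-- The multiplication of the 2-monad `T`, given by
`(α, (α_j, (x_jk)_k)_j) ↦ (α(α_j)_j, (x_jk)_jk)` on objects and by
`(ρ, (ρ_j, (γ_jk)_k)_j) ↦ (ρ(ρ_j)_j, (γ_jk)_jk)` on arrows. -/
def labMult (X : CatOver I) : T.labOver (T.labOver X) ⟶ T.labOver X where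
  functor :=
    { obj z :=
        { arr := T.compArr z.arr (fun j => (z.label j).arr) z.col_label
          label := fun l => (z.label (finSigmaFinEquiv.symm l).1).label (finSigmaFinEquiv.symm l).2
          col_label := fun l => (z.label (finSigmaFinEquiv.symm l).1).col_label _ }
      map {z z'} f :=
        { perm := blockPerm f.perm fun j => (f.hom j).perm
          hom := fun l => (f.hom (finSigmaFinEquiv.symm l).1).hom (finSigmaFinEquiv.symm l).2 ≫
            eqToHom (Lab.flat_label ⟨f.perm (finSigmaFinEquiv.symm l).1,
              (f.hom (finSigmaFinEquiv.symm l).1).perm (finSigmaFinEquiv.symm l).2⟩)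
          arr_eq := (compArr_congr f.arr_eq fun j => (f.hom j).arr_eq).trans
            (compArr_actArr z'.arr (fun j => (z'.label j).arr) z'.col_label f.perm
              (fun j => (f.hom j).perm)) }
      map_id z := Lab.hom_ext (fun l => finSigmaFinEquiv.apply_symm_apply l) fun l =>
        sameArrow_comp_eqToHom _ _
      map_comp {z₁ z₂ z₃} f g := by
        refine Lab.hom_ext (fun l => ?_) fun l => ?_
        · have := congrArg (fun p : Σ j, Fin (z₂.label j).arr.n =>
            finSigmaFinEquiv (⟨g.perm p.1, (g.hom p.1).perm p.2⟩ : Σ j, Fin (z₃.label j).arr.n))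
            (Equiv.symm_apply_apply finSigmaFinEquiv (⟨f.perm (finSigmaFinEquiv.symm l).1,
              (f.hom (finSigmaFinEquiv.symm l).1).perm (finSigmaFinEquiv.symm l).2⟩ :
                Σ j, Fin (z₂.label j).arr.n))
          exact this.symm
        · refine (sameArrow_comp_eqToHom _ _).trans (SameArrow.comp
            (sameArrow_comp_eqToHom _ _).symm ?_)
          exact (Lab.flat_hom g ⟨f.perm (finSigmaFinEquiv.symm l).1,
              (f.hom (finSigmaFinEquiv.symm l).1).perm (finSigmaFinEquiv.symm l).2⟩).trans
              (sameArrow_comp_eqToHom _ _).symm }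
  w := CategoryTheory.Functor.ext (fun _ => rfl) fun _ _ _ => Subsingleton.elim _ _

end Operad

lemma CatOver.hom_ext' {I : Type u} {X Y : CatOver I} {F G : X ⟶ Y}
    (h : ∀ {x y : X} (f : x ⟶ y), SameArrow (F.functor.map f) (G.functor.map f)) : F = G :=
  CatOver.hom_ext (SameArrow.functor_ext h)

lemma finSigma_assoc' {n : ℕ} {m : Fin n → ℕ} {p : ∀ j, Fin (m j) → ℕ} (q : Σ j, Fin (m j))
    (l : Fin (p q.1 q.2)) {a : Fin (∑ j, m j)} (ha : finSigmaFinEquiv.symm a = q)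
    (l' : Fin (p (finSigmaFinEquiv.symm a).1 (finSigmaFinEquiv.symm a).2)) (h : l'.val = l.val) :
    (finSigmaFinEquiv (⟨a, l'⟩ : Σ a : Fin (∑ j, m j),
        Fin (p (finSigmaFinEquiv.symm a).1 (finSigmaFinEquiv.symm a).2))).val =
      (finSigmaFinEquiv (⟨q.1, finSigmaFinEquiv ⟨q.2, l⟩⟩ : Σ j, Fin (∑ k, p j k))).val := by
  subst ha
  obtain rfl := Fin.ext h
  exact finSigma_assoc a l'

attribute [local irreducible] finSigmaFinEquiv

namespace Operad

variable {I : Type u} (T : Operad I)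

section
variable {T}

lemma Lab.eqToHom_perm {X : CatOver I} {a b : T.Lab X} (h : a = b) (j : Fin a.arr.n) :
    (Lab.Hom.perm (eqToHom h) j).val = j.val := by
  subst h; rfl

lemma Lab.eqToHom_hom {X : CatOver I} {a b : T.Lab X} (h : a = b) (j : Fin a.arr.n) :
    IsIdentity (Lab.Hom.hom (eqToHom h) j) := by
  subst h; exact ⟨rfl, rfl⟩

lemma Lab.comp_eqToHom_perm {X : CatOver I} {a b c : T.Lab X} (f : a ⟶ b) (h : b = c)
    (j : Fin a.arr.n) : (Lab.Hom.perm (f ≫ eqToHom h) j).val = (f.perm j).val := by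
  subst h; rfl

lemma Lab.comp_eqToHom_hom {X : CatOver I} {a b c : T.Lab X} (f : a ⟶ b) (h : b = c)
    (j : Fin a.arr.n) : SameArrow (Lab.Hom.hom (f ≫ eqToHom h) j) (f.hom j) := by
  subst h
  exact SameArrow.of_eq (Category.comp_id _)

lemma finSigma_one_left {n : Fin 1 → ℕ} (x : Σ j, Fin (n j)) :
    (finSigmaFinEquiv x).val = x.2.val := by
  rw [finSigmaFinEquiv_apply]
  obtain ⟨j, k⟩ := x
  obtain rfl : j = 0 := Subsingleton.elim _ _
  simp

lemma finSigma_one_left' {n : Fin 1 → ℕ} (l : Fin (∑ j, n j)) :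
    (finSigmaFinEquiv.symm l).2.val = l.val := by
  rw [← finSigma_one_left, Equiv.apply_symm_apply]

lemma finSigma_one_right {n : ℕ} (x : Σ _ : Fin n, Fin 1) :
    (finSigmaFinEquiv (n := fun _ : Fin n => 1) x).val = x.1.val := by
  rw [finSigmaFinEquiv_apply]
  obtain ⟨j, k⟩ := x
  obtain rfl : k = 0 := Subsingleton.elim _ _
  simp

lemma finSigma_one_right' {n : ℕ} (l : Fin (∑ _ : Fin n, 1)) :
    (finSigmaFinEquiv.symm l).1.val = l.val := by
  rw [← finSigma_one_right, Equiv.apply_symm_apply]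

lemma blockPerm_enc {n n' : ℕ} {m : Fin n → ℕ} {m' : Fin n' → ℕ} (ρ : Fin n' ≃ Fin n)
    (ρs : ∀ j, Fin (m' j) ≃ Fin (m (ρ j))) (x : Σ j, Fin (m' j)) :
    blockPerm ρ ρs (finSigmaFinEquiv x) =
      finSigmaFinEquiv (⟨ρ x.1, ρs x.1 x.2⟩ : Σ j, Fin (m j)) :=
  congrArg (fun x : Σ j, Fin (m' j) => finSigmaFinEquiv (⟨ρ x.1, ρs x.1 x.2⟩ : Σ j, Fin (m j)))
    (Equiv.symm_apply_apply finSigmaFinEquiv x)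

lemma Lab.hom_congr {X : CatOver I} {a b : T.Lab X} (f : a ⟶ b) {j k : Fin a.arr.n} (h : j = k) :
    SameArrow (f.hom j) (f.hom k) := by subst h; rfl

end

/-- The 2-functor on `Cat/I` underlying the 2-monad of the operad `T`. -/
def labFunctor : StrictPseudofunctor (CatOver I) (CatOver I) :=
  StrictPseudofunctor.mk''
    { obj := T.labOver
      map := T.labMap
      map₂ := T.labMap₂
      map₂_id := fun F => CatOver.cell_ext fun a => rfl
      map₂_comp := fun θ θ' => CatOver.cell_ext fun a => rfl
      map_id := fun X => rfl
      map_comp := fun F G => rfl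
      map₂_whisker_left := fun F _ _ θ => CatOver.cell_ext fun a =>
        ((Category.id_comp _).trans (Category.comp_id _)).symm
      map₂_whisker_right := fun θ F => CatOver.cell_ext fun a =>
        ((Category.id_comp _).trans (Category.comp_id _)).symm }

lemma labUnit_naturality {X Y : CatOver I} (F : X ⟶ Y) :
    F ≫ T.labUnit Y = T.labUnit X ≫ T.labMap F := by
  refine CatOver.hom_ext' fun {x y} f => Lab.sameArrow ?_ ?_ ?_ ?_
  · exact congrArg (fun i => toArr (T.one i)) (congrArg Discrete.as (Functor.congr_obj F.w x))
  · exact congrArg (fun i => toArr (T.one i)) (congrArg Discrete.as (Functor.congr_obj F.w y))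
  · exact fun j k h => h
  · exact fun j k h => rfl

lemma labMult_naturality {X Y : CatOver I} (F : X ⟶ Y) :
    T.labMap (T.labMap F) ≫ T.labMult Y = T.labMult X ≫ T.labMap F := by
  refine CatOver.hom_ext' fun {x y} f => Lab.sameArrow rfl rfl ?_ ?_
  · rintro j k h
    obtain rfl := Fin.ext h
    rfl
  · rintro j k h
    obtain rfl := Fin.ext h
    refine (sameArrow_comp_eqToHom _ _).trans ?_
    exact (SameArrow.map F.functor (sameArrow_comp_eqToHom _ _)).symm

lemma labUnit_labMult (X : CatOver I) : T.labUnit (T.labOver X) ≫ T.labMult X = 𝟙 _ := by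
  refine CatOver.hom_ext' fun {x y} f =>
    Lab.sameArrow (one_compArr _ rfl) (one_compArr _ rfl) ?_ ?_
  · intro j k h
    refine (finSigma_one_left _).trans ?_
    exact congrArg (fun l => (f.perm l).val) (Fin.ext ((finSigma_one_left' (n := fun _ => x.arr.n) j).trans h))
  · intro j k h
    refine (sameArrow_comp_eqToHom _ _).trans ?_
    exact Lab.hom_congr f (Fin.ext ((finSigma_one_left' (n := fun _ => x.arr.n) j).trans h))

lemma labMap_labUnit_labMult (X : CatOver I) :
    T.labMap (T.labUnit X) ≫ T.labMult X = 𝟙 _ := by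
  have key : ∀ x : T.labOver X, ((T.labMap (T.labUnit X) ≫ T.labMult X).functor.obj x).arr =
      x.arr := fun x =>
    (compArr_congr rfl fun j => congrArg (fun i => toArr (T.one i)) (x.col_label j)).trans
      (compArr_one x.arr)
  refine CatOver.hom_ext' fun {x y} f => Lab.sameArrow (key x) (key y) ?_ ?_
  · intro j k h
    refine (finSigma_one_right _).trans ?_
    exact congrArg (fun l => (f.perm l).val) (Fin.ext ((finSigma_one_right' j).trans h))
  · intro j k h
    refine (sameArrow_comp_eqToHom _ _).trans ?_
    exact Lab.hom_congr f (Fin.ext ((finSigma_one_right' j).trans h))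

lemma labMult_assoc (X : CatOver I) :
    T.labMap (T.labMult X) ≫ T.labMult X = T.labMult (T.labOver X) ≫ T.labMult X := by
  have key : ∀ x : T.labOver (T.labOver (T.labOver X)),
      ((T.labMap (T.labMult X) ≫ T.labMult X).functor.obj x).arr =
      ((T.labMult (T.labOver X) ≫ T.labMult X).functor.obj x).arr := fun x =>
    compArr_compArr x.arr (fun j => (x.label j).arr) x.col_label
      (fun j k => ((x.label j).label k).arr) (fun j => (x.label j).col_label)
  refine CatOver.hom_ext' fun {x y} f => Lab.sameArrow (key x) (key y) ?_ ?_
  · intro l' l h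
    obtain ⟨⟨a, l₀⟩, rfl⟩ := finSigmaFinEquiv.surjective l
    obtain rfl : l' = finSigmaFinEquiv ⟨(finSigmaFinEquiv.symm a).1,
        finSigmaFinEquiv ⟨(finSigmaFinEquiv.symm a).2, l₀⟩⟩ :=
      Fin.ext (h.trans (finSigma_assoc (m := fun j => (x.label j).arr.n)
        (p := fun j k => ((x.label j).label k).arr.n) a l₀))
    refine Eq.trans ?_ (Eq.trans (finSigma_assoc' (m := fun j => (y.label j).arr.n)
      (p := fun j k => ((y.label j).label k).arr.n)
      ⟨f.perm (finSigmaFinEquiv.symm a).1,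
        (f.hom (finSigmaFinEquiv.symm a).1).perm (finSigmaFinEquiv.symm a).2⟩
      (((f.hom (finSigmaFinEquiv.symm a).1).hom (finSigmaFinEquiv.symm a).2).perm l₀)
      (Equiv.symm_apply_apply finSigmaFinEquiv _) _ (Lab.comp_eqToHom_perm _
        (Lab.flat_label (z' := y) ⟨f.perm (finSigmaFinEquiv.symm a).1,
          (f.hom (finSigmaFinEquiv.symm a).1).perm (finSigmaFinEquiv.symm a).2⟩) l₀)).symm ?_)
    · refine (congrArg Fin.val (blockPerm_enc _ _ _)).trans ?_
      exact congrArg (fun r => (finSigmaFinEquiv (⟨f.perm (finSigmaFinEquiv.symm a).1, r⟩ :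
        Σ j, Fin (∑ k, ((y.label j).label k).arr.n))).val) (blockPerm_enc _ _ _)
    · exact (congrArg Fin.val (blockPerm_enc
        (m := fun j => (((T.labMult (T.labOver X)).functor.obj y).label j).arr.n)
        ((T.labMult (T.labOver X)).functor.map f).perm
        (fun j => (((T.labMult (T.labOver X)).functor.map f).hom j).perm) ⟨a, l₀⟩)).symm
  · intro l' l h
    obtain ⟨⟨a, l₀⟩, rfl⟩ := finSigmaFinEquiv.surjective l
    obtain rfl : l' = finSigmaFinEquiv ⟨(finSigmaFinEquiv.symm a).1,
        finSigmaFinEquiv ⟨(finSigmaFinEquiv.symm a).2, l₀⟩⟩ :=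
      Fin.ext (h.trans (finSigma_assoc (m := fun j => (x.label j).arr.n)
        (p := fun j k => ((x.label j).label k).arr.n) a l₀))
    refine ((sameArrow_comp_eqToHom _ _).trans ?_).trans (sameArrow_comp_eqToHom _ _).symm
    refine ((Lab.flat_hom ((T.labMap (T.labMult X)).functor.map f) _).symm.trans ?_).trans
      (Lab.flat_hom ((T.labMult (T.labOver X)).functor.map f) _)
    refine Eq.trans ?_ (Lab.comp_eqToHom_hom _ _ l₀).symm
    refine (sameArrow_comp_eqToHom _ _).trans ?_
    exact (Lab.flat_hom (f.hom (finSigmaFinEquiv.symm a).1) ⟨(finSigmaFinEquiv.symm a).2, l₀⟩).symm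

/-- The 2-monad on `Cat/I` associated to the operad `T`. -/
def twoMonad : TwoMonad (CatOver I) where
  T := T.labFunctor
  unit := T.labUnit
  unit_naturality := T.labUnit_naturality
  unit_naturality₂ {X Y F G} θ := by
    refine CatOver.sameArrow_cell (congrArg CatOver.Hom.functor (T.labUnit_naturality F))
      (congrArg CatOver.Hom.functor (T.labUnit_naturality G)) fun x => Lab.sameArrow ?_ ?_ ?_ ?_
    · exact congrArg (fun i => toArr (T.one i)) (congrArg Discrete.as (Functor.congr_obj F.w x))
    · exact congrArg (fun i => toArr (T.one i)) (congrArg Discrete.as (Functor.congr_obj G.w x))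
    · exact fun j k h => h
    · exact fun j k h => rfl
  mult := T.labMult
  mult_naturality := T.labMult_naturality
  mult_naturality₂ {X Y F G} θ := by
    refine CatOver.sameArrow_cell (congrArg CatOver.Hom.functor (T.labMult_naturality F))
      (congrArg CatOver.Hom.functor (T.labMult_naturality G)) fun x => Lab.sameArrow rfl rfl ?_ ?_
    · rintro j k h
      obtain rfl := Fin.ext h
      exact congrArg Fin.val (finSigmaFinEquiv.apply_symm_apply j)
    · rintro j k h
      obtain rfl := Fin.ext h
      exact (sameArrow_comp_eqToHom _ _)
  unit_mult := T.labUnit_labMult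
  map_unit_mult := T.labMap_labUnit_labMult
  assoc := T.labMult_assoc

end Operad

lemma isIdentity_id {C : Type u} [Category.{v} C] (x : C) : IsIdentity (𝟙 x) := ⟨rfl, rfl⟩

lemma IsIdentity.comp {C : Type u} [Category.{v} C] {x y z : C} {f : x ⟶ y} {g : y ⟶ z}
    (hf : IsIdentity f) (hg : IsIdentity g) : IsIdentity (f ≫ g) := by
  obtain ⟨rfl, rfl⟩ := hf
  obtain ⟨rfl, rfl⟩ := hg
  exact ⟨rfl, by simp⟩

lemma IsIdentity.map {C : Type u} [Category.{v} C] {D : Type*} [Category* D] (F : C ⥤ D)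
    {x y : C} {f : x ⟶ y} (hf : IsIdentity f) : IsIdentity (F.map f) := by
  obtain ⟨rfl, rfl⟩ := hf
  exact ⟨rfl, by simp⟩

lemma isIdentity_eqToHom {C : Type u} [Category.{v} C] {x y : C} (h : x = y) :
    IsIdentity (eqToHom h) := ⟨h, rfl⟩

lemma SameArrow.trans {C : Type u} [Category.{v} C] {x y x' y' x'' y'' : C} {f : x ⟶ y}
    {g : x' ⟶ y'} {k : x'' ⟶ y''} (h : SameArrow f g) (h' : SameArrow g k) : SameArrow f k :=
  Eq.trans h h'

lemma SameArrow.symm {C : Type u} [Category.{v} C] {x y x' y' : C} {f : x ⟶ y}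
    {g : x' ⟶ y'} (h : SameArrow f g) : SameArrow g f :=
  Eq.symm h

namespace Operad

variable {I : Type u} (T : Operad I)

/-- The objects of `T^{[1]}_Σ X`: the permutative arrows of `TX`, that is, the arrows `(ρ, (γ_j)_j)`
of `TX` for which all the `γ_j` are identities. -/
structure Perm (X : CatOver I) where
  dom : T.Lab X
  cod : T.Lab X
  arr : dom ⟶ cod
  permutative (j : Fin dom.arr.n) : IsIdentity (arr.hom j)

/-- The arrows of `T^{[1]}_Σ X`: commutative squares in `TX`. -/
@[ext]
structure Perm.Hom {T : Operad I} {X : CatOver I} (f g : T.Perm X) where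
  dom : f.dom ⟶ g.dom
  cod : f.cod ⟶ g.cod
  w : dom ≫ g.arr = f.arr ≫ cod

instance (X : CatOver I) : Category.{u} (T.Perm X) where
  Hom := Perm.Hom
  id f := ⟨𝟙 _, 𝟙 _, by simp⟩
  comp s t := ⟨s.dom ≫ t.dom, s.cod ≫ t.cod, by
    rw [Category.assoc, t.w, ← Category.assoc, s.w, Category.assoc]⟩
  id_comp _ := Perm.Hom.ext (Category.id_comp _) (Category.id_comp _)
  comp_id _ := Perm.Hom.ext (Category.comp_id _) (Category.comp_id _)
  assoc _ _ _ := Perm.Hom.ext (Category.assoc _ _ _) (Category.assoc _ _ _)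

/-- `T^{[1]}_Σ X` as an object of `Cat/I`. -/
abbrev permOver (X : CatOver I) : CatOver I where
  carrier := T.Perm X
  proj :=
    { obj f := ⟨f.dom.arr.tgt⟩
      map s := Discrete.eqToHom (Lab.Hom.tgt_eq s.dom)
      map_id _ := Subsingleton.elim _ _
      map_comp _ _ := Subsingleton.elim _ _ }

/-- The component at `X` of `d_T`, sending a permutative arrow to its domain. -/
def permDom (X : CatOver I) : T.permOver X ⟶ T.labOver X where
  functor :=
    { obj f := f.dom
      map s := s.dom
      map_id _ := rfl
      map_comp _ _ := rfl }
  w := rfl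

/-- The component at `X` of `c_T`, sending a permutative arrow to its codomain. -/
def permCod (X : CatOver I) : T.permOver X ⟶ T.labOver X where
  functor :=
    { obj f := f.cod
      map s := s.cod
      map_id _ := rfl
      map_comp _ _ := rfl }
  w := CategoryTheory.Functor.ext
    (fun f => congrArg Discrete.mk (Lab.Hom.tgt_eq f.arr).symm) fun _ _ _ => Subsingleton.elim _ _

/-- The component at `X` of `α_T : d_T ⟶ c_T`; its component at a permutative arrow is that
permutative arrow. -/
def permArr (X : CatOver I) : T.permDom X ⟶ T.permCod X :=
  CatOver.Cell.mk
    { app f := f.arr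
      naturality _ _ s := s.w }

section
variable {T}

/-- The functor into `T^{[1]}_Σ X` determined by a natural transformation between functors into
`TX`, with permutative components. -/
def permLift {Z X : CatOver I} {F G : Z ⟶ T.labOver X} (θ : F ⟶ G)
    (h : ∀ z j, IsIdentity ((θ.nat.app z).hom j)) : Z ⟶ T.permOver X where
  functor :=
    { obj z := ⟨F.functor.obj z, G.functor.obj z, θ.nat.app z, h z⟩
      map f := ⟨F.functor.map f, G.functor.map f, θ.nat.naturality f⟩
      map_id _ := Perm.Hom.ext (F.functor.map_id _) (G.functor.map_id _)
      map_comp _ _ := Perm.Hom.ext (F.functor.map_comp _ _) (G.functor.map_comp _ _) }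
  w := CategoryTheory.Functor.ext (fun z => Functor.congr_obj F.w z)
    fun _ _ _ => Subsingleton.elim _ _

lemma Perm.sameArrow {X : CatOver I} {f g f' g' : T.Perm X} {s : f ⟶ g} {s' : f' ⟶ g'}
    (hf : SameArrow f.arr f'.arr) (hg : SameArrow g.arr g'.arr)
    (h : SameArrow s.dom s'.dom) (h' : SameArrow s.cod s'.cod) : SameArrow s s' := by
  obtain ⟨fd, fc, fa, hfa⟩ := f
  obtain ⟨gd, gc, ga, hga⟩ := g
  obtain ⟨fd', fc', fa', hfa'⟩ := f'
  obtain ⟨gd', gc', ga', hga'⟩ := g'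
  dsimp only at hf hg
  obtain rfl : fd = fd' := congrArg Comma.left hf
  obtain rfl : fc = fc' := congrArg Comma.right hf
  obtain rfl : gd = gd' := congrArg Comma.left hg
  obtain rfl : gc = gc' := congrArg Comma.right hg
  obtain rfl : fa = fa' := Arrow.mk_injective _ _ hf
  obtain rfl : ga = ga' := Arrow.mk_injective _ _ hg
  exact SameArrow.of_eq (Perm.Hom.ext (Arrow.mk_injective _ _ h) (Arrow.mk_injective _ _ h'))

lemma perm_hom_ext {Z X : CatOver I} {F G : Z ⟶ T.permOver X}
    (h : F ≫ T.permDom X = G ≫ T.permDom X) (h' : F ≫ T.permCod X = G ≫ T.permCod X)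
    (h'' : ∀ z, SameArrow (F.functor.obj z).arr (G.functor.obj z).arr) : F = G :=
  CatOver.hom_ext' fun f => Perm.sameArrow (h'' _) (h'' _)
    (SameArrow.functor_map (congrArg CatOver.Hom.functor h) f)
    (SameArrow.functor_map (congrArg CatOver.Hom.functor h') f)

end

/-- The action of `T^{[1]}_Σ` on functors. -/
def permMap {X Y : CatOver I} (F : X ⟶ Y) : T.permOver X ⟶ T.permOver Y :=
  permLift (T.permArr X ▷ T.labMap F) fun f j => (f.permutative j).map F.functor

/-- The action of `T^{[1]}_Σ` on natural transformations. -/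
def permMap₂ {X Y : CatOver I} {F G : X ⟶ Y} (θ : F ⟶ G) : T.permMap F ⟶ T.permMap G :=
  CatOver.Cell.mk
    { app f := ⟨(T.labMap₂ θ).nat.app f.dom, (T.labMap₂ θ).nat.app f.cod,
        ((T.labMap₂ θ).nat.naturality f.arr).symm⟩
      naturality _ _ s := Perm.Hom.ext ((T.labMap₂ θ).nat.naturality s.dom)
        ((T.labMap₂ θ).nat.naturality s.cod) }

/-- The unit of `T^{[1]}_Σ`. -/
def permUnit (X : CatOver I) : X ⟶ T.permOver X :=
  permLift (𝟙 (T.labUnit X)) fun _ _ => isIdentity_id _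

section
variable {T}

lemma Lab.isIdentity_hom {X : CatOver I} {a b : T.Lab X} {f : a ⟶ b} (hf : IsIdentity f)
    (j : Fin a.arr.n) : IsIdentity (f.hom j) := by
  obtain ⟨h, rfl⟩ := hf
  exact Lab.eqToHom_hom h j

lemma Lab.isIdentity_mult {X : CatOver I} {z z' : T.labOver (T.labOver X)} {f : z ⟶ z'}
    (hf : ∀ j k, IsIdentity ((f.hom j).hom k)) (l) :
    IsIdentity (((T.labMult X).functor.map f).hom l) :=
  (hf _ _).comp (isIdentity_eqToHom _)

end

/-- The multiplication of `T^{[1]}_Σ`, induced by that of `T` and the horizontal composite of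
`α_T` with itself. -/
def permMult (X : CatOver I) : T.permOver (T.permOver X) ⟶ T.permOver X :=
  permLift
    (F := T.permDom (T.permOver X) ≫ T.labMap (T.permDom X) ≫ T.labMult X)
    (G := T.permCod (T.permOver X) ≫ T.labMap (T.permCod X) ≫ T.labMult X)
    ((T.permArr (T.permOver X) ▷ (T.labMap (T.permDom X) ≫ T.labMult X)) ≫
      (T.permCod (T.permOver X) ◁ (T.labMap₂ (T.permArr X) ▷ T.labMult X)))
    fun f _ =>
      (Lab.isIdentity_mult (f := (T.labMap (T.permDom X)).functor.map f.arr)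
        (fun j => Lab.isIdentity_hom ((f.permutative j).map (T.permDom X).functor)) _).comp
      (Lab.isIdentity_mult (f := (T.labMap₂ (T.permArr X)).nat.app f.cod)
        (fun j => (f.cod.label j).permutative) _)

lemma labUnit_naturality₂ {X Y : CatOver I} {F G : X ⟶ Y} (θ : F ⟶ G) (x : X) :
    SameArrow ((T.labUnit Y).functor.map (θ.nat.app x))
      ((T.labMap₂ θ).nat.app ((T.labUnit X).functor.obj x)) := by
  refine Lab.sameArrow ?_ ?_ ?_ ?_
  · exact congrArg (fun i => toArr (T.one i)) (congrArg Discrete.as (Functor.congr_obj F.w x))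
  · exact congrArg (fun i => toArr (T.one i)) (congrArg Discrete.as (Functor.congr_obj G.w x))
  · exact fun j k h => h
  · exact fun j k h => rfl

lemma labMult_naturality₂ {X Y : CatOver I} {F G : X ⟶ Y} (θ : F ⟶ G)
    (x : T.labOver (T.labOver X)) :
    SameArrow ((T.labMult Y).functor.map ((T.labMap₂ (T.labMap₂ θ)).nat.app x))
      ((T.labMap₂ θ).nat.app ((T.labMult X).functor.obj x)) := by
  refine Lab.sameArrow rfl rfl ?_ ?_
  · rintro j k h
    obtain rfl := Fin.ext h
    exact congrArg Fin.val (finSigmaFinEquiv.apply_symm_apply j)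
  · rintro j k h
    obtain rfl := Fin.ext h
    exact (sameArrow_comp_eqToHom _ _)

end Operad

namespace Operad

variable {I : Type u} (T : Operad I)

/-- The 2-functor underlying `T^{[1]}_Σ`. -/
def permFunctor : StrictPseudofunctor (CatOver I) (CatOver I) :=
  StrictPseudofunctor.mk''
    { obj := T.permOver
      map := T.permMap
      map₂ := T.permMap₂
      map₂_id := fun _ => CatOver.cell_ext fun _ => rfl
      map₂_comp := fun _ _ => CatOver.cell_ext fun _ => rfl
      map_id := fun _ => rfl
      map_comp := fun _ _ => rfl
      map₂_whisker_left := fun _ _ _ _ => CatOver.cell_ext fun _ =>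
        ((Category.id_comp _).trans (Category.comp_id _)).symm
      map₂_whisker_right := fun _ _ => CatOver.cell_ext fun _ =>
        ((Category.id_comp _).trans (Category.comp_id _)).symm }

lemma permUnit_naturality {X Y : CatOver I} (F : X ⟶ Y) :
    F ≫ T.permUnit Y = T.permUnit X ≫ T.permMap F := by
  refine perm_hom_ext (T.labUnit_naturality F) (T.labUnit_naturality F) fun z => ?_
  have h := Functor.congr_obj (congrArg CatOver.Hom.functor (T.labUnit_naturality F)) z
  exact SameArrow.trans (f := 𝟙 _) (g := 𝟙 _)
    (congrArg (fun a : T.labOver Y => Arrow.mk (𝟙 a)) h)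
    (SameArrow.of_eq ((T.labMap F).functor.map_id _).symm)

lemma permMult_naturality {X Y : CatOver I} (F : X ⟶ Y) :
    T.permMap (T.permMap F) ≫ T.permMult Y = T.permMult X ≫ T.permMap F := by
  refine perm_hom_ext
    (congrArg (fun G => T.permDom (T.permOver X) ≫ T.labMap (T.permDom X) ≫ G)
      (T.labMult_naturality F))
    (congrArg (fun G => T.permCod (T.permOver X) ≫ T.labMap (T.permCod X) ≫ G)
      (T.labMult_naturality F)) fun z => ?_
  have h := congrArg CatOver.Hom.functor (T.labMult_naturality F)
  refine SameArrow.trans ?_ (SameArrow.of_eq ((T.labMap F).functor.map_comp _ _)).symm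
  exact SameArrow.comp (SameArrow.functor_map h ((T.labMap (T.permDom X)).functor.map z.arr))
    (SameArrow.functor_map h ((T.labMap₂ (T.permArr X)).nat.app z.cod))

lemma Perm.sameArrow_arr {T : Operad I} {X : CatOver I} {p q : T.Perm X} (h : p.dom = q.dom) (h' : p.cod = q.cod)
    (h'' : ∀ j k, j.val = k.val → (p.arr.perm j).val = (q.arr.perm k).val) :
    SameArrow p.arr q.arr := by
  obtain ⟨a, b, f, hf⟩ := p
  obtain ⟨a', b', f', hf'⟩ := q
  obtain rfl : a = a' := h
  obtain rfl : b = b' := h'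
  have hp : ∀ j, f.perm j = f'.perm j := fun j => Fin.ext (h'' j j rfl)
  refine SameArrow.of_eq (Lab.hom_ext hp fun j => ?_)
  obtain ⟨e, he⟩ := hf j
  obtain ⟨e', he'⟩ := hf' j
  change SameArrow (f.hom j) (f'.hom j)
  rw [show f.hom j = eqToHom e from he, show f'.hom j = eqToHom e' from he']
  exact sameArrow_eqToHom _ _

lemma permUnit_permMult (X : CatOver I) : T.permUnit (T.permOver X) ≫ T.permMult X = 𝟙 _ := by
  have h (F : T.permOver X ⟶ T.labOver X) : T.labUnit (T.permOver X) ≫ T.labMap F ≫ T.labMult X =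
      F := by
    have h₁ := T.labUnit_naturality F
    have h₂ := T.labUnit_labMult X
    calc _ = (F ≫ T.labUnit _) ≫ T.labMult X := congrArg (fun G => G ≫ T.labMult X) h₁.symm
      _ = F := congrArg (fun G => F ≫ G) h₂
  refine perm_hom_ext (h (T.permDom X)) (h (T.permCod X)) fun z => ?_
  refine Perm.sameArrow_arr (Functor.congr_obj (congrArg CatOver.Hom.functor (h (T.permDom X))) z)
    (Functor.congr_obj (congrArg CatOver.Hom.functor (h (T.permCod X))) z) fun j k hjk => ?_
  refine (finSigma_one_left (n := fun _ => z.cod.arr.n) _).trans ?_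
  refine congrArg (fun l => (z.arr.perm l).val) (Fin.ext ?_)
  refine (finSigma_one_left' (n := fun _ => z.dom.arr.n) _).trans
    ((finSigma_one_left (n := fun _ => z.dom.arr.n) _).trans
      ((finSigma_one_left' (n := fun _ => z.dom.arr.n) j).trans hjk))

lemma permMap_permUnit_permMult (X : CatOver I) :
    T.permMap (T.permUnit X) ≫ T.permMult X = 𝟙 _ := by
  have h (F : T.permOver X ⟶ T.labOver X) :
      F ≫ T.labMap (T.labUnit X) ≫ T.labMult X = F :=
    congrArg (fun G => F ≫ G) (T.labMap_labUnit_labMult X)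
  refine perm_hom_ext (h (T.permDom X)) (h (T.permCod X)) fun z => ?_
  refine SameArrow.trans ?_ (SameArrow.functor_map
    (congrArg CatOver.Hom.functor (T.labMap_labUnit_labMult X)) z.arr)
  refine SameArrow.trans (SameArrow.of_eq ((T.labMult X).functor.map_comp _ _)).symm ?_
  refine SameArrow.map (T.labMult X).functor ?_
  exact SameArrow.of_eq (Category.comp_id _)

section
attribute [local irreducible] labMult

lemma permMult_assoc (X : CatOver I) :
    T.permMap (T.permMult X) ≫ T.permMult X = T.permMult (T.permOver X) ≫ T.permMult X := by
  have h (F : T.permOver (T.permOver (T.permOver X)) ⟶ T.labOver (T.permOver (T.permOver X)))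
      (G : T.permOver (T.permOver X) ⟶ T.labOver (T.permOver X))
      (H : T.permOver X ⟶ T.labOver X) :
      F ≫ T.labMap (G ≫ T.labMap H ≫ T.labMult X) ≫ T.labMult X =
        (F ≫ T.labMap G ≫ T.labMult (T.permOver X)) ≫ T.labMap H ≫ T.labMult X := by
    have h₁ := T.labMult_naturality H
    have h₂ := T.labMult_assoc X
    calc _ = (F ≫ T.labMap G ≫ T.labMap (T.labMap H)) ≫ T.labMap (T.labMult X) ≫ T.labMult X := rfl
      _ = (F ≫ T.labMap G ≫ T.labMap (T.labMap H)) ≫ T.labMult (T.labOver X) ≫ T.labMult X :=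
        congrArg (fun K => (F ≫ T.labMap G ≫ T.labMap (T.labMap H)) ≫ K) h₂
      _ = (F ≫ T.labMap G) ≫ (T.labMap (T.labMap H) ≫ T.labMult (T.labOver X)) ≫ T.labMult X := rfl
      _ = _ := congrArg (fun K => (F ≫ T.labMap G) ≫ K ≫ T.labMult X) h₁
  refine perm_hom_ext (h _ _ _) (h _ _ _) fun z => ?_
  have hn := congrArg CatOver.Hom.functor (T.labMult_naturality (T.permDom X))
  let μ := (T.labMult X).functor
  let μ' := (T.labMult (T.labOver X)).functor
  let Tμ := (T.labMap (T.labMult X)).functor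
  let a₁ := (T.labMap (T.labMap (T.permDom X))).functor.map
    ((T.labMap (T.permDom (T.permOver X))).functor.map z.arr)
  let a₂ := (T.labMap (T.labMap (T.permDom X))).functor.map
    ((T.labMap₂ (T.permArr (T.permOver X))).nat.app z.cod)
  let a₃ := (T.labMap₂ (T.labMap₂ (T.permArr X))).nat.app
    ((T.labMap (T.permCod (T.permOver X))).functor.obj z.cod)
  have e₁ : SameArrow ((T.permMap (T.permMult X) ≫ T.permMult X).functor.obj z).arr
      (μ.map (Tμ.map a₁) ≫ μ.map (Tμ.map (a₂ ≫ a₃))) :=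
    SameArrow.comp SameArrow.rfl (SameArrow.map μ (Lab.sameArrow rfl rfl
      (fun j k h => h) fun j k h => by
        obtain rfl := Fin.ext h
        exact SameArrow.of_eq ((T.labMult X).functor.map_comp _ _).symm))
  have e₂ : SameArrow (μ.map (μ'.map (a₁ ≫ a₂)) ≫ μ.map (μ'.map a₃))
      ((T.permMult (T.permOver X) ≫ T.permMult X).functor.obj z).arr := by
    refine SameArrow.comp (SameArrow.map μ ?_) (SameArrow.map μ
      (T.labMult_naturality₂ (T.permArr X) _))
    refine SameArrow.trans ?_ (SameArrow.map (T.labMap (T.permDom X)).functor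
      (SameArrow.of_eq ((T.labMult (T.permOver X)).functor.map_comp _ _)))
    refine SameArrow.trans ?_ (SameArrow.functor_map hn _)
    exact SameArrow.map μ' (SameArrow.of_eq
      ((T.labMap (T.labMap (T.permDom X))).functor.map_comp _ _).symm)
  refine e₁.trans (SameArrow.trans ?_ e₂)
  refine SameArrow.trans (f := μ.map (Tμ.map a₁) ≫ μ.map (Tμ.map (a₂ ≫ a₃)))
    (g := (Tμ ⋙ μ).map (a₁ ≫ a₂ ≫ a₃)) (SameArrow.of_eq ((Tμ ⋙ μ).map_comp _ _).symm) ?_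
  refine SameArrow.trans (SameArrow.functor_map
    (congrArg CatOver.Hom.functor (T.labMult_assoc X)) _) ?_
  refine SameArrow.trans (SameArrow.of_eq ?_) (SameArrow.of_eq ((μ' ⋙ μ).map_comp (a₁ ≫ a₂) a₃))
  exact congrArg (μ' ⋙ μ).map (Category.assoc _ _ _).symm

end

/-- The 2-monad `T^{[1]}_Σ` on `Cat/I`. -/
def permMonad : TwoMonad (CatOver I) where
  T := T.permFunctor
  unit := T.permUnit
  unit_naturality := T.permUnit_naturality
  unit_naturality₂ {X Y F G} θ := by
    refine CatOver.sameArrow_cell (congrArg CatOver.Hom.functor (T.permUnit_naturality F))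
      (congrArg CatOver.Hom.functor (T.permUnit_naturality G)) fun x => Perm.sameArrow ?_ ?_ ?_ ?_
    · exact congrArg (fun H : X ⟶ T.permOver Y => Arrow.mk (H.functor.obj x).arr)
        (T.permUnit_naturality F)
    · exact congrArg (fun H : X ⟶ T.permOver Y => Arrow.mk (H.functor.obj x).arr)
        (T.permUnit_naturality G)
    · exact T.labUnit_naturality₂ θ x
    · exact T.labUnit_naturality₂ θ x
  mult := T.permMult
  mult_naturality := T.permMult_naturality
  mult_naturality₂ {X Y F G} θ := by
    refine CatOver.sameArrow_cell (congrArg CatOver.Hom.functor (T.permMult_naturality F))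
      (congrArg CatOver.Hom.functor (T.permMult_naturality G)) fun x => Perm.sameArrow ?_ ?_ ?_ ?_
    · exact congrArg (fun H : T.permOver (T.permOver X) ⟶ T.permOver Y =>
        Arrow.mk (H.functor.obj x).arr) (T.permMult_naturality F)
    · exact congrArg (fun H : T.permOver (T.permOver X) ⟶ T.permOver Y =>
        Arrow.mk (H.functor.obj x).arr) (T.permMult_naturality G)
    · exact T.labMult_naturality₂ θ ((T.labMap (T.permDom X)).functor.obj x.dom)
    · exact T.labMult_naturality₂ θ ((T.labMap (T.permCod X)).functor.obj x.cod)
  unit_mult := T.permUnit_permMult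
  map_unit_mult := T.permMap_permUnit_permMult
  assoc := T.permMult_assoc

/-- The morphism of 2-monads `d_T : T^{[1]}_Σ ⟶ T`. -/
def permDomHom : TwoMonad.Hom T.permMonad T.twoMonad where
  app := T.permDom
  naturality _ := rfl
  naturality₂ _ := rfl
  unit_app _ := rfl
  mult_app _ := rfl

/-- The morphism of 2-monads `c_T : T^{[1]}_Σ ⟶ T`. -/
def permCodHom : TwoMonad.Hom T.permMonad T.twoMonad where
  app := T.permCod
  naturality _ := rfl
  naturality₂ _ := rfl
  unit_app _ := rfl
  mult_app _ := rfl

/-- The 2-monad 2-cell `α_T : d_T ⟶ c_T`. -/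
def permCell : TwoMonad.Cell T.permDomHom T.permCodHom where
  app := T.permArr
  naturality _ := rfl
  unit_app _ := isIdentity_id _
  mult_app X := by
    refine CatOver.sameArrow_cell rfl rfl fun z => ?_
    refine SameArrow.trans (SameArrow.of_eq ((T.labMult X).functor.map_comp _ _)).symm ?_
    refine SameArrow.trans ?_ (SameArrow.of_eq ((T.labMult X).functor.map_comp _ _))
    exact SameArrow.map (T.labMult X).functor
      (SameArrow.of_eq ((T.labMap₂ (T.permArr X)).nat.naturality z.arr))

end Operad

/-! ## Coidentifiers and lax algebras -/

section Whisker

variable {K : Type u} [Bicategory.{w, v} K] [Bicategory.Strict K] {A B C D : K}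

lemma SameArrow.whiskerRight {f g f' g' : A ⟶ B} {θ : f ⟶ g} {θ' : f' ⟶ g'} (h : SameArrow θ θ')
    (k : B ⟶ C) : SameArrow (θ ▷ k) (θ' ▷ k) := by
  obtain ⟨rfl, rfl, e⟩ := (Arrow.mk_eq_mk_iff _ _).1 h
  obtain rfl : θ = θ' := by simpa using e
  exact SameArrow.rfl

lemma SameArrow.whiskerLeft {f g f' g' : B ⟶ C} {θ : f ⟶ g} {θ' : f' ⟶ g'} (h : SameArrow θ θ')
    (k : A ⟶ B) : SameArrow (k ◁ θ) (k ◁ θ') := by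
  obtain ⟨rfl, rfl, e⟩ := (Arrow.mk_eq_mk_iff _ _).1 h
  obtain rfl : θ = θ' := by simpa using e
  exact SameArrow.rfl

lemma sameArrow_whiskerRight_comp {f g : A ⟶ B} (θ : f ⟶ g) (k : B ⟶ C) (l : C ⟶ D) :
    SameArrow (θ ▷ (k ≫ l)) (θ ▷ k ▷ l) := by
  rw [whiskerRight_comp, Strict.associator_eqToIso, Strict.associator_eqToIso, eqToIso.hom,
    eqToIso.inv]
  exact (sameArrow_eqToHom_comp _ _).trans (sameArrow_comp_eqToHom _ _)

lemma sameArrow_comp_whiskerLeft (k : A ⟶ B) (l : B ⟶ C) {f g : C ⟶ D} (θ : f ⟶ g) :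
    SameArrow ((k ≫ l) ◁ θ) (k ◁ l ◁ θ) := by
  rw [comp_whiskerLeft, Strict.associator_eqToIso, Strict.associator_eqToIso, eqToIso.hom,
    eqToIso.inv]
  exact (sameArrow_eqToHom_comp _ _).trans (sameArrow_comp_eqToHom _ _)

lemma sameArrow_whisker_assoc (k : A ⟶ B) {f g : B ⟶ C} (θ : f ⟶ g) (l : C ⟶ D) :
    SameArrow ((k ◁ θ) ▷ l) (k ◁ (θ ▷ l)) := by
  rw [whisker_assoc, Strict.associator_eqToIso, Strict.associator_eqToIso, eqToIso.hom,
    eqToIso.inv]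
  exact (sameArrow_eqToHom_comp _ _).trans (sameArrow_comp_eqToHom _ _)

end Whisker

namespace TwoMonad

variable {K : Type u} [Bicategory.{w, v} K] [Bicategory.Strict K]

/-- The identity morphism of a 2-monad. -/
def Hom.id (T : TwoMonad K) : Hom T T where
  app X := 𝟙 (T.T.obj X)
  naturality f := by rw [Strict.comp_id, Strict.id_comp]
  naturality₂ θ := by
    rw [whiskerRight_id, id_whiskerLeft, Strict.rightUnitor_eqToIso, Strict.rightUnitor_eqToIso,
      Strict.leftUnitor_eqToIso, Strict.leftUnitor_eqToIso, eqToIso.hom, eqToIso.hom, eqToIso.inv,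
      eqToIso.inv]
    have h₁ := (sameArrow_eqToHom_comp (Strict.comp_id _) (T.T.map₂ θ ≫ eqToHom _)).trans
      (sameArrow_comp_eqToHom (T.T.map₂ θ) (Strict.comp_id _).symm)
    have h₂ := (sameArrow_eqToHom_comp (Strict.id_comp _) (T.T.map₂ θ ≫ eqToHom _)).trans
      (sameArrow_comp_eqToHom (T.T.map₂ θ) (Strict.id_comp _).symm)
    exact h₁.trans h₂.symm
  unit_app X := Strict.comp_id _
  mult_app X := by rw [T.T.map_id]; simp only [Strict.comp_id, Strict.id_comp]

/-- Composition of morphisms of 2-monads, in diagrammatic order. -/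
def Hom.comp {S T U : TwoMonad K} (φ : Hom S T) (ψ : Hom T U) : Hom S U where
  app X := φ.app X ≫ ψ.app X
  naturality f := by
    rw [← Strict.assoc, φ.naturality, Strict.assoc, ψ.naturality, Strict.assoc]
  naturality₂ {X Y f g} θ :=
    (((sameArrow_whiskerRight_comp _ _ _).trans ((φ.naturality₂ θ).whiskerRight _)).trans
      (sameArrow_whisker_assoc _ _ _)).trans
      (((ψ.naturality₂ θ).whiskerLeft _).trans (sameArrow_comp_whiskerLeft _ _ _).symm)
  unit_app X := by rw [← Strict.assoc, φ.unit_app, ψ.unit_app]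
  mult_app X := by
    rw [← Strict.assoc, φ.mult_app, Strict.assoc, Strict.assoc, ψ.mult_app, S.T.map_comp,
      Strict.assoc, Strict.assoc, ← Strict.assoc (φ.app _) (T.T.map _), ← φ.naturality,
      Strict.assoc]

/-- The morphism of 2-monads `q : T ⟶ Q` is a coidentifier of the 2-monad 2-cell `α`, where
`α : φ ⟶ ψ` and `φ, ψ : S ⟶ T`, in the 2-category `Mnd(K)`: `qα` is an identity, and composition
with `q` is an isomorphism of categories from `Mnd(K)(Q, R)` to the full subcategory of `Mnd(K)(T, R)`
given by the `h` such that `hα` is an identity. -/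
structure IsCoidentifier {S T Q : TwoMonad K} {φ ψ : Hom S T} (α : Cell φ ψ) (q : Hom T Q) :
    Prop where
  isIdentity (X : K) : IsIdentity (α.app X ▷ q.app X)
  existsUnique_hom (R : TwoMonad K) (h : Hom T R) (hα : ∀ X, IsIdentity (α.app X ▷ h.app X)) :
    ∃! k : Hom Q R, q.comp k = h
  existsUnique_cell (R : TwoMonad K) (k k' : Hom Q R) (θ : Cell (q.comp k) (q.comp k')) :
    ∃! θ' : Cell k k', ∀ X, q.app X ◁ θ'.app X = θ.app X

/-- The 2-monad 2-cell `α : φ ⟶ ψ`, where `φ, ψ : S ⟶ T`, is reflexive: there is `s : T ⟶ S` such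
that `φs` and `ψs` are identities and `αs` is an identity. -/
def IsReflexive {S T : TwoMonad K} {φ ψ : Hom S T} (α : Cell φ ψ) : Prop :=
  ∃ s : Hom T S, s.comp φ = Hom.id T ∧ s.comp ψ = Hom.id T ∧ ∀ X, IsIdentity (s.app X ◁ α.app X)

/-- A lax algebra structure on `A` for the 2-monad `T`. The arrows `eqToHom _` are the equalities
`a ≫ unit A ≫ a = unit (T A) ≫ T a ≫ a`, `T (unit A ≫ a) ≫ a = T (unit A) ≫ T a ≫ a`,
`T T a ≫ mult A ≫ a = mult (T A) ≫ T a ≫ a` and `T (mult A ≫ a) ≫ a = T (mult A) ≫ T a ≫ a`. -/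
structure LaxAlgebra (T : TwoMonad K) (A : K) where
  a : T.T.obj A ⟶ A
  a₀ : 𝟙 A ⟶ T.unit A ≫ a
  a₂ : T.T.map a ≫ a ⟶ T.mult A ≫ a
  left_unit : IsIdentity (a ◁ a₀ ≫
    eqToHom (show a ≫ T.unit A ≫ a = T.unit (T.T.obj A) ≫ T.T.map a ≫ a by
      rw [← Strict.assoc, T.unit_naturality, Strict.assoc]) ≫ T.unit (T.T.obj A) ◁ a₂)
  right_unit : IsIdentity (T.T.map₂ a₀ ▷ a ≫
    eqToHom (show T.T.map (T.unit A ≫ a) ≫ a = T.T.map (T.unit A) ≫ T.T.map a ≫ a by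
      rw [T.T.map_comp, Strict.assoc]) ≫ T.T.map (T.unit A) ◁ a₂)
  assoc : SameArrow
    (T.T.map (T.T.map a) ◁ a₂ ≫
      eqToHom (show T.T.map (T.T.map a) ≫ T.mult A ≫ a = T.mult (T.T.obj A) ≫ T.T.map a ≫ a by
        rw [← Strict.assoc, T.mult_naturality, Strict.assoc]) ≫ T.mult (T.T.obj A) ◁ a₂)
    (T.T.map₂ a₂ ▷ a ≫
      eqToHom (show T.T.map (T.mult A ≫ a) ≫ a = T.T.map (T.mult A) ≫ T.T.map a ≫ a by
        rw [T.T.map_comp, Strict.assoc]) ≫ T.T.map (T.mult A) ◁ a₂)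

/-- A lax algebra is a pseudo algebra if its coherence 2-cells are invertible. -/
def LaxAlgebra.IsPseudo {T : TwoMonad K} {A : K} (M : LaxAlgebra T A) : Prop :=
  IsIso M.a₀ ∧ IsIso M.a₂

/-- A lax algebra is a strict algebra if its coherence 2-cells are identities. -/
def LaxAlgebra.IsStrict {T : TwoMonad K} {A : K} (M : LaxAlgebra T A) : Prop :=
  IsIdentity M.a₀ ∧ IsIdentity M.a₂

end TwoMonad

/-! ## The standard monad of an operad on `I`-indexed families of sets -/

namespace Operad

variable {I : Type u} (T : Operad I)

/-- The elements of `∐_n ∐_{i_1, …, i_n} T((i_j)_j; i) × ∏_j X_{i_j}`. -/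
structure Term (X : I → Type u) (i : I) where
  n : ℕ
  c : Fin n → I
  op : T.Hom c i
  arg (j : Fin n) : X (c j)

namespace Term

variable {T} {X Y Z : I → Type u} {i : I}

/-- The action of permutations on terms. -/
def permute (t : T.Term X i) {m : ℕ} (ρ : Fin m ≃ Fin t.n) : T.Term X i :=
  ⟨m, t.c ∘ ρ, T.act ρ t.op, fun j => t.arg (ρ j)⟩

/-- The terms `t` and `t'` are in the same orbit for the action of permutations. -/
def SameOrbit (t t' : T.Term X i) : Prop := ∃ ρ : Fin t.n ≃ Fin t'.n, t = t'.permute ρ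

/-- Applying a function to the variables of a term. -/
def map (f : ∀ i, X i → Y i) (t : T.Term X i) : T.Term Y i :=
  ⟨t.n, t.c, t.op, fun j => f _ (t.arg j)⟩

/-- A variable, regarded as a term. -/
def var (x : X i) : T.Term X i := ⟨1, fun _ => i, T.one i, fun _ => x⟩

/-- Substitution of terms into a term. -/
def subst (t : T.Term (T.Term X) i) : T.Term X i :=
  ⟨∑ j, (t.arg j).n, concatFun fun j => (t.arg j).c, T.comp t.op fun j => (t.arg j).op,
    fun l => (t.arg (finSigmaFinEquiv.symm l).1).arg (finSigmaFinEquiv.symm l).2⟩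

lemma ext' {t t' : T.Term X i} (h : toArr (A := T.Hom) t.op = toArr t'.op)
    (h' : ∀ j k, j.val = k.val → t.arg j ≍ t'.arg k) : t = t' := by
  obtain ⟨n, c, α, x⟩ := t
  obtain ⟨n', c', α', x'⟩ := t'
  obtain ⟨rfl, h₂, h₃, h₄⟩ := Arr.mk.inj h
  obtain rfl := eq_of_heq h₂
  obtain rfl := eq_of_heq h₄
  obtain rfl : x = x' := funext fun j => eq_of_heq (h' j j rfl)
  rfl

lemma permute_refl (t : T.Term X i) : t.permute (Equiv.refl _) = t := by
  refine ext' (congrArg _ (T.act_refl t.op)) ?_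
  rintro j k h
  obtain rfl := Fin.ext h
  rfl

lemma permute_permute (t : T.Term X i) {m l : ℕ} (ρ₁ : Fin m ≃ Fin t.n) (ρ₂ : Fin l ≃ Fin m) :
    (t.permute ρ₁).permute ρ₂ = t.permute (ρ₂.trans ρ₁) := by
  refine ext' (congrArg _ (T.act_act t.op _ _)) ?_
  rintro j k h
  obtain rfl := Fin.ext h
  rfl

lemma sameOrbit_permute (t : T.Term X i) {m : ℕ} (ρ : Fin m ≃ Fin t.n) :
    SameOrbit (t.permute ρ) t := ⟨ρ, rfl⟩

lemma SameOrbit.refl (t : T.Term X i) : SameOrbit t t := ⟨Equiv.refl _, (permute_refl t).symm⟩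

lemma SameOrbit.symm {t t' : T.Term X i} (h : SameOrbit t t') : SameOrbit t' t := by
  obtain ⟨ρ, h⟩ := h
  have key : ∀ {m : ℕ} (ρ : Fin m ≃ Fin t'.n), SameOrbit t' (t'.permute ρ) := fun ρ =>
    ⟨ρ.symm, by
      have := permute_permute t' ρ ρ.symm
      rw [Equiv.symm_trans_self, permute_refl] at this
      exact this.symm⟩
  rw [h]
  exact key ρ

lemma SameOrbit.trans {t t' t'' : T.Term X i} (h : SameOrbit t t') (h' : SameOrbit t' t'') :
    SameOrbit t t'' := by
  obtain ⟨ρ, h⟩ := h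
  obtain ⟨ρ', h'⟩ := h'
  have key : ∀ (s : T.Term X i) (_ : s = t''.permute ρ') {m : ℕ} (ρ : Fin m ≃ Fin s.n),
      SameOrbit (s.permute ρ) t'' := by
    rintro s rfl m ρ
    exact ⟨_, permute_permute t'' ρ' ρ⟩
  rw [h]
  exact key t' h' ρ

variable (T X i) in
/-- The equivalence relation of being in the same orbit. -/
def setoid : Setoid (T.Term X i) :=
  ⟨SameOrbit, SameOrbit.refl, SameOrbit.symm, SameOrbit.trans⟩

lemma SameOrbit.map (f : ∀ i, X i → Y i) {t t' : T.Term X i} (h : SameOrbit t t') :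
    SameOrbit (t.map f) (t'.map f) := by
  obtain ⟨ρ, h⟩ := h
  rw [h]
  exact sameOrbit_permute (t'.map f) ρ

lemma subst_permute (t : T.Term (T.Term X) i) {m : ℕ} (ρ : Fin m ≃ Fin t.n)
    {m' : Fin m → ℕ} (ρs : ∀ j, Fin (m' j) ≃ Fin (t.arg (ρ j)).n) :
    subst ⟨m, t.c ∘ ρ, T.act ρ t.op, fun j => (t.arg (ρ j)).permute (ρs j)⟩ =
      (subst t).permute (blockPerm ρ ρs) := by
  refine ext' (T.comp_act t.op (fun j => (t.arg j).op) ρ ρs) ?_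
  rintro j k h
  obtain rfl := Fin.ext h
  exact (congr_arg_heq (fun p : Σ j, Fin (t.arg j).n => (t.arg p.1).arg p.2)
    (Equiv.symm_apply_apply finSigmaFinEquiv (⟨ρ (finSigmaFinEquiv.symm j).1,
      ρs _ (finSigmaFinEquiv.symm j).2⟩ : Σ j, Fin (t.arg j).n))).symm

lemma flat_arg (s : T.Term (T.Term X) i) (p : Σ j, Fin (s.arg j).n) :
    (subst s).arg (finSigmaFinEquiv p) ≍ (s.arg p.1).arg p.2 :=
  congr_arg_heq (fun p : Σ j, Fin (s.arg j).n => (s.arg p.1).arg p.2)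
    (Equiv.symm_apply_apply finSigmaFinEquiv p)

lemma subst_map_subst (t : T.Term (T.Term (T.Term X)) i) :
    subst (t.map fun _ => subst) = subst (subst t) := by
  refine ext' (T.comp_comp t.op (fun j => (t.arg j).op) (fun j k => ((t.arg j).arg k).op)) ?_
  intro l' l h
  obtain ⟨⟨a, l₀⟩, rfl⟩ := finSigmaFinEquiv.surjective l
  obtain rfl : l' = finSigmaFinEquiv ⟨(finSigmaFinEquiv.symm a).1,
      finSigmaFinEquiv ⟨(finSigmaFinEquiv.symm a).2, l₀⟩⟩ :=
    Fin.ext (h.trans (finSigma_assoc (m := fun j => (t.arg j).n)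
      (p := fun j k => ((t.arg j).arg k).n) a l₀))
  exact ((flat_arg (t.map fun _ => subst) ⟨(finSigmaFinEquiv.symm a).1,
    finSigmaFinEquiv ⟨(finSigmaFinEquiv.symm a).2, l₀⟩⟩).trans
    (flat_arg (t.arg (finSigmaFinEquiv.symm a).1) ⟨_, l₀⟩)).trans
      (flat_arg (subst t) ⟨a, l₀⟩).symm

lemma subst_var (t : T.Term X i) : subst (var t) = t := by
  refine ext' (T.one_comp t.op) ?_
  intro j k h
  obtain rfl : (finSigmaFinEquiv.symm j).2 = k :=
    Fin.ext ((finSigma_one_left' (n := fun _ => t.n) j).trans h)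
  rfl

lemma subst_map_var (t : T.Term X i) : subst (t.map fun _ => var) = t := by
  refine ext' (T.comp_one t.op) ?_
  intro j k h
  obtain rfl : (finSigmaFinEquiv.symm j).1 = k :=
    Fin.ext ((finSigma_one_right' j).trans h)
  rfl

lemma map_subst (f : ∀ i, X i → Y i) (t : T.Term (T.Term X) i) :
    (subst t).map f = subst (t.map fun _ => map f) := rfl

/-- The class of a term in the quotient by the action of permutations. -/
def cls (t : T.Term X i) : Quotient (setoid T X i) := Quotient.mk _ t

lemma cls_eq {t t' : T.Term X i} : cls t = cls t' ↔ SameOrbit t t' := Quotient.eq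

lemma subst_congr {t t' : T.Term (T.Term X) i}
    (h : SameOrbit (t.map fun _ => cls) (t'.map fun _ => cls)) : SameOrbit (subst t) (subst t') := by
  obtain ⟨ρ, h⟩ := h
  obtain ⟨n, c, α, x⟩ := t
  obtain ⟨n', c', α', x'⟩ := t'
  obtain ⟨-, h₂, h₃, h₄⟩ := Term.mk.inj h
  change Fin n ≃ Fin n' at ρ
  obtain rfl : c = c' ∘ ρ := eq_of_heq h₂
  obtain rfl : α = T.act ρ α' := eq_of_heq h₃
  have hx : ∀ j, SameOrbit (x j) (x' (ρ j)) := fun j =>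
    cls_eq.1 (congrFun (eq_of_heq h₄) j)
  choose ρs hρs using hx
  have key : ∀ (m : Fin n → ℕ) (ρs : ∀ j, Fin (m j) ≃ Fin (x' (ρ j)).n)
      (y : ∀ j, T.Term X (c' (ρ j))) (_ : y = fun j => (x' (ρ j)).permute (ρs j)),
      SameOrbit (subst ⟨n, c' ∘ ρ, T.act ρ α', y⟩) (subst ⟨n', c', α', x'⟩) := by
    rintro m ρs y rfl
    exact ⟨_, subst_permute ⟨n', c', α', x'⟩ ρ ρs⟩
  exact key _ ρs x (funext hρs)

end Term

/-- The set `∐_n (∐_{i_1, …, i_n} T((i_j)_j; i) × ∏_j X_{i_j}) / Σ_n`. -/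
def Orbits (X : I → Type u) (i : I) : Type u := Quotient (Term.setoid T X i)

section
variable {T} {X Y Z : I → Type u} {i : I}

/-- The orbit of a term. -/
def Term.orbit (t : T.Term X i) : T.Orbits X i := t.cls

lemma orbit_eq {t t' : T.Term X i} : t.orbit = t'.orbit ↔ Term.SameOrbit t t' := Quotient.eq

lemma orbit_surjective (x : T.Orbits X i) : ∃ t : T.Term X i, t.orbit = x :=
  Quotient.exists_rep x

/-- A choice of a representing term of an orbit. -/
noncomputable def Orbits.rep (x : T.Orbits X i) : T.Term X i := (orbit_surjective x).choose

lemma orbit_rep (x : T.Orbits X i) : x.rep.orbit = x := (orbit_surjective x).choose_spec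

/-- The action of the standard monad on functions. -/
def Orbits.map (f : ∀ i, X i → Y i) : T.Orbits X i → T.Orbits Y i :=
  Quotient.lift (fun t => (t.map f).orbit) fun _ _ h => orbit_eq.2 (h.map f)

lemma Orbits.map_orbit (f : ∀ i, X i → Y i) (t : T.Term X i) :
    Orbits.map f t.orbit = (t.map f).orbit := rfl

lemma Term.exists_rep (t : T.Term (T.Orbits X) i) :
    ∃ s : T.Term (T.Term X) i, t = s.map fun _ => Term.orbit :=
  ⟨t.map fun _ => Orbits.rep, Term.ext' rfl fun j k h => by
    obtain rfl := Fin.ext h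
    exact heq_of_eq (orbit_rep _).symm⟩

/-- The multiplication of the standard monad: substitution of representing terms. -/
noncomputable def Orbits.mul : T.Orbits (T.Orbits X) i → T.Orbits X i :=
  Quotient.lift (fun t => (t.map fun _ => Orbits.rep).subst.orbit) fun t t' h => by
    refine orbit_eq.2 (Term.subst_congr ?_)
    have key : ∀ t : T.Term (T.Orbits X) i,
        (t.map fun _ => Orbits.rep).map (fun _ => Term.cls) = t := fun t =>
      Term.ext' rfl fun j k h => by
        obtain rfl := Fin.ext h
        exact heq_of_eq (orbit_rep _)
    rw [key, key]
    exact h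

lemma Orbits.mul_orbit (t : T.Term (T.Term X) i) :
    Orbits.mul (t.map fun _ => Term.orbit).orbit = t.subst.orbit := by
  refine orbit_eq.2 (Term.subst_congr ?_)
  rw [show ((t.map fun _ => Term.orbit).map fun _ => Orbits.rep).map (fun _ => Term.cls) =
    t.map fun _ => Term.cls from Term.ext' rfl fun j k h => by
      obtain rfl := Fin.ext h
      exact heq_of_eq (orbit_rep _)]
  exact Term.SameOrbit.refl _

lemma exists_orbit_orbit (x : T.Orbits (T.Orbits X) i) :
    ∃ s : T.Term (T.Term X) i, (s.map fun _ => Term.orbit).orbit = x := by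
  obtain ⟨t, rfl⟩ := orbit_surjective x
  obtain ⟨s, rfl⟩ := t.exists_rep
  exact ⟨s, rfl⟩

lemma exists_orbit_orbit_orbit (x : T.Orbits (T.Orbits (T.Orbits X)) i) :
    ∃ s : T.Term (T.Term (T.Term X)) i,
      (s.map fun _ t => (t.map fun _ => Term.orbit).orbit).orbit = x := by
  obtain ⟨s, rfl⟩ := exists_orbit_orbit x
  choose r hr using fun j => (s.arg j).exists_rep
  refine ⟨⟨s.n, s.c, s.op, r⟩, congrArg Term.orbit (Term.ext' rfl fun j k h => ?_)⟩
  obtain rfl := Fin.ext h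
  exact heq_of_eq (congrArg Term.orbit (hr j).symm)

lemma fam_ext {f g : X ⟶ Y} (h : ∀ i x, f i x = g i x) : f = g :=
  funext fun i => ConcreteCategory.hom_ext _ _ (h i)

end

/-- The standard monad of the operad `T` on the category of `I`-indexed families of sets, whose
algebras are the algebras of the operad `T` in the category of sets. -/
noncomputable def standardMonad : Monad (I → Type u) where
  obj X := T.Orbits X
  map f := fun _ => ↾(Orbits.map fun i x => f i x)
  map_id X := fam_ext fun i x => by
    obtain ⟨t, rfl⟩ := orbit_surjective x
    rfl
  map_comp f g := fam_ext fun i x => by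
    obtain ⟨t, rfl⟩ := orbit_surjective x
    rfl
  η := { app := fun X _ => ↾fun x => (Term.var x).orbit
         naturality := fun X Y f => fam_ext fun i x => rfl }
  μ := { app := fun X _ => ↾Orbits.mul
         naturality := fun X Y f => fam_ext fun i x => by
           obtain ⟨t, rfl⟩ := exists_orbit_orbit x
           have h₁ := Orbits.mul_orbit (t.map fun _ t => t.map fun i x => f i x)
           have h₂ := congrArg (Orbits.map fun i x => f i x) (Orbits.mul_orbit t)
           exact h₁.trans h₂.symm }
  assoc X := fam_ext fun i x => by
    obtain ⟨t, rfl⟩ := exists_orbit_orbit_orbit x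
    have h₁ := Orbits.mul_orbit (t.map fun _ t => t.subst)
    have h₂ := Orbits.mul_orbit t.subst
    have h₃ := congrArg Orbits.mul (Orbits.mul_orbit (t.map fun _ t => t.map fun _ => Term.orbit))
    have h₄ : t.map (fun _ s => Orbits.mul (s.map fun _ => Term.orbit).orbit) =
        t.map (fun _ s => s.subst.orbit) := congrArg (fun f : ∀ i, T.Term (T.Term X) i →
          T.Orbits X i => t.map f) (funext fun _ => funext fun s => Orbits.mul_orbit s)
    have h₅ := congrArg (fun t => Orbits.mul t.orbit) h₄
    have h₆ : t.subst.subst = (t.map fun _ t => t.subst).subst := (Term.subst_map_subst t).symm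
    exact h₅.trans (h₁.trans ((congrArg Term.orbit h₆.symm).trans (h₃.trans h₂).symm))
  left_unit X := fam_ext fun i x => by
    obtain ⟨t, rfl⟩ := orbit_surjective x
    have h := Orbits.mul_orbit (Term.var t)
    rw [Term.subst_var] at h
    exact h
  right_unit X := fam_ext fun i x => by
    obtain ⟨t, rfl⟩ := orbit_surjective x
    have h := Orbits.mul_orbit (t.map fun _ => Term.var)
    rw [Term.subst_map_var] at h
    exact h

end Operad

/-! ## Lax morphisms `T ⟶ Cat` -/

section Products

variable {I : Type u} {H : I → Type u} [∀ i, Category.{u} (H i)]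

/-- The functor `c_ρ` permuting the factors of a product of categories. -/
def permuteFactors {m n : ℕ} (c : Fin n → I) (ρ : Fin m ≃ Fin n) :
    (∀ j, H (c j)) ⥤ (∀ j, H ((c ∘ ρ) j)) where
  obj x := fun j => x (ρ j)
  map f := fun j => f (ρ j)

/-- The isomorphism identifying a category with the product of the family consisting of it only. -/
def toUnary (i : I) : H i ⥤ (∀ _ : Fin 1, H i) where
  obj x := fun _ => x
  map f := fun _ => f

/-- The isomorphism identifying an iterated product of categories with the product of the
concatenated sequence. -/
def concatFactors {n : ℕ} {m : Fin n → ℕ} (d : ∀ j, Fin (m j) → I) :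
    (∀ j k, H (d j k)) ⥤ (∀ l, H (concatFun d l)) where
  obj x := fun l => x (finSigmaFinEquiv.symm l).1 (finSigmaFinEquiv.symm l).2
  map f := fun l => f (finSigmaFinEquiv.symm l).1 (finSigmaFinEquiv.symm l).2

/-- The product of the functors `F j`. -/
def prodFunctor {n : ℕ} {m : Fin n → ℕ} {d : ∀ j, Fin (m j) → I} {c : Fin n → I}
    (F : ∀ j, (∀ k, H (d j k)) ⥤ H (c j)) : (∀ j k, H (d j k)) ⥤ (∀ j, H (c j)) where
  obj x := fun j => (F j).obj (x j)
  map f := fun j => (F j).map (f j)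
  map_id x := funext fun j => (F j).map_id (x j)
  map_comp f g := funext fun j => (F j).map_comp (f j) (g j)

end Products

/-- A lax morphism of operads `H : T ⟶ Cat` whose categories `H_i` are given. The axioms are
stated in components. -/
@[ext]
structure LaxMorphism {I : Type u} (T : Operad I) (H : I → Type u) [∀ i, Category.{u} (H i)] where
  /-- The products `H_α`. -/
  prod {n : ℕ} {c : Fin n → I} {i : I} (α : T.Hom c i) : (∀ j, H (c j)) ⥤ H i
  /-- The symmetries `ξ_{α,ρ} : H_{αρ} c_ρ ⟶ H_α`. -/
  sym {m n : ℕ} {c : Fin n → I} {i : I} (α : T.Hom c i) (ρ : Fin m ≃ Fin n) :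
    permuteFactors c ρ ⋙ prod (T.act ρ α) ⟶ prod α
  /-- The units `ν_i : 1 ⟶ H_{1_i}`. -/
  unit (i : I) : 𝟭 (H i) ⟶ toUnary i ⋙ prod (T.one i)
  /-- The substitutions `σ_{α,(β_j)_j} : H_α (∏_j H_{β_j}) ⟶ H_{α(β_j)_j}`. -/
  subst {n : ℕ} {c : Fin n → I} {i : I} {m : Fin n → ℕ} {d : ∀ j, Fin (m j) → I}
    (α : T.Hom c i) (β : ∀ j, T.Hom (d j) (c j)) :
    prodFunctor (fun j => prod (β j)) ⋙ prod α ⟶ concatFactors d ⋙ prod (T.comp α β)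
  /-- `ξ_{α,1} = id`. -/
  sym_refl {n : ℕ} {c : Fin n → I} {i : I} (α : T.Hom c i) :
    IsIdentity (sym α (Equiv.refl (Fin n)))
  /-- `ξ_{α,ρ₁ρ₂} = ξ_{α,ρ₁} (ξ_{αρ₁,ρ₂} c_{ρ₁})`. -/
  sym_trans {l m n : ℕ} {c : Fin n → I} {i : I} (α : T.Hom c i) (ρ₁ : Fin m ≃ Fin n)
    (ρ₂ : Fin l ≃ Fin m) (x : ∀ j, H (c j)) :
    SameArrow ((sym (T.act ρ₁ α) ρ₂).app ((permuteFactors c ρ₁).obj x) ≫ (sym α ρ₁).app x)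
      ((sym α (ρ₂.trans ρ₁)).app x)
  /-- The composite `H_α ⟶ H_α (∏_j H_{1_{i_j}}) ⟶ H_{α(1_{i_j})_j} = H_α` is the identity. -/
  subst_one {n : ℕ} {c : Fin n → I} {i : I} (α : T.Hom c i) (x : ∀ j, H (c j)) :
    IsIdentity ((prod α).map (fun j => (unit (c j)).app (x j)) ≫
      (subst α (fun j => T.one (c j))).app (fun j => (toUnary (c j)).obj (x j)))
  /-- The composite `H_α ⟶ H_{1_i} H_α ⟶ H_{1_i(α)} = H_α` is the identity. -/
  one_subst {n : ℕ} {c : Fin n → I} {i : I} (α : T.Hom c i) (x : ∀ j, H (c j)) :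
    IsIdentity ((unit i).app ((prod α).obj x) ≫
      (subst (T.one i) (fun _ => α)).app (fun _ => x))
  /-- The two composites `H_{αρ} (∏_j H_{β_{ρj}ρ_j}) ⟶ H_{α(β_j)_j}` agree, modulo
  `(αρ)(β_{ρj}ρ_j)_j = (α(β_j)_j)(ρ(ρ_j)_j)`. -/
  subst_sym {n n' : ℕ} {c : Fin n → I} {i : I} {m : Fin n → ℕ} {d : ∀ j, Fin (m j) → I}
    {m' : Fin n' → ℕ} (α : T.Hom c i) (β : ∀ j, T.Hom (d j) (c j))
    (ρ : Fin n' ≃ Fin n) (ρs : ∀ j, Fin (m' j) ≃ Fin (m (ρ j))) (x : ∀ j k, H (d j k)) :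
    ∃ h : (prod (T.comp (T.act ρ α) fun j => T.act (ρs j) (β (ρ j)))).obj
        ((concatFactors fun j => d (ρ j) ∘ ρs j).obj fun j k => x (ρ j) (ρs j k)) =
        (prod (T.act (blockPerm ρ ρs) (T.comp α β))).obj
          ((permuteFactors (concatFun d) (blockPerm ρ ρs)).obj ((concatFactors d).obj x)),
      (prod (T.act ρ α)).map (fun j => (sym (β (ρ j)) (ρs j)).app (x (ρ j))) ≫
          (sym α ρ).app (fun j => (prod (β j)).obj (x j)) ≫ (subst α β).app x =
        (subst (T.act ρ α) fun j => T.act (ρs j) (β (ρ j))).app (fun j k => x (ρ j) (ρs j k)) ≫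
          eqToHom h ≫ (sym (T.comp α β) (blockPerm ρ ρs)).app ((concatFactors d).obj x)
  /-- The two composites `H_α (∏_j H_{β_j} (∏_k H_{γ_jk})) ⟶ H_{α(β_j(γ_jk)_k)_j}` agree. -/
  subst_subst {n : ℕ} {c : Fin n → I} {i : I} {m : Fin n → ℕ} {d : ∀ j, Fin (m j) → I}
    {p : ∀ j, Fin (m j) → ℕ} {e : ∀ j k, Fin (p j k) → I}
    (α : T.Hom c i) (β : ∀ j, T.Hom (d j) (c j)) (γ : ∀ j k, T.Hom (e j k) (d j k))
    (x : ∀ j k l, H (e j k l)) :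
    SameArrow
      ((prod α).map (fun j => (subst (β j) (γ j)).app (x j)) ≫
        (subst α (fun j => T.comp (β j) (γ j))).app (fun j => (concatFactors (e j)).obj (x j)))
      ((subst α β).app (fun j k => (prod (γ j k)).obj (x j k)) ≫
        (subst (T.comp α β)
          (fun l => γ (finSigmaFinEquiv.symm l).1 (finSigmaFinEquiv.symm l).2)).app
          (fun l => x (finSigmaFinEquiv.symm l).1 (finSigmaFinEquiv.symm l).2))

namespace LaxMorphism

variable {I : Type u} {T : Operad I} {H : I → Type u} [∀ i, Category.{u} (H i)]

/-- A lax morphism is commutative if its symmetries are identities. -/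
def IsCommutative (M : LaxMorphism T H) : Prop :=
  ∀ {m n : ℕ} {c : Fin n → I} {i : I} (α : T.Hom c i) (ρ : Fin m ≃ Fin n), IsIdentity (M.sym α ρ)

/-- A lax morphism is a pseudo morphism if its units and substitutions are invertible. -/
def IsPseudo (M : LaxMorphism T H) : Prop :=
  (∀ i, IsIso (M.unit i)) ∧
    ∀ {n : ℕ} {c : Fin n → I} {i : I} {m : Fin n → ℕ} {d : ∀ j, Fin (m j) → I}
      (α : T.Hom c i) (β : ∀ j, T.Hom (d j) (c j)), IsIso (M.subst α β)

/-- A lax morphism is a strict morphism if its units and substitutions are identities. -/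
def IsStrict (M : LaxMorphism T H) : Prop :=
  (∀ i, IsIdentity (M.unit i)) ∧
    ∀ {n : ℕ} {c : Fin n → I} {i : I} {m : Fin n → ℕ} {d : ∀ j, Fin (m j) → I}
      (α : T.Hom c i) (β : ∀ j, T.Hom (d j) (c j)), IsIdentity (M.subst α β)

end LaxMorphism

/-! ## Comparison of algebras with morphisms into `Cat` -/

namespace CatOver

variable {I : Type u}

/-- The fibre over `i` of an object of `Cat/I`. -/
abbrev Fibre (H : CatOver I) (i : I) : Type u := Functor.Fiber H.proj ⟨i⟩

/-- The inclusion of the fibre over `i`. -/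
abbrev incl (H : CatOver I) (i : I) : H.Fibre i ⥤ H := Functor.Fiber.fiberInclusion

/-- The object of `Cat/I` with discrete fibres determined by an `I`-indexed family of sets. -/
abbrev disc (X : I → Type u) : CatOver I where
  carrier := Discrete (Σ i, X i)
  proj := Discrete.functor fun p => ⟨p.1⟩

/-- The 1-cell of `Cat/I` determined by a function of `I`-indexed families of sets. -/
def discMap {X Y : I → Type u} (f : X ⟶ Y) : disc X ⟶ disc Y where
  functor := Discrete.functor fun p => ⟨⟨p.1, f p.1 p.2⟩⟩
  w := CategoryTheory.Functor.ext (fun _ => rfl) fun _ _ _ => Subsingleton.elim _ _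

end CatOver

namespace Operad

variable {I : Type u} {T : Operad I} {H : CatOver I}

/-- The object `(α, (x_j)_j)` of `TH`. -/
def lab {n : ℕ} {c : Fin n → I} {i : I} (α : T.Hom c i) (x : ∀ j, H.Fibre (c j)) :
    T.labOver H :=
  (⟨toArr α, fun j => (H.incl _).obj (x j), fun j => congrArg Discrete.as (x j).2⟩ : T.Lab H)

/-- The levelwise arrow `(1, (γ_j)_j) : (α, (x_j)_j) ⟶ (α, (y_j)_j)` of `TH`. -/
def labLevelwise {n : ℕ} {c : Fin n → I} {i : I} (α : T.Hom c i) {x y : ∀ j, H.Fibre (c j)}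
    (γ : x ⟶ y) : lab α x ⟶ lab α y :=
  (⟨Equiv.refl (Fin n), fun j => (H.incl _).map (γ j), (actArr_refl _).symm⟩ :
    Lab.Hom (lab α x) (lab α y))

/-- The permutative arrow `(ρ, (1)_j) : (αρ, (x_{ρj})_j) ⟶ (α, (x_j)_j)` of `TH`. -/
def labPermutative {m n : ℕ} {c : Fin n → I} {i : I} (α : T.Hom c i) (ρ : Fin m ≃ Fin n)
    (x : ∀ j, H.Fibre (c j)) :
    lab (T.act ρ α) ((permuteFactors c ρ).obj x) ⟶ lab α x :=
  (⟨ρ, fun j => 𝟙 ((H.incl _).obj (x (ρ j))), rfl⟩ :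
    Lab.Hom (lab (T.act ρ α) ((permuteFactors c ρ).obj x)) (lab α x))

/-- The object `(α, (β_j, (x_jk)_k)_j)` of `TTH`. -/
def lab₂ {n : ℕ} {c : Fin n → I} {i : I} {m : Fin n → ℕ} {d : ∀ j, Fin (m j) → I}
    (α : T.Hom c i) (β : ∀ j, T.Hom (d j) (c j)) (x : ∀ j k, H.Fibre (d j k)) :
    T.labOver (T.labOver H) :=
  (⟨toArr α, fun j => lab (β j) (x j), fun _ => rfl⟩ : T.Lab (T.labOver H))

/-- Let `q : T ⟶ Q` be a morphism of 2-monads. The lax `Q`-algebra structure `A` on `H` and the lax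
morphism `M : T ⟶ Cat` whose categories are the fibres of `H` are built from the same data: with
`a : TH ⟶ H` the composite of `q_H` with the action of `A`, the products of `M` are the values of
`a` at objects and levelwise arrows, the symmetries of `M` are the values of `a` at permutative
arrows, and the units and substitutions of `M` are the components of the coherence 2-cells
of `A`. -/
structure Corresponds {Q : TwoMonad (CatOver I)} (q : TwoMonad.Hom T.twoMonad Q)
    (A : Q.LaxAlgebra H) (M : LaxMorphism T H.Fibre) : Prop where
  prod_obj {n : ℕ} {c : Fin n → I} {i : I} (α : T.Hom c i) (x : ∀ j, H.Fibre (c j)) :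
    (H.incl i).obj ((M.prod α).obj x) = (q.app H ≫ A.a).functor.obj (lab α x)
  prod_map {n : ℕ} {c : Fin n → I} {i : I} (α : T.Hom c i) {x y : ∀ j, H.Fibre (c j)}
    (γ : x ⟶ y) :
    SameArrow ((H.incl i).map ((M.prod α).map γ))
      ((q.app H ≫ A.a).functor.map (labLevelwise α γ))
  sym {m n : ℕ} {c : Fin n → I} {i : I} (α : T.Hom c i) (ρ : Fin m ≃ Fin n)
    (x : ∀ j, H.Fibre (c j)) :
    SameArrow ((H.incl i).map ((M.sym α ρ).app x))
      ((q.app H ≫ A.a).functor.map (labPermutative α ρ x))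
  unit {i : I} (x : H.Fibre i) :
    SameArrow ((H.incl i).map ((M.unit i).app x)) (A.a₀.nat.app ((H.incl i).obj x))
  subst {n : ℕ} {c : Fin n → I} {i : I} {m : Fin n → ℕ} {d : ∀ j, Fin (m j) → I}
    (α : T.Hom c i) (β : ∀ j, T.Hom (d j) (c j)) (x : ∀ j k, H.Fibre (d j k)) :
    SameArrow ((H.incl i).map ((M.subst α β).app x))
      (A.a₂.nat.app ((T.twoMonad.T.map (q.app H) ≫ q.app (Q.T.obj H)).functor.obj (lab₂ α β x)))

/-- The restriction of the 2-monad `Q` under `T` to objects of `Cat/I` with discrete fibres is the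
standard monad of the operad `T`: there is a natural family of isomorphisms, compatible with units
and multiplications, under which `q : T ⟶ Q` sends a labelled operation to its orbit. -/
def AgreesWithStandardMonad {Q : TwoMonad (CatOver I)} (q : TwoMonad.Hom T.twoMonad Q) : Prop :=
  ∃ (φ : ∀ X : I → Type u, Q.T.obj (CatOver.disc X) ⟶ CatOver.disc (T.standardMonad.obj X))
    (ψ : ∀ X : I → Type u, CatOver.disc (T.standardMonad.obj X) ⟶ Q.T.obj (CatOver.disc X)),
    (∀ X, φ X ≫ ψ X = 𝟙 _) ∧
    (∀ X, ψ X ≫ φ X = 𝟙 _) ∧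
    (∀ {X Y : I → Type u} (f : X ⟶ Y), Q.T.map (CatOver.discMap f) ≫ φ Y =
      φ X ≫ CatOver.discMap (T.standardMonad.map f)) ∧
    (∀ X, Q.unit (CatOver.disc X) ≫ φ X = CatOver.discMap (T.standardMonad.η.app X)) ∧
    (∀ X, Q.mult (CatOver.disc X) ≫ φ X =
      Q.T.map (φ X) ≫ φ (T.standardMonad.obj X) ≫ CatOver.discMap (T.standardMonad.μ.app X)) ∧
    ∀ (X : I → Type u) {i : I} (t : T.Term X i),
      (q.app (CatOver.disc X) ≫ φ X).functor.obj
        (⟨toArr t.op, fun j => ⟨⟨t.c j, t.arg j⟩⟩, fun _ => rfl⟩ : T.Lab (CatOver.disc X)) =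
      ⟨⟨i, t.orbit⟩⟩

end Operad

end CatOperads

namespace CatOperads

/-! ## Strict coidentifiers of categories -/

section StrictQuotient

/-! The coidentifier in `Mnd(Cat/I)` is computed pointwise: `(T/Σ)X` is the strict coidentifier, in
`Cat/I`, of the permutative arrows of `TX`. Permutative arrows can be composed and reversed, so no
formal composites have to be added. The projection `TX ⟶ (T/Σ)X` is full and surjective on objects,
two objects have the same image iff a permutative arrow connects them, and two parallel arrows have
the same image iff a finite chain of replacements of a permutative factor by a parallel one leads
from one to the other. `IsCoid` records this description. It yields the one-dimensional universal
property (`IsCoid.exists_desc`), and fullness alone yields the two-dimensional one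
(`IsFullSurj.exists_natTrans`).

The decisive point is that `T` preserves such coidentifiers (`isCoid_labMap`). An arrow of `TX` is a
permutation together with a finite family of arrows, and finitely many chains of reflexive
elementary relations can be merged into one chain of families (`eqvGen_pi`). Hence `TTX ⟶ T(T/Σ)X ⟶
(T/Σ)(T/Σ)X` is full and surjective on objects, and the multiplication of `T`, which sends
permutative arrows of either layer to permutative arrows, descends along it (`exists_quotMult`). The
monad axioms and the universal property are then inherited from `T` by cancelling these projections.
Any other coidentifier is isomorphic to this one, so its components satisfy `IsCoid` too
(`isCoid_of_isCoidentifier`); the comparison results use nothing else.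

On a discrete `X` every arrow of `TX` is permutative. So `(T/Σ)X` has only identities, and its
objects are the orbits of the symmetric groups.

For the algebras, write `Q` for the coidentifier. A functor `QH ⟶ H` is a functor `TH ⟶ H` sending
permutative arrows to identities. Every arrow of `TH` is a levelwise one followed by a permutative
one (`lab_factor`), so such a functor is a family `H_α` with `H_{αρ} c_ρ = H_α`. Likewise `a₂` is a
family indexed by the objects of `TTH`: naturality in levelwise arrows is naturality of the
substitutions, and naturality in permutative arrows is their compatibility with the symmetries
(`lab₂_factor`). The algebra axioms, evaluated at images of objects of `TH` and `TTTH`, are the unit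
and associativity axioms of a lax morphism. Finally, `Corresponds` determines each side from the
other (`PreCorresponds.morphism_unique`, `PreCorresponds.algebra_unique`). -/

lemma SameArrow.eq {C : Type u} [Category.{v} C] {x y : C} {f g : x ⟶ y} (h : SameArrow f g) :
    f = g := Arrow.mk_injective _ _ h

lemma IsIdentity.sameArrow {C : Type u} [Category.{v} C] {x y : C} {f : x ⟶ y}
    (h : IsIdentity f) : SameArrow f (𝟙 x) := by
  obtain ⟨rfl, rfl⟩ := h
  exact SameArrow.rfl

lemma IsIdentity.sameArrow_tgt {C : Type u} [Category.{v} C] {x y : C} {f : x ⟶ y}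
    (h : IsIdentity f) : SameArrow f (𝟙 y) := by
  obtain ⟨rfl, rfl⟩ := h
  exact SameArrow.rfl

lemma IsIdentity.src_eq_tgt {C : Type u} [Category.{v} C] {x y : C} {f : x ⟶ y}
    (h : IsIdentity f) : x = y := h.1

lemma IsIdentity.eq {C : Type u} [Category.{v} C] {x y : C} {f g : x ⟶ y}
    (h : IsIdentity f) (h' : IsIdentity g) : f = g := by
  obtain ⟨_, rfl⟩ := h
  obtain ⟨_, rfl⟩ := h'
  rfl

lemma SameArrow.comp_isIdentity {C : Type u} [Category.{v} C] {x y z : C} (f : x ⟶ y) {g : y ⟶ z}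
    (h : IsIdentity g) : SameArrow (f ≫ g) f := by
  obtain ⟨rfl, rfl⟩ := h
  exact sameArrow_comp_eqToHom _ _

lemma SameArrow.isIdentity_comp {C : Type u} [Category.{v} C] {x y z : C} {f : x ⟶ y} (g : y ⟶ z)
    (h : IsIdentity f) : SameArrow (f ≫ g) g := by
  obtain ⟨rfl, rfl⟩ := h
  exact sameArrow_eqToHom_comp _ _

lemma SameArrow.src_eq {C : Type u} [Category.{v} C] {x y x' y' : C} {f : x ⟶ y} {g : x' ⟶ y'}
    (h : SameArrow f g) : x = x' := congrArg Comma.left h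

lemma SameArrow.tgt_eq {C : Type u} [Category.{v} C] {x y x' y' : C} {f : x ⟶ y} {g : x' ⟶ y'}
    (h : SameArrow f g) : y = y' := congrArg Comma.right h

lemma IsIdentity.sameArrow_of_src_eq {C : Type u} [Category.{v} C] {x y x' y' : C} {f : x ⟶ y}
    {g : x' ⟶ y'} (hf : IsIdentity f) (hg : IsIdentity g) (h : x = x') : SameArrow f g := by
  subst h
  exact hf.sameArrow.trans hg.sameArrow.symm

lemma SameArrow.isIso_iff {C : Type u} [Category.{v} C] {x y x' y' : C} {f : x ⟶ y} {g : x' ⟶ y'}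
    (h : SameArrow f g) : IsIso f ↔ IsIso g := by
  obtain ⟨h₁, h₂, rfl⟩ := (Arrow.mk_eq_mk_iff _ _).1 h
  subst h₁ h₂
  simp

/-- A natural transformation is an identity if all its components are. -/
lemma isIdentity_natTrans {C D : Type*} [Category* C] [Category* D] {F G : C ⥤ D} (θ : F ⟶ G)
    (h : ∀ x, IsIdentity (θ.app x)) : IsIdentity θ := by
  -- The naturality square of `f` has identities as its two vertical sides, so its horizontal sides
  -- `F.map f` and `G.map f` are the same arrow.
  obtain rfl : F = G := SameArrow.functor_ext fun f =>
    ((SameArrow.comp_isIdentity _ (h _)).symm.trans (SameArrow.of_eq (θ.naturality f))).trans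
      (SameArrow.isIdentity_comp _ (h _))
  exact ⟨rfl, NatTrans.ext (funext fun x => (h x).eq (isIdentity_id _))⟩

lemma IsIdentity.natTrans_app {C D : Type*} [Category* C] [Category* D] {F G : C ⥤ D} {θ : F ⟶ G}
    (h : IsIdentity θ) (x : C) : IsIdentity (θ.app x) := by
  obtain ⟨rfl, rfl⟩ := h
  exact isIdentity_id _

variable {C D E : Type u} [Category.{u} C] [Category.{u} D] [Category.{u} E]

/-- The relation identifying all parallel arrows with property `P`. -/
def parallel (P : MorphismProperty C) : HomRel C := fun _ _ p p' => P p ∧ P p'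

/-- The functor `q` is full and surjective on objects. -/
structure IsFullSurj (q : C ⥤ D) : Prop where
  obj_surj (y : D) : ∃ x, q.obj x = y
  exists_map {a b : C} (g : q.obj a ⟶ q.obj b) : ∃ f, q.map f = g

lemma IsFullSurj.comp {q : C ⥤ D} {r : D ⥤ E} (hq : IsFullSurj q) (hr : IsFullSurj r) :
    IsFullSurj (q ⋙ r) where
  obj_surj z := by
    obtain ⟨y, rfl⟩ := hr.obj_surj z
    obtain ⟨x, rfl⟩ := hq.obj_surj y
    exact ⟨x, rfl⟩
  exists_map g := by
    obtain ⟨f, rfl⟩ := hr.exists_map g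
    obtain ⟨e, rfl⟩ := hq.exists_map f
    exact ⟨e, rfl⟩

lemma IsFullSurj.exists_sameArrow {q : C ⥤ D} (hq : IsFullSurj q) {x y : D} (g : x ⟶ y) :
    ∃ (a b : C) (f : a ⟶ b), SameArrow (q.map f) g := by
  obtain ⟨a, rfl⟩ := hq.obj_surj x
  obtain ⟨b, rfl⟩ := hq.obj_surj y
  obtain ⟨f, rfl⟩ := hq.exists_map g
  exact ⟨a, b, f, rfl⟩

/-- Up to equality of endpoints every arrow of `D` is some `q.map f`. So `q` is strictly an
epimorphism. -/
lemma IsFullSurj.functor_ext {q : C ⥤ D} (hq : IsFullSurj q) {F G : D ⥤ E}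
    (h : q ⋙ F = q ⋙ G) : F = G :=
  SameArrow.functor_ext fun {x y} g => by
    obtain ⟨a, b, f, hf⟩ := hq.exists_sameArrow g
    exact ((hf.map F).symm.trans (SameArrow.functor_map h f)).trans (hf.map G)

/-- Fullness makes this work without any condition on `θ`: its components depend only on the image
of the object under `q`, and naturality along an arrow of `D` is naturality along a lift. -/
lemma IsFullSurj.exists_natTrans {q : C ⥤ D} (hq : IsFullSurj q) {F G : D ⥤ E}
    (θ : q ⋙ F ⟶ q ⋙ G) : ∃ θ' : F ⟶ G, ∀ x, θ'.app (q.obj x) = θ.app x := by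
  choose s hs using hq.obj_surj
  -- The equality `q.obj x = q.obj y`, viewed as an arrow, lifts to some `x ⟶ y`; naturality of `θ`
  -- along this lift identifies the two components.
  have key : ∀ x y (h : q.obj x = q.obj y),
      eqToHom (congrArg F.obj h) ≫ θ.app y = θ.app x ≫ eqToHom (congrArg G.obj h) := by
    intro x y h
    obtain ⟨f, hf⟩ := hq.exists_map (eqToHom h)
    have := θ.naturality f
    simpa [hf, eqToHom_map] using this
  refine ⟨{ app := fun y => eqToHom (congrArg F.obj (hs y).symm) ≫ θ.app (s y) ≫
              eqToHom (congrArg G.obj (hs y)), naturality := ?_ }, fun x => ?_⟩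
  · intro x y g
    obtain ⟨f, hf⟩ := hq.exists_map (eqToHom (hs x) ≫ g ≫ eqToHom (hs y).symm)
    have := θ.naturality f
    dsimp only [Functor.comp_map, Functor.comp_obj] at this
    rw [hf] at this
    simp only [Functor.map_comp, eqToHom_map, Category.assoc] at this
    have hg : F.map g ≫ eqToHom (congrArg F.obj (hs y).symm) ≫ θ.app (s y) =
        eqToHom (congrArg F.obj (hs x).symm) ≫ θ.app (s x) ≫ eqToHom (congrArg G.obj (hs x)) ≫
          G.map g ≫ eqToHom (congrArg G.obj (hs y).symm) := by
      rw [← this]; simp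
    simp only [Category.assoc]
    rw [reassoc_of% hg]
    simp
  · have := key _ _ (hs (q.obj x)).symm
    dsimp only
    rw [reassoc_of% this]
    simp

lemma IsFullSurj.natTrans_ext {q : C ⥤ D} (hq : IsFullSurj q) {F G : D ⥤ E} {θ θ' : F ⟶ G}
    (h : ∀ x, θ.app (q.obj x) = θ'.app (q.obj x)) : θ = θ' := by
  ext y
  obtain ⟨x, rfl⟩ := hq.obj_surj y
  exact h x

/-- The functor `q` presents its target as the strict coidentifier of the arrows with
property `P`. -/
structure IsCoid (P : MorphismProperty C) (q : C ⥤ D) : Prop extends IsFullSurj q where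
  isIdentity {a b : C} (p : a ⟶ b) : P p → IsIdentity (q.map p)
  exists_prop {a b : C} : q.obj a = q.obj b → ∃ p : a ⟶ b, P p
  eqvGen {a b : C} {f g : a ⟶ b} : q.map f = q.map g →
    Relation.EqvGen (HomRel.CompClosure (parallel P) (X := a) (Y := b)) f g

/-- Parallel arrows with property `P` become parallel identities, and those are equal; an elementary
replacement is therefore invisible to `F`. -/
lemma map_eq_of_eqvGen {P : MorphismProperty C} {F : C ⥤ E}
    (hF : ∀ {a b : C} (p : a ⟶ b), P p → IsIdentity (F.map p)) {a b : C} {f g : a ⟶ b}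
    (h : Relation.EqvGen (HomRel.CompClosure (parallel P) (X := a) (Y := b)) f g) :
    F.map f = F.map g := by
  induction h with
  | rel _ _ h =>
    obtain ⟨c, d, u, p, p', v, h, h'⟩ := h
    simp only [F.map_comp, (hF p h).eq (hF p' h')]
  | refl => rfl
  | symm _ _ _ ih => exact ih.symm
  | trans _ _ _ _ _ ih ih' => exact ih.trans ih'

namespace IsCoid

variable {P : MorphismProperty C} {q : C ⥤ D} (hq : IsCoid P q)
include hq

/-- This makes descent well defined. The sources of `f` and `g` are connected by some `p` in `P`,
the targets by some `p'`. Then `f ≫ p'` and `p ≫ g` are parallel with the same image under `q`,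
hence joined by a chain of replacements, and `F` sends `p` and `p'` to identities. -/
lemma sameArrow_map {F : C ⥤ E} (hF : ∀ {a b : C} (p : a ⟶ b), P p → IsIdentity (F.map p))
    {a b a' b' : C} {f : a ⟶ b} {g : a' ⟶ b'} (h : SameArrow (q.map f) (q.map g)) :
    SameArrow (F.map f) (F.map g) := by
  obtain ⟨p, hp⟩ := hq.exists_prop h.src_eq
  obtain ⟨p', hp'⟩ := hq.exists_prop h.tgt_eq
  have e : q.map (f ≫ p') = q.map (p ≫ g) := by
    refine SameArrow.eq ?_
    rw [q.map_comp, q.map_comp]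
    exact ((SameArrow.comp_isIdentity _ (hq.isIdentity p' hp')).trans h).trans
      (SameArrow.isIdentity_comp _ (hq.isIdentity p hp)).symm
  have e' := map_eq_of_eqvGen hF (hq.eqvGen e)
  rw [F.map_comp, F.map_comp] at e'
  exact ((SameArrow.comp_isIdentity _ (hF p' hp')).symm.trans (SameArrow.of_eq e')).trans
      (SameArrow.isIdentity_comp _ (hF p hp))

/-- The descended functor is evaluated on chosen lifts of objects and arrows. By `sameArrow_map` the
choices do not matter, which gives both functoriality and the factorization. -/
lemma exists_desc (F : C ⥤ E) (hF : ∀ {a b : C} (p : a ⟶ b), P p → IsIdentity (F.map p)) :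
    ∃ G : D ⥤ E, q ⋙ G = F := by
  choose s hs using hq.obj_surj
  have hl : ∀ {x y : D} (g : x ⟶ y), ∃ f : s x ⟶ s y, SameArrow (q.map f) g := fun {x y} g => by
    obtain ⟨f, hf⟩ := hq.exists_map (eqToHom (hs x) ≫ g ≫ eqToHom (hs y).symm)
    exact ⟨f, (SameArrow.of_eq hf).trans ((sameArrow_eqToHom_comp _ _).trans
      (sameArrow_comp_eqToHom _ _))⟩
  choose l hl using @hl
  refine ⟨{ obj := fun x => F.obj (s x), map := fun g => F.map (l g), map_id := ?_, map_comp := ?_ },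
    ?_⟩
  · intro x
    rw [← F.map_id]
    refine (hq.sameArrow_map hF ((hl _).trans ?_)).eq
    rw [q.map_id, hs]
    rfl
  · intro x y z f g
    rw [← F.map_comp]
    refine (hq.sameArrow_map hF ((hl _).trans ?_)).eq
    rw [q.map_comp]
    exact (SameArrow.comp (hl f) (hl g)).symm
  · exact SameArrow.functor_ext fun f => hq.sameArrow_map hF (hl _)

end IsCoid

/-- Being a strict coidentifier is invariant under isomorphisms of categories. -/
lemma IsCoid.comp_iso {P : MorphismProperty C} {q : C ⥤ D} (hq : IsCoid P q) {r : D ⥤ E}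
    {s : E ⥤ D} (h : r ⋙ s = 𝟭 D) (h' : s ⋙ r = 𝟭 E) : IsCoid P (q ⋙ r) where
  toIsFullSurj := hq.toIsFullSurj.comp
    { obj_surj := fun y => ⟨s.obj y, Functor.congr_obj h' y⟩
      exists_map := fun {a b} g => by
        refine ⟨eqToHom (Functor.congr_obj h a).symm ≫ s.map g ≫ eqToHom (Functor.congr_obj h b),
          SameArrow.eq ?_⟩
        refine (SameArrow.map r ((sameArrow_eqToHom_comp _ _).trans
          (sameArrow_comp_eqToHom _ _))).trans (SameArrow.functor_map h' g) }
  isIdentity p hp := (hq.isIdentity p hp).map r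
  exists_prop {a b} e := hq.exists_prop (by
    rw [← Functor.id_obj (q.obj a), ← Functor.id_obj (q.obj b), ← h]
    exact congrArg s.obj e)
  eqvGen {a b f g} e := hq.eqvGen (by
    refine SameArrow.eq ((SameArrow.functor_map h.symm (q.map f)).trans
      (SameArrow.trans ?_ (SameArrow.functor_map h (q.map g))))
    exact SameArrow.of_eq (congrArg s.map e))

end StrictQuotient

/-! ## Construction of strict coidentifiers -/

section Construction

variable {C : Type u} [Category.{u} C]

/-- The arrows with property `P` form a wide subcategory, in which the relation of being
connected is symmetric. -/
class IsGroupoidal (P : MorphismProperty C) : Prop where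
  id_mem (a : C) : P (𝟙 a)
  comp_mem {a b c : C} (p : a ⟶ b) (p' : b ⟶ c) : P p → P p' → P (p ≫ p')
  symm_mem {a b : C} (p : a ⟶ b) : P p → ∃ p' : b ⟶ a, P p'

variable (P : MorphismProperty C) [IsGroupoidal P]

/-- Two objects are equivalent if they are connected by an arrow with property `P`. -/
def connSetoid : Setoid C where
  r a b := ∃ p : a ⟶ b, P p
  iseqv :=
    { refl := fun a => ⟨𝟙 a, IsGroupoidal.id_mem a⟩
      symm := fun ⟨p, hp⟩ => IsGroupoidal.symm_mem p hp
      trans := fun ⟨p, hp⟩ ⟨p', hp'⟩ => ⟨p ≫ p', IsGroupoidal.comp_mem p p' hp hp'⟩ }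

/-- The objects of the strict coidentifier of the arrows with property `P`. -/
def CoidCat : Type u := Quotient (connSetoid P)

variable {P}

/-- A representative of an object of the strict coidentifier. -/
noncomputable def CoidCat.rep (x : CoidCat P) : C := Quotient.out (s := connSetoid P) x

/-- An arrow between two classes is an arrow between their representatives, modulo the
identification of parallel arrows in `P`. Formal zigzags are not needed: any two objects of a class
are connected in both directions by arrows of `P`, so a path jumping between them can be composed in
`C`. -/
noncomputable instance : Category.{u} (CoidCat P) where
  Hom x y := (⟨x.rep⟩ : CategoryTheory.Quotient (parallel P)) ⟶ ⟨y.rep⟩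
  id x := 𝟙 (⟨x.rep⟩ : CategoryTheory.Quotient (parallel P))
  comp {x y z} f g := CategoryStruct.comp (X := (⟨x.rep⟩ : CategoryTheory.Quotient (parallel P)))
    (Y := ⟨y.rep⟩) (Z := ⟨z.rep⟩) f g
  id_comp {x y} f := Category.id_comp (X := (⟨x.rep⟩ : CategoryTheory.Quotient (parallel P)))
    (Y := ⟨y.rep⟩) f
  comp_id {x y} f := Category.comp_id (X := (⟨x.rep⟩ : CategoryTheory.Quotient (parallel P)))
    (Y := ⟨y.rep⟩) f
  assoc {x y z t} f g h := Category.assoc (W := (⟨x.rep⟩ : CategoryTheory.Quotient (parallel P)))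
    (X := ⟨y.rep⟩) (Y := ⟨z.rep⟩) (Z := ⟨t.rep⟩) f g h

namespace CoidCat

/-- The arrow of the strict coidentifier represented by an arrow between representatives. -/
noncomputable def homMk {x y : CoidCat P} (f : x.rep ⟶ y.rep) : x ⟶ y :=
  (CategoryTheory.Quotient.functor (parallel P)).map f

lemma homMk_comp {x y z : CoidCat P} (f : x.rep ⟶ y.rep) (g : y.rep ⟶ z.rep) :
    homMk (f ≫ g) = homMk f ≫ homMk g :=
  (CategoryTheory.Quotient.functor (parallel P)).map_comp f g

lemma homMk_id (x : CoidCat P) : homMk (𝟙 x.rep) = 𝟙 x :=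
  (CategoryTheory.Quotient.functor (parallel P)).map_id x.rep

lemma homMk_surjective {x y : CoidCat P} (g : x ⟶ y) : ∃ f : x.rep ⟶ y.rep, homMk f = g :=
  Quot.exists_rep g

lemma homMk_sound {x y : CoidCat P} {c d : C} (u : x.rep ⟶ c) (p p' : c ⟶ d) (v : d ⟶ y.rep)
    (h : P p) (h' : P p') : homMk (x := x) (y := y) (u ≫ p ≫ v) = homMk (u ≫ p' ≫ v) :=
  Quot.sound (HomRel.CompClosure.intro _ _ u p p' v ⟨h, h'⟩)

lemma homMk_exact {x y : CoidCat P} {f g : x.rep ⟶ y.rep} (h : homMk (x := x) (y := y) f = homMk g) :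
    Relation.EqvGen (HomRel.CompClosure (parallel P) (X := x.rep) (Y := y.rep)) f g :=
  Quot.eqvGen_exact h

/-- When `x = y`, the arrow `p` is parallel to the identity of the representative, which also has
property `P`, so the quotient identifies the two. -/
lemma homMk_isIdentity {x y : CoidCat P} (p : x.rep ⟶ y.rep) (hp : P p) (h : x = y) :
    IsIdentity (homMk (x := x) (y := y) p) := by
  subst h
  have := homMk_sound (x := x) (y := x) (𝟙 _) p (𝟙 _) (𝟙 _) hp (IsGroupoidal.id_mem _)
  simp only [Category.id_comp, Category.comp_id, homMk_id] at this
  rw [this]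
  exact isIdentity_id x

variable (P) in
/-- The class of an object. -/
def cls (a : C) : CoidCat P := Quotient.mk (connSetoid P) a

lemma exists_to (a : C) : ∃ p : (cls P a).rep ⟶ a, P p :=
  Quotient.exact (s := connSetoid P) (Quotient.out_eq (s := connSetoid P) _)

lemma exists_from (a : C) : ∃ p : a ⟶ (cls P a).rep, P p :=
  let ⟨p, hp⟩ := exists_to (P := P) a
  IsGroupoidal.symm_mem p hp

variable (P) in
/-- A chosen arrow from the representative of the class of an object to this object. -/
noncomputable def toObj (a : C) : (cls P a).rep ⟶ a := (exists_to a).choose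

variable (P) in
/-- A chosen arrow from an object to the representative of its class. -/
noncomputable def fromObj (a : C) : a ⟶ (cls P a).rep := (exists_from a).choose

lemma toObj_mem (a : C) : P (toObj P a) := (exists_to a).choose_spec

lemma fromObj_mem (a : C) : P (fromObj P a) := (exists_from a).choose_spec

variable (P) in
/-- The functor to the strict coidentifier. -/
noncomputable def proj : C ⥤ CoidCat P where
  obj := cls P
  map {a b} f := homMk (toObj P a ≫ f ≫ fromObj P b)
  map_id a := (homMk_isIdentity _ (IsGroupoidal.comp_mem _ _ (toObj_mem a)
    (IsGroupoidal.comp_mem _ _ (IsGroupoidal.id_mem a) (fromObj_mem a))) rfl).eq (isIdentity_id _)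
  map_comp {a b c} f g := by
    rw [← homMk_comp]
    -- The product of the two images contains the round trip from `b` to its representative and
    -- back. It is an endomorphism in `P`, so it may be replaced by `𝟙 b`.
    have := homMk_sound (P := P) (x := cls P a) (y := cls P c) (toObj P a ≫ f) (𝟙 b)
      (fromObj P b ≫ toObj P b) (g ≫ fromObj P c) (IsGroupoidal.id_mem b)
      (IsGroupoidal.comp_mem _ _ (fromObj_mem b) (toObj_mem b))
    simpa using this

lemma isCoid_proj : IsCoid P (proj P) where
  obj_surj y := ⟨y.rep, Quotient.out_eq (s := connSetoid P) y⟩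
  exists_map {a b} g := by
    change cls P a ⟶ cls P b at g
    obtain ⟨f, rfl⟩ := homMk_surjective g
    -- The lift moves `f` from the representatives to `a` and `b`. Its image contains one round trip
    -- at each end, and `h₁` and `h₂` remove them.
    refine ⟨fromObj P a ≫ f ≫ toObj P b, ?_⟩
    have h₁ := homMk_sound (P := P) (x := cls P a) (y := cls P b) (𝟙 _)
      (toObj P a ≫ fromObj P a) (𝟙 _) (f ≫ toObj P b ≫ fromObj P b)
      (IsGroupoidal.comp_mem _ _ (toObj_mem a) (fromObj_mem a)) (IsGroupoidal.id_mem _)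
    have h₂ := homMk_sound (P := P) (x := cls P a) (y := cls P b) f
      (toObj P b ≫ fromObj P b) (𝟙 _) (𝟙 _)
      (IsGroupoidal.comp_mem _ _ (toObj_mem b) (fromObj_mem b)) (IsGroupoidal.id_mem _)
    simp only [Category.id_comp, Category.comp_id, Category.assoc] at h₁ h₂
    refine (congrArg homMk ?_).trans (h₁.trans h₂)
    simp only [Category.assoc]
  isIdentity {a b} p hp := homMk_isIdentity _ (IsGroupoidal.comp_mem _ _ (toObj_mem a)
    (IsGroupoidal.comp_mem _ _ hp (fromObj_mem b))) (Quotient.sound (s := connSetoid P) ⟨p, hp⟩)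
  exists_prop h := Quotient.exact (s := connSetoid P) h
  eqvGen {a b f g} h := by
    -- Equality of images gives a chain between the transports of `f` and `g` to the
    -- representatives. Transporting back to `a` and `b` preserves equality in the quotient (`key`),
    -- and the resulting round trips are trivial there (`h₁`).
    have key : ∀ {f g : (cls P a).rep ⟶ (cls P b).rep},
        Relation.EqvGen (HomRel.CompClosure (parallel P)
          (X := (cls P a).rep) (Y := (cls P b).rep)) f g →
        (Quotient.functor (parallel P)).map (fromObj P a ≫ f ≫ toObj P b) =
          (Quotient.functor (parallel P)).map (fromObj P a ≫ g ≫ toObj P b) := by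
      intro f g h
      simp only [Functor.map_comp]
      rw [show (Quotient.functor (parallel P)).map f = (Quotient.functor (parallel P)).map g from
        Quot.eqvGen_sound h]
    have h₁ : ∀ f : a ⟶ b, (Quotient.functor (parallel P)).map
        (fromObj P a ≫ (toObj P a ≫ f ≫ fromObj P b) ≫ toObj P b) =
        (Quotient.functor (parallel P)).map f := by
      intro f
      have h₁ : (Quotient.functor (parallel P)).map (fromObj P a ≫ toObj P a) = 𝟙 _ :=
        (CategoryTheory.Quotient.sound _ ⟨IsGroupoidal.comp_mem _ _ (fromObj_mem a) (toObj_mem a),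
          IsGroupoidal.id_mem _⟩).trans (CategoryTheory.Functor.map_id _ _)
      have h₂ : (Quotient.functor (parallel P)).map (fromObj P b ≫ toObj P b) = 𝟙 _ :=
        (CategoryTheory.Quotient.sound _ ⟨IsGroupoidal.comp_mem _ _ (fromObj_mem b) (toObj_mem b),
          IsGroupoidal.id_mem _⟩).trans (CategoryTheory.Functor.map_id _ _)
      rw [show fromObj P a ≫ (toObj P a ≫ f ≫ fromObj P b) ≫ toObj P b =
        (fromObj P a ≫ toObj P a) ≫ f ≫ (fromObj P b ≫ toObj P b) by simp, Functor.map_comp,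
        Functor.map_comp _ f, h₁, h₂]
      exact (Category.id_comp _).trans (Category.comp_id _)
    exact Quot.eqvGen_exact (((h₁ f).symm.trans (key (homMk_exact h))).trans (h₁ g))

end CoidCat

end Construction

/-! ## Strict coidentifiers over a set -/

namespace CatOver

variable {I : Type u} {X Y Z : CatOver I}

lemma epi_of_isFullSurj {q : X ⟶ Y} (hq : IsFullSurj q.functor) {F G : Y ⟶ Z}
    (h : q ≫ F = q ≫ G) : F = G :=
  hom_ext (hq.functor_ext (congrArg Hom.functor h))

lemma exists_desc {P : MorphismProperty X} {q : X ⟶ Y} (hq : IsCoid P q.functor) (F : X ⟶ Z)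
    (hF : ∀ {a b : X} (p : a ⟶ b), P p → IsIdentity (F.functor.map p)) :
    ∃ G : Y ⟶ Z, q ≫ G = F := by
  obtain ⟨G, hG⟩ := hq.exists_desc F.functor hF
  -- That the descended functor lies over `I` can be tested after precomposition with `q`, where it
  -- is the corresponding property of `F`.
  refine ⟨⟨G, hq.functor_ext ?_⟩, hom_ext hG⟩
  rw [← Functor.assoc, hG, F.w, q.w]

/-- The composites `q ≫ F` and `q ≫ G` are replaced by 1-cells only propositionally equal to them.
In the applications they are sides of naturality squares, which commute by a proof and not by
definition. -/
lemma exists_cell {q : X ⟶ Y} (hq : IsFullSurj q.functor) {F G : Y ⟶ Z} {F' G' : X ⟶ Z}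
    (hF : q ≫ F = F') (hG : q ≫ G = G') (θ : F' ⟶ G') :
    ∃ θ' : F ⟶ G, ∀ x, SameArrow (θ'.nat.app (q.functor.obj x)) (θ.nat.app x) := by
  subst hF hG
  obtain ⟨θ', h⟩ := hq.exists_natTrans θ.nat
  exact ⟨⟨θ'⟩, fun x => SameArrow.of_eq (h x)⟩

lemma cell_ext_of_isFullSurj {q : X ⟶ Y} (hq : IsFullSurj q.functor) {F G : Y ⟶ Z} {θ θ' : F ⟶ G}
    (h : ∀ x, SameArrow (θ.nat.app (q.functor.obj x)) (θ'.nat.app (q.functor.obj x))) : θ = θ' :=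
  Cell.ext (hq.natTrans_ext fun x => (h x).eq)

lemma sameArrow_of_isFullSurj {q : X ⟶ Y} (hq : IsFullSurj q.functor) {F G F' G' : Y ⟶ Z}
    {θ : F ⟶ G} {θ' : F' ⟶ G'} (hF : F = F') (hG : G = G')
    (h : ∀ x, SameArrow (θ.nat.app (q.functor.obj x)) (θ'.nat.app (q.functor.obj x))) :
    SameArrow θ θ' := by
  subst hF hG
  exact SameArrow.of_eq (cell_ext_of_isFullSurj hq h)

lemma sameArrow_app {F G F' G' : X ⟶ Y} {θ : F ⟶ G} {θ' : F' ⟶ G'} (h : SameArrow θ θ') (x : X) :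
    SameArrow (θ.nat.app x) (θ'.nat.app x) := by
  obtain ⟨h₁, h₂, rfl⟩ := (Arrow.mk_eq_mk_iff _ _).1 h
  subst h₁ h₂
  simp only [eqToHom_refl, Category.comp_id, Category.id_comp]
  rfl

lemma sameArrow_app_of_eq {F G : X ⟶ Y} (θ : F ⟶ G) {x y : X} (h : x = y) :
    SameArrow (θ.nat.app x) (θ.nat.app y) := by
  subst h
  rfl

lemma obj_eq {F G : X ⟶ Y} (h : F = G) (x : X) : F.functor.obj x = G.functor.obj x := by rw [h]

lemma isIdentity_cell {F G : X ⟶ Y} (θ : F ⟶ G) (h : ∀ x, IsIdentity (θ.nat.app x)) :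
    IsIdentity θ := by
  obtain ⟨e, he⟩ := isIdentity_natTrans θ.nat h
  obtain rfl : F = G := hom_ext e
  exact ⟨rfl, Cell.ext he⟩

lemma isIdentity_app {F G : X ⟶ Y} {θ : F ⟶ G} (h : IsIdentity θ) (x : X) :
    IsIdentity (θ.nat.app x) := by
  obtain ⟨rfl, rfl⟩ := h
  exact isIdentity_id _

end CatOver

/-! ### The 2-functor `T` preserves strict coidentifiers -/

/-- Families of related elements are connected by families of elementary relations. -/
lemma eqvGen_pi {ι : Type*} [Finite ι] {A : ι → Type*} {r : ∀ i, A i → A i → Prop}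
    (hr : ∀ i a, r i a a) {f g : ∀ i, A i} (h : ∀ i, Relation.EqvGen (r i) (f i) (g i)) :
    Relation.EqvGen (fun f g : ∀ i, A i => ∀ i, r i (f i) (g i)) f g := by
  classical
  cases nonempty_fintype ι
  -- Coordinates are moved from `f` to `g` one at a time. Reflexivity of the relations allows all
  -- other coordinates to stay constant during an elementary step, and finiteness of the index set
  -- brings every coordinate to `g`.
  have key : ∀ s : Finset ι, Relation.EqvGen (fun f g : ∀ i, A i => ∀ i, r i (f i) (g i)) f
      (fun i => if i ∈ s then g i else f i) := by
    intro s
    induction s using Finset.induction_on with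
    | empty => simpa using Relation.EqvGen.refl f
    | insert a s ha ih =>
      refine ih.trans _ _ _ ?_
      have step : ∀ x y : A a, Relation.EqvGen (r a) x y →
          Relation.EqvGen (fun f g : ∀ i, A i => ∀ i, r i (f i) (g i))
            (Function.update (fun i => if i ∈ s then g i else f i) a x)
            (Function.update (fun i => if i ∈ s then g i else f i) a y) := by
        intro x y hxy
        induction hxy with
        | rel x y hxy =>
          refine Relation.EqvGen.rel _ _ fun i => ?_
          rcases eq_or_ne i a with rfl | hi
          · simpa using hxy
          · simpa [hi] using hr i _
        | refl => exact Relation.EqvGen.refl _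
        | symm _ _ _ ih => exact ih.symm
        | trans _ _ _ _ _ ih ih' => exact ih.trans _ _ _ ih'
      convert step _ _ (h a) using 1
      · funext i
        rcases eq_or_ne i a with rfl | hi
        · simp [ha]
        · simp [hi]
      · funext i
        rcases eq_or_ne i a with rfl | hi
        · simp
        · simp [hi]
  simpa using key Finset.univ

namespace Operad

variable {I : Type u} {T : Operad I}

variable (T) in
/-- The property of being a permutative arrow of `TX`. -/
def permutative (X : CatOver I) : MorphismProperty (T.Lab X) :=
  fun a _ f => ∀ j : Fin a.arr.n, IsIdentity (Lab.Hom.hom f j)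

lemma actArr_symm {a b : Arr T.Hom} {ρ : Fin a.n ≃ Fin b.n} (h : a = T.actArr b ρ) :
    b = T.actArr a ρ.symm := by
  -- The type of `ρ` involves the arity of `a`, so `h` cannot be substituted directly. The arrow is
  -- generalized together with the permutation, whose values are compared as natural numbers.
  have key : ∀ (a' : Arr T.Hom) (ρ' : Fin b.n ≃ Fin a'.n), a' = a → (∀ j, (ρ' j).val = (ρ.symm j).val)
      → T.actArr a' ρ' = T.actArr a ρ.symm := by
    rintro a' ρ' rfl h
    rw [show ρ' = ρ.symm from Equiv.ext fun j => Fin.ext (h j)]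
  rw [← key (T.actArr b ρ) ρ.symm h.symm fun _ => rfl, actArr_actArr, Equiv.symm_trans_self,
    actArr_refl]

/-- Reversal uses the inverse permutation: the labels of a permutative arrow agree after reindexing,
so identities are again available as its components. -/
instance (X : CatOver I) : IsGroupoidal (T.permutative X) where
  id_mem a _ := isIdentity_id _
  comp_mem p p' h h' j := (h j).comp (h' _)
  symm_mem {a b} p h := by
    have e : ∀ j, b.label j = a.label (p.perm.symm j) := fun j => by
      rw [(h (p.perm.symm j)).src_eq_tgt, Equiv.apply_symm_apply]
    exact ⟨⟨p.perm.symm, fun j => eqToHom (e j), actArr_symm p.arr_eq⟩,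
      fun j => isIdentity_eqToHom (e j)⟩

/-- The arrows of `TX` with components in `P` and with trivial permutation. -/
def levelwise {X : CatOver I} (P : MorphismProperty X) : MorphismProperty (T.Lab X) :=
  fun a _ f => (∀ j : Fin a.arr.n, (Lab.Hom.perm f j).val = j.val) ∧ ∀ j, P (Lab.Hom.hom f j)

/-- By `eqvGen_pi` the chains for the separate labels become one chain of simultaneous replacements.
Each of these is a single replacement in `TX`, since a family of factorizations `u p v` is a
factorization in `TX` whose first two factors are levelwise and whose last factor carries `ρ`. The
hypothesis `hP` makes the elementary relations reflexive. -/
lemma eqvGen_levelwise {X : CatOver I} {P : MorphismProperty X} (hP : ∀ x, P (𝟙 x))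
    {a b : T.Lab X} (ρ : Fin a.arr.n ≃ Fin b.arr.n) (hρ : a.arr = T.actArr b.arr ρ)
    {f g : ∀ j, a.label j ⟶ b.label (ρ j)}
    (h : ∀ j, Relation.EqvGen (HomRel.CompClosure (parallel P) (X := a.label j)
      (Y := b.label (ρ j))) (f j) (g j)) :
    Relation.EqvGen (HomRel.CompClosure (parallel (levelwise P)) (X := a) (Y := b))
      ⟨ρ, f, hρ⟩ ⟨ρ, g, hρ⟩ := by
  have key := eqvGen_pi (r := fun j => HomRel.CompClosure (parallel P) (X := a.label j)
      (Y := b.label (ρ j))) (fun j u => by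
      simpa using HomRel.CompClosure.intro (r := parallel P) _ _ u (𝟙 _) (𝟙 _) (𝟙 _)
        ⟨hP _, hP _⟩) h
  clear h
  induction key with
  | refl => exact Relation.EqvGen.refl _
  | symm _ _ _ ih => exact ih.symm
  | trans _ _ _ _ _ ih ih' => exact ih.trans _ _ _ ih'
  | rel f g h =>
    refine Relation.EqvGen.rel _ _ ?_
    have h' : ∀ j, ∃ (c d : X) (u : a.label j ⟶ c) (p p' : c ⟶ d) (v : d ⟶ b.label (ρ j)),
        P p ∧ P p' ∧ f j = u ≫ p ≫ v ∧ g j = u ≫ p' ≫ v := by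
      intro j
      have h := h j
      generalize f j = fj at h ⊢
      generalize g j = gj at h ⊢
      obtain ⟨c, d, u, p, p', v, h, h'⟩ := h
      exact ⟨c, d, u, p, p', v, h, h', rfl, rfl⟩
    choose c d u p p' v hp hp' hf hg using h'
    -- The intermediate objects are admissible labels for the operation of `a`, because an arrow of
    -- `X` cannot leave its fibre over `I`.
    have hc : ∀ j, X.col (c j) = a.arr.src j := fun j =>
      (Discrete.eq_of_hom (X.proj.map (u j))).symm.trans (a.col_label j)
    have hd : ∀ j, X.col (d j) = a.arr.src j := fun j =>
      (Discrete.eq_of_hom (X.proj.map (p j))).symm.trans (hc j)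
    let c' : T.Lab X := ⟨a.arr, c, hc⟩
    let d' : T.Lab X := ⟨a.arr, d, hd⟩
    let u' : a ⟶ c' := (⟨Equiv.refl _, u, (actArr_refl _).symm⟩ : Lab.Hom a c')
    let q : c' ⟶ d' := (⟨Equiv.refl _, p, (actArr_refl _).symm⟩ : Lab.Hom c' d')
    let q' : c' ⟶ d' := (⟨Equiv.refl _, p', (actArr_refl _).symm⟩ : Lab.Hom c' d')
    let v' : d' ⟶ b := (⟨ρ, v, hρ⟩ : Lab.Hom d' b)
    have e : (⟨ρ, f, hρ⟩ : Lab.Hom a b) = u' ≫ q ≫ v' :=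
      Lab.Hom.ext' (fun _ => rfl) fun j => SameArrow.of_eq (hf j)
    have e' : (⟨ρ, g, hρ⟩ : Lab.Hom a b) = u' ≫ q' ≫ v' :=
      Lab.Hom.ext' (fun _ => rfl) fun j => SameArrow.of_eq (hg j)
    rw [e, e']
    exact HomRel.CompClosure.intro _ _ u' q q' v' ⟨⟨fun _ => rfl, hp⟩, ⟨fun _ => rfl, hp'⟩⟩

/-- The 2-functor `T` preserves full functors surjective on objects. -/
lemma isFullSurj_labMap {X Y : CatOver I} {q : X ⟶ Y} (hq : IsFullSurj q.functor) :
    IsFullSurj (T.labMap q).functor where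
  obj_surj b := by
    obtain ⟨arr, l, hl⟩ := b
    choose s hs using fun j => hq.obj_surj (l j)
    have hcol : ∀ x : X, Y.col (q.functor.obj x) = X.col x := fun x =>
      congrArg Discrete.as (Functor.congr_obj q.w x)
    obtain rfl : (fun j => q.functor.obj (s j)) = l := funext hs
    exact ⟨⟨arr, s, fun j => (hcol _).symm.trans (hl j)⟩, rfl⟩
  exists_map {a b} g := by
    choose f hf using fun j => hq.exists_map (g.hom j)
    exact ⟨⟨g.perm, f, g.arr_eq⟩, Lab.hom_ext (fun _ => rfl) fun j => SameArrow.of_eq (hf j)⟩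

/-- The 2-functor `T` preserves strict coidentifiers. -/
lemma isCoid_labMap {X Y : CatOver I} {P : MorphismProperty X} (hP : ∀ x, P (𝟙 x)) {q : X ⟶ Y}
    (hq : IsCoid P q.functor) : IsCoid (levelwise P) (T.labMap q).functor where
  toIsFullSurj := isFullSurj_labMap hq.toIsFullSurj
  isIdentity {a b} p hp := by
    obtain ⟨arr, l, hl⟩ := a
    obtain ⟨ρ, h, e⟩ := p
    obtain ⟨hρ, hp⟩ := hp
    -- Source and target have a priori different arities, so triviality of the permutation is stated
    -- through values of indices. Once the operations are known to coincide (`key₂`), the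
    -- permutation is the identity and the components are compared label by label.
    have key : ∀ (arr' : Arr T.Hom) (e' : arr = arr') (l' hl') (ρ : Fin arr.n ≃ Fin arr'.n) (h e),
        (∀ j, (ρ j).val = j.val) → (∀ j, P (h j)) → IsIdentity ((T.labMap q).functor.map
        (⟨ρ, h, e⟩ : Lab.Hom (⟨arr, l, hl⟩ : T.Lab X) ⟨arr', l', hl'⟩)) := by
      rintro _ rfl l' hl' ρ h e hρ hh
      obtain rfl : ρ = Equiv.refl _ := Equiv.ext fun j => Fin.ext (hρ j)
      have h₁ : ∀ j, IsIdentity (q.functor.map (h j)) := fun j => hq.isIdentity _ (hh j)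
      have e₁ : (T.labMap q).functor.obj ⟨arr, l, hl⟩ = (T.labMap q).functor.obj ⟨arr, l', hl'⟩ :=
        Lab.ext' rfl fun j k hjk => by
          obtain rfl := Fin.ext hjk
          exact (h₁ j).src_eq_tgt
      refine ⟨e₁, SameArrow.eq (Lab.sameArrow rfl rfl (fun j k hjk => ?_) fun j k hjk => ?_)⟩
      · rw [Lab.eqToHom_perm]
        exact hjk
      · obtain rfl := Fin.ext hjk
        exact (h₁ j).sameArrow.trans (Lab.eqToHom_hom e₁ j).sameArrow.symm
    refine key b.arr ?_ b.label b.col_label ρ h e hρ hp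
    have key₂ : ∀ (n : ℕ) (hn : n = b.arr.n) (ρ : Fin n ≃ Fin b.arr.n) (hρ : ∀ j, (ρ j).val = j.val),
        T.actArr b.arr ρ = b.arr := by
      rintro n rfl ρ hρ
      obtain rfl : ρ = Equiv.refl _ := Equiv.ext fun j => Fin.ext (hρ j)
      exact actArr_refl _
    exact e.trans (key₂ _ (Fin.equiv_iff_eq.1 ⟨ρ⟩) ρ hρ)
  exists_prop {a b} h := by
    obtain ⟨arr, l, hl⟩ := a
    obtain ⟨arr', l', hl'⟩ := b
    have h₁ : arr = arr' := congrArg Lab.arr h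
    subst h₁
    have h₂ : ∀ j, q.functor.obj (l j) = q.functor.obj (l' j) := fun j =>
      congrFun (eq_of_heq (Lab.mk.inj h).2) j
    choose p hp using fun j => hq.exists_prop (h₂ j)
    exact ⟨⟨Equiv.refl _, p, (actArr_refl _).symm⟩, fun _ => rfl, hp⟩
  eqvGen {a b f g} h := by
    obtain ⟨ρ, f, hf⟩ := f
    obtain ⟨ρ', g, hg⟩ := g
    -- The functor `T q` leaves permutations unchanged. Arrows with equal images thus have the same
    -- permutation, and only their label components remain to be connected.
    obtain ⟨h₁, h₂⟩ := Lab.Hom.mk.inj h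
    subst h₁
    exact eqvGen_levelwise hP ρ hf fun j => hq.eqvGen (congrFun (eq_of_heq h₂) j)

/-- The multiplication of `T` sends levelwise permutative arrows to permutative arrows. -/
lemma permutative_labMult {X : CatOver I} {z z' : T.labOver (T.labOver X)} {f : z ⟶ z'}
    (hf : ∀ j, T.permutative X (f.hom j)) : T.permutative X ((T.labMult X).functor.map f) :=
  fun l => Lab.isIdentity_mult hf l

lemma permutative_labMap {X Y : CatOver I} (F : X ⟶ Y) {a b : T.labOver X} {f : a ⟶ b}
    (hf : T.permutative X f) : T.permutative Y ((T.labMap F).functor.map f) :=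
  fun j => (hf j).map F.functor

/-- Permutative arrows lift along `T q` if `q` is surjective on objects. -/
lemma exists_permutative_lift {X Y : CatOver I} {q : X ⟶ Y} (hq : IsFullSurj q.functor)
    {a b : T.labOver Y} {f : a ⟶ b} (hf : T.permutative Y f) :
    ∃ (a' b' : T.labOver X) (f' : a' ⟶ b'), T.permutative X f' ∧
      SameArrow ((T.labMap q).functor.map f') f := by
  obtain ⟨brr, l, hl⟩ := b
  obtain ⟨arr, m, hm⟩ := a
  obtain ⟨ρ, h, e⟩ := f
  -- Only the labels of the target are lifted freely. The labels of the source are forced to be the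
  -- permuted lifts, so that the components of the lifted arrow are genuine identities.
  choose s hs using fun j => hq.obj_surj (l j)
  have hcol : ∀ x : X, Y.col (q.functor.obj x) = X.col x := fun x =>
    congrArg Discrete.as (Functor.congr_obj q.w x)
  obtain rfl : (fun j => q.functor.obj (s j)) = l := funext hs
  have hm' : ∀ j, m j = q.functor.obj (s (ρ j)) := fun j => (hf j).src_eq_tgt
  refine ⟨⟨arr, fun j => s (ρ j), fun j => (hcol _).symm.trans
      ((congrArg Y.col (hm' j)).symm.trans (hm j))⟩,
    ⟨brr, s, fun j => (hcol _).symm.trans (hl j)⟩, ⟨ρ, fun j => 𝟙 _, e⟩,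
    fun j => isIdentity_id _, Lab.sameArrow rfl rfl (fun j k hjk => ?_) fun j k hjk => ?_⟩
  · obtain rfl := Fin.ext hjk
    rfl
  · obtain rfl := Fin.ext hjk
    exact ((isIdentity_id _).map q.functor).sameArrow_tgt.trans (hf j).sameArrow_tgt.symm

end Operad

/-! ## The 2-monad `T/Σ` -/

namespace Operad

variable {I : Type u} (T : Operad I)

lemma exists_quotProj (X : CatOver I) : ∃ G : CoidCat (T.permutative X) ⥤ Discrete I,
    CoidCat.proj (T.permutative X) ⋙ G = (T.labOver X).proj :=
  CoidCat.isCoid_proj.exists_desc _ fun p _ =>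
    ⟨Discrete.ext (Lab.Hom.tgt_eq p), Subsingleton.elim _ _⟩

/-- The object `(T/Σ)X` of `Cat/I`. -/
noncomputable abbrev quotOver (X : CatOver I) : CatOver I where
  carrier := CoidCat (T.permutative X)
  proj := (T.exists_quotProj X).choose

/-- The component of the coidentifier at `X`. -/
noncomputable def quot (X : CatOver I) : T.labOver X ⟶ T.quotOver X where
  functor := CoidCat.proj (T.permutative X)
  w := (T.exists_quotProj X).choose_spec

variable {T}

lemma isCoid_quot (X : CatOver I) : IsCoid (T.permutative X) (T.quot X).functor :=
  CoidCat.isCoid_proj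

lemma isFullSurj_quot (X : CatOver I) : IsFullSurj (T.quot X).functor :=
  (isCoid_quot X).toIsFullSurj

lemma exists_quotMap {X Y : CatOver I} (F : X ⟶ Y) :
    ∃ G : T.quotOver X ⟶ T.quotOver Y, T.quot X ≫ G = T.labMap F ≫ T.quot Y :=
  CatOver.exists_desc (isCoid_quot X) _ fun _ hp =>
    (isCoid_quot Y).isIdentity _ (permutative_labMap F hp)

variable (T) in
/-- The action of `T/Σ` on functors. -/
noncomputable def quotMap {X Y : CatOver I} (F : X ⟶ Y) : T.quotOver X ⟶ T.quotOver Y :=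
  (exists_quotMap F).choose

lemma quot_quotMap {X Y : CatOver I} (F : X ⟶ Y) :
    T.quot X ≫ T.quotMap F = T.labMap F ≫ T.quot Y := (exists_quotMap F).choose_spec

variable (T) in
/-- The action of `T/Σ` on natural transformations. -/
noncomputable def quotMap₂ {X Y : CatOver I} {F G : X ⟶ Y} (θ : F ⟶ G) :
    T.quotMap F ⟶ T.quotMap G :=
  (CatOver.exists_cell (isFullSurj_quot X) (quot_quotMap F) (quot_quotMap G)
    (T.labMap₂ θ ▷ T.quot Y)).choose

lemma quotMap₂_app {X Y : CatOver I} {F G : X ⟶ Y} (θ : F ⟶ G) (x : T.labOver X) :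
    SameArrow ((T.quotMap₂ θ).nat.app ((T.quot X).functor.obj x))
      ((T.quot Y).functor.map ((T.labMap₂ θ).nat.app x)) :=
  (CatOver.exists_cell (isFullSurj_quot X) (quot_quotMap F) (quot_quotMap G)
    (T.labMap₂ θ ▷ T.quot Y)).choose_spec x

lemma quotMap_id (X : CatOver I) : T.quotMap (𝟙 X) = 𝟙 _ :=
  CatOver.epi_of_isFullSurj (isFullSurj_quot X) (quot_quotMap _)

lemma quotMap_comp {X Y Z : CatOver I} (F : X ⟶ Y) (G : Y ⟶ Z) :
    T.quotMap (F ≫ G) = T.quotMap F ≫ T.quotMap G := by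
  refine CatOver.epi_of_isFullSurj (isFullSurj_quot X) ((quot_quotMap _).trans ?_)
  exact (congrArg (fun H => T.labMap F ≫ H) (quot_quotMap G)).symm.trans
    (congrArg (fun H => H ≫ T.quotMap G) (quot_quotMap F)).symm

/-- The whiskering axioms of a strict 2-functor involve equality 2-cells for its preservation of
composites; their components are invisible to `SameArrow`. -/
lemma sameArrow_eqToHom_comp_comp_eqToHom_app {X Y : CatOver I} {F G F' G' : X ⟶ Y} (h : F = F')
    (θ : F' ⟶ G') (h' : G' = G) (x : X) :
    SameArrow (CatOver.Cell.nat (eqToHom h ≫ θ ≫ eqToHom h') |>.app x) (θ.nat.app x) := by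
  subst h h'
  simp only [eqToHom_refl, Category.comp_id, Category.id_comp]
  rfl

variable (T) in
/-- The 2-functor underlying `T/Σ`. -/
noncomputable def quotFunctor : StrictPseudofunctor (CatOver I) (CatOver I) :=
  StrictPseudofunctor.mk''
    { obj := T.quotOver
      map := T.quotMap
      map₂ := T.quotMap₂
      map₂_id := fun {X Y} F => CatOver.cell_ext_of_isFullSurj (isFullSurj_quot X) fun x =>
        (quotMap₂_app _ x).trans (IsIdentity.sameArrow_of_src_eq
          ((isIdentity_id _).map (T.quot Y).functor) (isIdentity_id _)
          (CatOver.obj_eq (quot_quotMap F) x).symm)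
      map₂_comp := fun {X Y} F G H θ θ' =>
        CatOver.cell_ext_of_isFullSurj (isFullSurj_quot X) fun x => by
        refine (quotMap₂_app _ x).trans
          (SameArrow.trans ?_ (SameArrow.comp (quotMap₂_app θ x) (quotMap₂_app θ' x)).symm)
        exact SameArrow.of_eq ((T.quot Y).functor.map_comp ((T.labMap₂ θ).nat.app x)
          ((T.labMap₂ θ').nat.app x))
      map_id := quotMap_id
      map_comp := quotMap_comp
      map₂_whisker_left := fun {X Y Z} F _ _ θ =>
        CatOver.cell_ext_of_isFullSurj (isFullSurj_quot X) fun x => by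
        refine (quotMap₂_app _ x).trans
          (SameArrow.trans ?_ (sameArrow_eqToHom_comp_comp_eqToHom_app _ _ _ _).symm)
        exact (quotMap₂_app θ ((T.labMap F).functor.obj x)).symm.trans
          (CatOver.sameArrow_app_of_eq (T.quotMap₂ θ) (CatOver.obj_eq (quot_quotMap F) x)).symm
      map₂_whisker_right := fun {X Y Z} {F G} θ H =>
        CatOver.cell_ext_of_isFullSurj (isFullSurj_quot X) fun x => by
        refine (quotMap₂_app _ x).trans
          (SameArrow.trans ?_ (sameArrow_eqToHom_comp_comp_eqToHom_app _ _ _ _).symm)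
        exact SameArrow.trans (SameArrow.functor_map
          (congrArg CatOver.Hom.functor (quot_quotMap H)).symm ((T.labMap₂ θ).nat.app x))
          ((quotMap₂_app θ x).symm.map (T.quotMap H).functor) }

variable (T) in
/-- The map from `TTX` to `(T/Σ)(T/Σ)X`. -/
noncomputable def quot₂ (X : CatOver I) :
    T.labOver (T.labOver X) ⟶ T.quotOver (T.quotOver X) :=
  T.labMap (T.quot X) ≫ T.quot (T.quotOver X)

/-- Equations between 1-cells or 2-cells out of `(T/Σ)(T/Σ)X` can consequently be checked on `TTX`.
-/
lemma isFullSurj_quot₂ (X : CatOver I) : IsFullSurj (T.quot₂ X).functor :=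
  (isFullSurj_labMap (isFullSurj_quot X)).comp (isFullSurj_quot _)

lemma quot₂_naturality {X Y : CatOver I} (F : X ⟶ Y) :
    T.quot₂ X ≫ T.quotMap (T.quotMap F) = T.labMap (T.labMap F) ≫ T.quot₂ Y :=
  (congrArg (fun H => T.labMap (T.quot X) ≫ H) (quot_quotMap (T.quotMap F))).trans
    (congrArg (fun H => T.labMap H ≫ T.quot (T.quotOver Y)) (quot_quotMap F))

/-- Descent happens in two stages. Along `TTX ⟶ T(T/Σ)X` one has to treat levelwise arrows whose
components are permutative, because `T` preserves the coidentifier of `X`; then come the permutative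
arrows of `T(T/Σ)X`. The multiplication of `T` turns both kinds into permutative arrows of `TX`,
which `T.quot X` sends to identities. -/
lemma exists_quotMult (X : CatOver I) :
    ∃ G : T.quotOver (T.quotOver X) ⟶ T.quotOver X, T.quot₂ X ≫ G = T.labMult X ≫ T.quot X := by
  obtain ⟨G, hG⟩ := CatOver.exists_desc (isCoid_labMap (T := T) (q := T.quot X)
    (IsGroupoidal.id_mem (P := T.permutative X)) (isCoid_quot X)) (T.labMult X ≫ T.quot X)
    fun p hp => (isCoid_quot X).isIdentity _ (permutative_labMult hp.2)
  obtain ⟨K, hK⟩ := CatOver.exists_desc (isCoid_quot (T.quotOver X)) G fun p hp => by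
    -- The functor `G` is known only through its restriction to `TTX`, so the permutative arrow is
    -- first lifted there.
    obtain ⟨a, b, f, hf, hfp⟩ := exists_permutative_lift (isFullSurj_quot X) hp
    refine (hfp.map G.functor).isIdentity_iff.1 ?_
    refine (SameArrow.functor_map (congrArg CatOver.Hom.functor hG) f).isIdentity_iff.2 ?_
    exact (isCoid_quot X).isIdentity _
      (permutative_labMult fun j => Lab.isIdentity_hom (hf j))
  exact ⟨K, (congrArg (fun H => T.labMap (T.quot X) ≫ H) hK).trans hG⟩

variable (T) in
/-- The multiplication of `T/Σ`. -/
noncomputable def quotMult (X : CatOver I) : T.quotOver (T.quotOver X) ⟶ T.quotOver X :=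
  (exists_quotMult X).choose

lemma quot₂_quotMult (X : CatOver I) : T.quot₂ X ≫ T.quotMult X = T.labMult X ≫ T.quot X :=
  (exists_quotMult X).choose_spec

variable (T) in
/-- The unit of `T/Σ`. -/
noncomputable def quotUnit (X : CatOver I) : X ⟶ T.quotOver X := T.labUnit X ≫ T.quot X

lemma quotUnit_naturality {X Y : CatOver I} (F : X ⟶ Y) :
    F ≫ T.quotUnit Y = T.quotUnit X ≫ T.quotMap F :=
  (congrArg (fun H => H ≫ T.quot Y) (T.labUnit_naturality F)).trans
    (congrArg (fun H => T.labUnit X ≫ H) (quot_quotMap F)).symm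

lemma quotMult_naturality {X Y : CatOver I} (F : X ⟶ Y) :
    T.quotMap (T.quotMap F) ≫ T.quotMult Y = T.quotMult X ≫ T.quotMap F := by
  refine CatOver.epi_of_isFullSurj (isFullSurj_quot₂ X) ?_
  calc T.quot₂ X ≫ T.quotMap (T.quotMap F) ≫ T.quotMult Y
      = T.labMap (T.labMap F) ≫ T.quot₂ Y ≫ T.quotMult Y :=
        congrArg (fun H => H ≫ T.quotMult Y) (quot₂_naturality F)
    _ = (T.labMap (T.labMap F) ≫ T.labMult Y) ≫ T.quot Y :=
        congrArg (fun H => T.labMap (T.labMap F) ≫ H) (quot₂_quotMult Y)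
    _ = (T.labMult X ≫ T.labMap F) ≫ T.quot Y :=
        congrArg (fun H => H ≫ T.quot Y) (T.labMult_naturality F)
    _ = (T.labMult X ≫ T.quot X) ≫ T.quotMap F :=
        (congrArg (fun H => T.labMult X ≫ H) (quot_quotMap F)).symm
    _ = _ := (congrArg (fun H => H ≫ T.quotMap F) (quot₂_quotMult X)).symm

lemma quotUnit_quotMult (X : CatOver I) :
    T.quotUnit (T.quotOver X) ≫ T.quotMult X = 𝟙 _ := by
  refine CatOver.epi_of_isFullSurj (isFullSurj_quot X) ?_
  calc T.quot X ≫ T.quotUnit (T.quotOver X) ≫ T.quotMult X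
      = (T.quot X ≫ T.labUnit _) ≫ T.quot (T.quotOver X) ≫ T.quotMult X := rfl
    _ = (T.labUnit _ ≫ T.labMap (T.quot X)) ≫ T.quot (T.quotOver X) ≫ T.quotMult X :=
        congrArg (fun H => H ≫ T.quot (T.quotOver X) ≫ T.quotMult X)
          (T.labUnit_naturality (T.quot X))
    _ = T.labUnit _ ≫ T.labMult X ≫ T.quot X :=
        congrArg (fun H => T.labUnit _ ≫ H) (quot₂_quotMult X)
    _ = T.quot X := congrArg (fun H => H ≫ T.quot X) (T.labUnit_labMult X)

lemma quotMap_quotUnit_quotMult (X : CatOver I) :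
    T.quotMap (T.quotUnit X) ≫ T.quotMult X = 𝟙 _ := by
  refine CatOver.epi_of_isFullSurj (isFullSurj_quot X) ?_
  calc T.quot X ≫ T.quotMap (T.quotUnit X) ≫ T.quotMult X
      = (T.labMap (T.quotUnit X) ≫ T.quot _) ≫ T.quotMult X :=
        congrArg (fun H => H ≫ T.quotMult X) (quot_quotMap (T.quotUnit X))
    _ = T.labMap (T.labUnit X) ≫ T.labMult X ≫ T.quot X :=
        congrArg (fun H => T.labMap (T.labUnit X) ≫ H) (quot₂_quotMult X)
    _ = T.quot X := congrArg (fun H => H ≫ T.quot X) (T.labMap_labUnit_labMult X)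

/-- Restricted along the full and surjective map `TTTX ⟶ (T/Σ)(T/Σ)(T/Σ)X`, the two sides become the
two sides of associativity for `T`, followed by `T.quot X`. The projection to the threefold quotient
is grouped so that both innermost quotients are formed under `T`; for the second side it is
regrouped by naturality of the multiplication of `T`. -/
lemma quotMult_assoc (X : CatOver I) :
    T.quotMap (T.quotMult X) ≫ T.quotMult X = T.quotMult (T.quotOver X) ≫ T.quotMult X := by
  have h : IsFullSurj (T.labMap (T.quot₂ X) ≫ T.quot (T.quotOver (T.quotOver X))).functor :=
    (isFullSurj_labMap (isFullSurj_quot₂ X)).comp (isFullSurj_quot _)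
  refine CatOver.epi_of_isFullSurj h ?_
  have e₁ : (T.labMap (T.quot₂ X) ≫ T.quot (T.quotOver (T.quotOver X))) ≫
      T.quotMap (T.quotMult X) ≫ T.quotMult X = T.labMap (T.labMult X) ≫ T.labMult X ≫ T.quot X :=
    calc _ = T.labMap (T.quot₂ X) ≫ (T.labMap (T.quotMult X) ≫ T.quot _) ≫ T.quotMult X :=
          congrArg (fun H => T.labMap (T.quot₂ X) ≫ H ≫ T.quotMult X) (quot_quotMap (T.quotMult X))
      _ = T.labMap (T.labMult X ≫ T.quot X) ≫ T.quot _ ≫ T.quotMult X :=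
          congrArg (fun H => T.labMap H ≫ T.quot _ ≫ T.quotMult X) (quot₂_quotMult X)
      _ = _ := congrArg (fun H => T.labMap (T.labMult X) ≫ H) (quot₂_quotMult X)
  have e₂ : (T.labMap (T.quot₂ X) ≫ T.quot (T.quotOver (T.quotOver X))) ≫
      T.quotMult (T.quotOver X) ≫ T.quotMult X = T.labMult _ ≫ T.labMult X ≫ T.quot X :=
    calc _ = T.labMap (T.labMap (T.quot X)) ≫ (T.quot₂ (T.quotOver X) ≫ T.quotMult _) ≫
            T.quotMult X := rfl
      _ = (T.labMap (T.labMap (T.quot X)) ≫ T.labMult _) ≫ T.quot _ ≫ T.quotMult X :=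
          congrArg (fun H => T.labMap (T.labMap (T.quot X)) ≫ H ≫ T.quotMult X) (quot₂_quotMult _)
      _ = T.labMult _ ≫ T.quot₂ X ≫ T.quotMult X :=
          congrArg (fun H => H ≫ T.quot _ ≫ T.quotMult X) (T.labMult_naturality (T.quot X))
      _ = _ := congrArg (fun H => T.labMult _ ≫ H) (quot₂_quotMult X)
  exact (e₁.trans (congrArg (fun H => H ≫ T.quot X) (T.labMult_assoc X))).trans e₂.symm

variable (T) in
/-- The 2-monad `T/Σ`. -/
noncomputable def quotMonad : TwoMonad (CatOver I) where
  T := T.quotFunctor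
  unit := T.quotUnit
  unit_naturality := quotUnit_naturality
  unit_naturality₂ {X Y F G} θ :=
    CatOver.sameArrow_cell (congrArg CatOver.Hom.functor (quotUnit_naturality F))
      (congrArg CatOver.Hom.functor (quotUnit_naturality G)) fun x =>
        (SameArrow.map (T.quot Y).functor (T.labUnit_naturality₂ θ x)).trans
          (quotMap₂_app θ ((T.labUnit X).functor.obj x)).symm
  mult := T.quotMult
  mult_naturality := quotMult_naturality
  mult_naturality₂ {X Y F G} θ := by
    refine CatOver.sameArrow_of_isFullSurj (isFullSurj_quot₂ X) (quotMult_naturality F)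
      (quotMult_naturality G) fun x => ?_
    -- The 2-cell `(T/Σ)(T/Σ)θ` at the image of `x` is the image of the component of `TTθ` at `x`;
    -- this reduces the claim to 2-naturality of the multiplication of `T`.
    have h₁ : SameArrow ((T.quotMap₂ (T.quotMap₂ θ)).nat.app ((T.quot₂ X).functor.obj x))
        ((T.quot₂ Y).functor.map ((T.labMap₂ (T.labMap₂ θ)).nat.app x)) := by
      refine (quotMap₂_app _ _).trans (SameArrow.map (T.quot (T.quotOver Y)).functor ?_)
      exact Lab.sameArrow rfl rfl (fun j k h => h) fun j k h => by
        obtain rfl := Fin.ext h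
        exact quotMap₂_app θ _
    have h₂ : SameArrow ((T.quotMap₂ θ).nat.app ((T.quot₂ X ≫ T.quotMult X).functor.obj x))
        ((T.quot Y).functor.map ((T.labMap₂ θ).nat.app ((T.labMult X).functor.obj x))) :=
      (CatOver.sameArrow_app_of_eq _ (CatOver.obj_eq (quot₂_quotMult X) x)).trans
        (quotMap₂_app θ _)
    refine SameArrow.trans ?_ h₂.symm
    refine (h₁.map (T.quotMult Y).functor).trans ?_
    refine (SameArrow.functor_map (congrArg CatOver.Hom.functor (quot₂_quotMult Y)) _).trans ?_
    exact SameArrow.map (T.quot Y).functor (T.labMult_naturality₂ θ x)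
  unit_mult := quotUnit_quotMult
  map_unit_mult := quotMap_quotUnit_quotMult
  assoc := quotMult_assoc

variable (T) in
/-- The morphism of 2-monads from `T` to `T/Σ`. -/
noncomputable def quotHom : TwoMonad.Hom T.twoMonad T.quotMonad where
  app := T.quot
  naturality F := (quot_quotMap F).symm
  naturality₂ {X Y F G} θ := CatOver.sameArrow_cell
    (congrArg CatOver.Hom.functor (quot_quotMap F)).symm
    (congrArg CatOver.Hom.functor (quot_quotMap G)).symm fun x => (quotMap₂_app θ x).symm
  unit_app _ := rfl
  mult_app X := (quot₂_quotMult X).symm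

/-- A permutative arrow is an object of `T^{[1]}_Σ X`, and the component of `α_T` at this object is
the arrow itself. -/
lemma isIdentity_map_of_permCell {R : TwoMonad (CatOver I)} {h : TwoMonad.Hom T.twoMonad R}
    (hα : ∀ X, IsIdentity (T.permCell.app X ▷ h.app X)) {X : CatOver I} {a b : T.labOver X}
    (f : a ⟶ b) (hf : T.permutative X f) : IsIdentity ((h.app X).functor.map f) :=
  CatOver.isIdentity_app (hα X) (⟨a, b, f, hf⟩ : T.Perm X)

/-- The components of `k` come from descent at each object. Every axiom for `k` becomes the axiom
for `h` after precomposition with a projection that is full and surjective on objects. -/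
lemma exists_quotMonad_hom {R : TwoMonad (CatOver I)} (h : TwoMonad.Hom T.twoMonad R)
    (hα : ∀ X, IsIdentity (T.permCell.app X ▷ h.app X)) :
    ∃ k : TwoMonad.Hom T.quotMonad R, T.quotHom.comp k = h := by
  let η (X : CatOver I) : T.labOver X ⟶ R.T.obj X := h.app X
  choose k hk using fun X => CatOver.exists_desc (isCoid_quot X) (η X) fun f hf =>
    isIdentity_map_of_permCell hα f hf
  have nat {X Y : CatOver I} (F : X ⟶ Y) : T.quotMap F ≫ k Y = k X ≫ R.T.map F := by
    refine CatOver.epi_of_isFullSurj (isFullSurj_quot X) ?_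
    calc T.quot X ≫ T.quotMap F ≫ k Y = T.labMap F ≫ T.quot Y ≫ k Y :=
          congrArg (fun H => H ≫ k Y) (quot_quotMap F)
      _ = T.labMap F ≫ η Y := congrArg (fun H => T.labMap F ≫ H) (hk Y)
      _ = η X ≫ R.T.map F := h.naturality F
      _ = _ := (congrArg (fun H => H ≫ R.T.map F) (hk X)).symm
  refine ⟨{ app := k, naturality := nat, naturality₂ := ?_, unit_app := ?_, mult_app := ?_ },
    TwoMonad.Hom.ext (funext hk)⟩
  · intro X Y F G θ
    refine CatOver.sameArrow_of_isFullSurj (isFullSurj_quot X) (nat F) (nat G) fun x => ?_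
    refine ((quotMap₂_app θ x).map (k Y).functor).trans ?_
    refine (SameArrow.functor_map (congrArg CatOver.Hom.functor (hk Y)) _).trans ?_
    refine (CatOver.sameArrow_app (h.naturality₂ θ) x).trans ?_
    exact (CatOver.sameArrow_app_of_eq (R.T.map₂ θ) (CatOver.obj_eq (hk X) x)).symm
  · intro X
    exact (congrArg (fun H => T.labUnit X ≫ H) (hk X)).trans (h.unit_app X)
  · intro X
    refine CatOver.epi_of_isFullSurj (isFullSurj_quot₂ X) ?_
    calc T.quot₂ X ≫ T.quotMult X ≫ k X = T.labMult X ≫ T.quot X ≫ k X :=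
          congrArg (fun H => H ≫ k X) (quot₂_quotMult X)
      _ = T.labMult X ≫ η X := congrArg (fun H => T.labMult X ≫ H) (hk X)
      _ = T.labMap (η X) ≫ η _ ≫ R.mult X := h.mult_app X
      -- Both copies of `η` are factored again, so that naturality of the projection at `k X` can
      -- assemble `T.quot₂ X` in front.
      _ = T.labMap (T.quot X ≫ k X) ≫ (T.quot _ ≫ k _) ≫ R.mult X := by rw [hk, hk]
      _ = T.labMap (T.quot X) ≫ (T.labMap (k X) ≫ T.quot _) ≫ k _ ≫ R.mult X := rfl
      _ = T.labMap (T.quot X) ≫ (T.quot _ ≫ T.quotMap (k X)) ≫ k _ ≫ R.mult X :=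
          congrArg (fun H => T.labMap (T.quot X) ≫ H ≫ k _ ≫ R.mult X) (quot_quotMap (k X)).symm
      _ = _ := rfl

/-- This is the two-dimensional part of the universal property. The components of `θ` descend
because the projections are full, and the axioms hold because they hold at the images of labelled
operations. -/
lemma exists_quotMonad_cell {R : TwoMonad (CatOver I)} {k k' : TwoMonad.Hom T.quotMonad R}
    (θ : TwoMonad.Cell (T.quotHom.comp k) (T.quotHom.comp k')) :
    ∃ θ' : TwoMonad.Cell k k', ∀ X, T.quot X ◁ θ'.app X = θ.app X := by
  choose σ hσ using fun X => CatOver.exists_cell (isFullSurj_quot X)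
    (F := k.app X) (G := k'.app X) rfl rfl (θ.app X)
  refine ⟨{ app := σ, naturality := ?_, unit_app := ?_, mult_app := ?_ }, fun X =>
    CatOver.cell_ext fun x => (hσ X x).eq⟩
  · intro X Y F
    refine CatOver.sameArrow_of_isFullSurj (isFullSurj_quot X) (k.naturality F)
      (k'.naturality F) fun x => ?_
    refine (CatOver.sameArrow_app_of_eq (σ Y) (CatOver.obj_eq (quot_quotMap F) x)).trans ?_
    refine (hσ Y _).trans ((CatOver.sameArrow_app (θ.naturality F) x).trans ?_)
    exact (hσ X x).symm.map (R.T.map F).functor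
  · intro X
    refine CatOver.isIdentity_cell _ fun x => ?_
    exact (hσ X _).isIdentity_iff.2 (CatOver.isIdentity_app (θ.unit_app X) x)
  · intro X
    have hd : T.quotMonad.T.map (k'.app X) ≫ k'.app _ ≫ R.mult X = T.quotMonad.mult X ≫ k'.app X :=
      (k'.mult_app X).symm
    refine CatOver.sameArrow_of_isFullSurj (isFullSurj_quot₂ X) (k.mult_app X)
      (k'.mult_app X) fun x => ?_
    have h₁ : SameArrow ((σ X).nat.app ((T.quot₂ X ≫ T.quotMult X).functor.obj x))
        ((θ.app X).nat.app ((T.labMult X).functor.obj x)) :=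
      (CatOver.sameArrow_app_of_eq (σ X) (CatOver.obj_eq (quot₂_quotMult X) x)).trans (hσ X _)
    refine h₁.trans ((CatOver.sameArrow_app (θ.mult_app X) x).trans ?_)
    refine SameArrow.comp ?_ ?_
    · refine SameArrow.map (k.app (R.T.obj X) ≫ R.mult X).functor ?_
      refine SameArrow.trans ?_ (quotMap₂_app (σ X) _).symm
      refine SameArrow.map (T.quot _).functor (Lab.sameArrow rfl rfl (fun j k h => h)
        fun j k h => ?_)
      obtain rfl := Fin.ext h
      exact (hσ X _).symm
    · refine SameArrow.map (R.mult X).functor ?_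
      refine (hσ (R.T.obj X) _).symm.trans ?_
      exact CatOver.sameArrow_app_of_eq (σ (R.T.obj X))
        (CatOver.obj_eq (quot_quotMap (k'.app X)) ((T.labMap (T.quot X)).functor.obj x)).symm

variable (T) in
/-- The morphism from `T` to `T/Σ` is a coidentifier of `α_T`. -/
lemma isCoidentifier_quotHom : TwoMonad.IsCoidentifier T.permCell T.quotHom where
  isIdentity X := CatOver.isIdentity_cell _ fun f => (isCoid_quot X).isIdentity f.arr f.permutative
  existsUnique_hom R h hα := by
    obtain ⟨k, hk⟩ := exists_quotMonad_hom h hα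
    refine ⟨k, hk, fun k' hk' => TwoMonad.Hom.ext (funext fun X => ?_)⟩
    exact CatOver.epi_of_isFullSurj (isFullSurj_quot X)
      (congrArg (fun φ => TwoMonad.Hom.app φ X) (hk'.trans hk.symm))
  existsUnique_cell R k k' θ := by
    obtain ⟨θ', h⟩ := exists_quotMonad_cell θ
    refine ⟨θ', h, fun θ'' h' => TwoMonad.Cell.ext (funext fun X => ?_)⟩
    refine CatOver.cell_ext_of_isFullSurj (isFullSurj_quot X) fun x => ?_
    exact CatOver.sameArrow_app (SameArrow.of_eq ((h' X).trans (h X).symm)) x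

variable (T) in
/-- The 2-cell `α_T` is reflexive. -/
lemma isReflexive_permCell : TwoMonad.IsReflexive T.permCell := by
  -- The section is `permLift` of an identity 2-cell: it sends a labelled operation to its identity
  -- arrow, which is permutative.
  have nat {X Y : CatOver I} (F : X ⟶ Y) :
      T.labMap F ≫ permLift (𝟙 (𝟙 (T.labOver Y))) (fun z _ => isIdentity_id _) =
        permLift (𝟙 (𝟙 (T.labOver X))) (fun z _ => isIdentity_id _) ≫ T.permMap F :=
    perm_hom_ext rfl rfl fun z => SameArrow.of_eq ((T.labMap F).functor.map_id z).symm
  refine ⟨{ app := fun X => permLift (𝟙 (𝟙 (T.labOver X))) fun z _ => isIdentity_id _,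
            naturality := nat, naturality₂ := fun {X Y F G} θ => ?_, unit_app := fun X => ?_,
            mult_app := fun X => ?_ }, ?_, ?_, fun X => ?_⟩
  · refine CatOver.sameArrow_cell (congrArg CatOver.Hom.functor (nat F))
      (congrArg CatOver.Hom.functor (nat G)) fun x => Perm.sameArrow ?_ ?_ rfl rfl
    · exact SameArrow.of_eq ((T.labMap F).functor.map_id x).symm
    · exact SameArrow.of_eq ((T.labMap G).functor.map_id x).symm
  · exact perm_hom_ext rfl rfl fun z => rfl
  · refine perm_hom_ext rfl rfl fun z => IsIdentity.sameArrow_of_src_eq (isIdentity_id _) ?_ rfl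
    exact IsIdentity.comp
      (((isIdentity_id z).map (T.labMap (permLift (𝟙 (𝟙 (T.labOver X)))
        fun z _ => isIdentity_id _) ≫ T.labMap (T.permDom X)).functor).map (T.labMult X).functor)
      ((isIdentity_id z).map (T.labMult X).functor)
  · exact TwoMonad.Hom.ext rfl
  · exact TwoMonad.Hom.ext rfl
  · exact CatOver.isIdentity_cell _ fun x => isIdentity_id _

end Operad

/-! ### Components of an arbitrary coidentifier -/

namespace Operad

variable {I : Type u} {T : Operad I}

/-- The components of every coidentifier of `α_T` are strict coidentifiers of the permutative
arrows. -/
lemma isCoid_of_isCoidentifier {Q : TwoMonad (CatOver I)} {q : TwoMonad.Hom T.twoMonad Q}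
    (hq : TwoMonad.IsCoidentifier T.permCell q) (X : CatOver I) :
    IsCoid (T.permutative X) (q.app X).functor := by
  have h₀ := T.isCoidentifier_quotHom
  obtain ⟨k, hk, -⟩ := h₀.existsUnique_hom Q q hq.isIdentity
  obtain ⟨k', hk', -⟩ := hq.existsUnique_hom _ T.quotHom h₀.isIdentity
  -- By uniqueness of factorizations the two comparison morphisms are mutually inverse, so every
  -- component of `q` is that of `T.quotHom` followed by an isomorphism of categories.
  have e₁ : k.comp k' = TwoMonad.Hom.id _ :=
    (h₀.existsUnique_hom _ T.quotHom h₀.isIdentity).unique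
      ((congrArg (fun φ => TwoMonad.Hom.comp φ k') hk).trans hk') (TwoMonad.Hom.ext rfl)
  have e₂ : k'.comp k = TwoMonad.Hom.id _ :=
    (hq.existsUnique_hom _ q hq.isIdentity).unique
      ((congrArg (fun φ => TwoMonad.Hom.comp φ k) hk').trans hk) (TwoMonad.Hom.ext rfl)
  rw [← hk]
  exact (isCoid_quot X).comp_iso
    (congrArg (fun φ : TwoMonad.Hom _ _ => (φ.app X).functor) e₁)
    (congrArg (fun φ : TwoMonad.Hom _ _ => (φ.app X).functor) e₂)

/-! ## Comparison with the standard monad -/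

section Standard

variable {X Y : I → Type u}

/-- The term underlying an operation labelled in a discrete object. -/
def Lab.toTerm (a : T.Lab (CatOver.disc X)) : T.Term X a.arr.tgt where
  n := a.arr.n
  c j := (a.label j).as.1
  op := cast (congrArg (fun c => T.Hom c a.arr.tgt) (funext fun j => (a.col_label j).symm)) a.arr.hom
  arg j := (a.label j).as.2

/-- The operation labelled in a discrete object determined by a term. -/
def Term.toLab {i : I} (t : T.Term X i) : T.Lab (CatOver.disc X) :=
  ⟨toArr t.op, fun j => ⟨⟨t.c j, t.arg j⟩⟩, fun _ => rfl⟩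

/-- Taking the colours of the labels as the source of the operation removes the transport in
`Lab.toTerm`; further arguments may assume that an object has the form `t.toLab`. -/
lemma exists_term (a : T.Lab (CatOver.disc X)) : ∃ (i : I) (t : T.Term X i), a = t.toLab := by
  obtain ⟨⟨n, c, i, α⟩, l, hl⟩ := a
  change Fin n → CatOver.disc X at l
  have hl' : (fun j => (l j).as.1) = c := funext hl
  subst hl'
  exact ⟨i, ⟨n, _, α, fun j => (l j).as.2⟩, rfl⟩

/-- Labels in a discrete object are joined only by identities, so an arrow retains nothing but a
permutation that carries one term to the other. -/
lemma sameOrbit_of_hom {i i' : I} {t : T.Term X i} {t' : T.Term X i'} (f : t.toLab ⟶ t'.toLab) :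
    (⟨⟨i, t.orbit⟩⟩ : CatOver.disc (T.Orbits X)) = ⟨⟨i', t'.orbit⟩⟩ := by
  obtain ⟨n, c, α, x⟩ := t
  obtain ⟨n', c', α', x'⟩ := t'
  obtain ⟨ρ, h, e⟩ := f
  have h' : ∀ j, (⟨c j, x j⟩ : Σ i, X i) = ⟨c' (ρ j), x' (ρ j)⟩ := fun j =>
    Discrete.eq_of_hom (h j)
  change Fin n ≃ Fin n' at ρ
  obtain ⟨-, h₂, h₃, h₄⟩ := Arr.mk.inj e
  obtain rfl : i = i' := h₃
  obtain rfl : c = c' ∘ ρ := eq_of_heq h₂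
  obtain rfl : α = T.act ρ α' := eq_of_heq h₄
  obtain rfl : x = fun j => x' (ρ j) := funext fun j => eq_of_heq (Sigma.mk.inj (h' j)).2
  exact congrArg (fun o : T.Orbits X i => (⟨⟨i, o⟩⟩ : CatOver.disc (T.Orbits X)))
    (orbit_eq.2 (Term.sameOrbit_permute ⟨n', c', α', x'⟩ ρ))

lemma hom_of_sameOrbit {i : I} {t t' : T.Term X i} (h : Term.SameOrbit t t') :
    Nonempty (t.toLab ⟶ t'.toLab) := by
  obtain ⟨ρ, h⟩ := h
  have key : ∀ {m : ℕ} (ρ : Fin m ≃ Fin t'.n), Nonempty ((t'.permute ρ).toLab ⟶ t'.toLab) :=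
    fun ρ => ⟨(⟨ρ, fun j => 𝟙 _, rfl⟩ : Lab.Hom _ _)⟩
  rw [h]
  exact key ρ

/-- The operation labelled in labelled operations determined by a term in terms. -/
def Term.toLab₂ {i : I} (s : T.Term (T.Term X) i) : T.labOver (T.labOver (CatOver.disc X)) :=
  (⟨toArr s.op, fun j => (s.arg j).toLab, fun _ => rfl⟩ : T.Lab (T.labOver (CatOver.disc X)))

lemma exists_term₂ (z : T.Lab (T.labOver (CatOver.disc X))) :
    ∃ (i : I) (s : T.Term (T.Term X) i), z = s.toLab₂ := by
  obtain ⟨⟨n, c, i, α⟩, l, hl⟩ := z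
  change Fin n → T.Lab (CatOver.disc X) at l
  choose k t ht using fun j => exists_term (l j)
  obtain rfl : l = fun j => (t j).toLab := funext ht
  have hl' : k = c := funext hl
  subst hl'
  exact ⟨i, ⟨n, k, α, t⟩, rfl⟩

/-- For discrete labels every arrow of `TX` is thus sent to an identity by the coidentifier. This is
why the quotient has only identities and its objects are the connected components of `TX`, that is,
the orbits. -/
lemma permutative_disc {a b : T.Lab (CatOver.disc X)} (f : a ⟶ b) :
    T.permutative (CatOver.disc X) f :=
  fun j => ⟨Discrete.ext (Discrete.eq_of_hom (f.hom j)), Subsingleton.elim _ _⟩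

variable (X) in
/-- The map sending a labelled operation to its orbit. -/
def labOrbit : T.labOver (CatOver.disc X) ⟶ CatOver.disc (T.Orbits X) where
  functor :=
    { obj a := ⟨⟨a.arr.tgt, a.toTerm.orbit⟩⟩
      map {a b} f := eqToHom (by
        obtain ⟨i, t, rfl⟩ := exists_term a
        obtain ⟨i', t', rfl⟩ := exists_term b
        exact sameOrbit_of_hom f)
      map_id _ := Subsingleton.elim _ _
      map_comp _ _ := Subsingleton.elim _ _ }
  w := CategoryTheory.Functor.ext (fun _ => rfl) fun _ _ _ => Subsingleton.elim _ _

lemma isIdentity_disc {a b : CatOver.disc X} (f : a ⟶ b) : IsIdentity f :=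
  ⟨Discrete.ext (Discrete.eq_of_hom f), Subsingleton.elim _ _⟩

lemma hom_ext_disc {Y : CatOver I} {F G : Y ⟶ CatOver.disc X}
    (h : ∀ x, F.functor.obj x = G.functor.obj x) : F = G :=
  CatOver.hom_ext' fun f =>
    IsIdentity.sameArrow_of_src_eq (isIdentity_disc _) (isIdentity_disc _) (h _)

/-- The map `φ` is the descent of `labOrbit`, and `ψ` takes the class of a representative of an
orbit. All categories involved have only identity arrows, so each identity is checked on objects,
and there on classes of terms, where `hφt` and `hψ` compute both maps. -/
lemma agreesWithStandardMonad {Q : TwoMonad (CatOver I)} {q : TwoMonad.Hom T.twoMonad Q}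
    (hq : ∀ X, IsCoid (T.permutative X) (q.app X).functor) : AgreesWithStandardMonad q := by
  have hid (X : I → Type u) {a b : Q.T.obj (CatOver.disc X)} (f : a ⟶ b) : IsIdentity f := by
    obtain ⟨a, b, f, hf⟩ := (hq (CatOver.disc X)).exists_sameArrow f
    exact hf.isIdentity_iff.1 ((hq _).isIdentity f (permutative_disc f))
  choose φ hφ using fun X : I → Type u => CatOver.exists_desc (hq (CatOver.disc X)) (labOrbit X)
    fun f _ => isIdentity_disc _
  have hφ' (X : I → Type u) (a) := CatOver.obj_eq (hφ X) a
  let qX (X : I → Type u) : T.labOver (CatOver.disc X) ⟶ Q.T.obj (CatOver.disc X) :=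
    q.app (CatOver.disc X)
  have hcol (X : I → Type u) {i : I} (t : T.Term X i) :
      (Q.T.obj (CatOver.disc X)).proj.obj ((qX X).functor.obj t.toLab) = ⟨i⟩ :=
    Functor.congr_obj (qX X).w t.toLab
  let ψ (X : I → Type u) : CatOver.disc (T.Orbits X) ⟶ Q.T.obj (CatOver.disc X) :=
    { functor := Discrete.functor fun p => (qX X).functor.obj p.2.rep.toLab
      w := CategoryTheory.Functor.ext (fun p => hcol X p.as.2.rep)
        fun _ _ _ => Subsingleton.elim _ _ }
  -- The chosen representative lies in the orbit of `t`, hence is connected to `t` by an arrow of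
  -- `TX`, and this arrow becomes an identity.
  have hψ (X : I → Type u) {i : I} (t : T.Term X i) :
      (ψ X).functor.obj ⟨⟨i, t.orbit⟩⟩ = (qX X).functor.obj t.toLab := by
    obtain ⟨f⟩ := hom_of_sameOrbit (orbit_eq.1 (orbit_rep t.orbit))
    exact (hid X ((qX X).functor.map f)).src_eq_tgt
  have hφt (X : I → Type u) {i : I} (t : T.Term X i) :
      (φ X).functor.obj ((qX X).functor.obj t.toLab) = ⟨⟨i, t.orbit⟩⟩ := hφ' X t.toLab
  have hsurj (X : I → Type u) (y : Q.T.obj (CatOver.disc X)) :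
      ∃ (i : I) (t : T.Term X i), (qX X).functor.obj t.toLab = y := by
    obtain ⟨a, rfl⟩ := (hq (CatOver.disc X)).obj_surj y
    obtain ⟨i, t, rfl⟩ := exists_term a
    exact ⟨i, t, rfl⟩
  refine ⟨φ, ψ, fun X => ?_, fun X => ?_, fun {X Y} f => ?_, fun X => ?_, fun X => ?_,
    fun X i t => hφt X t⟩
  · refine CatOver.hom_ext' fun {x y} f => IsIdentity.sameArrow_of_src_eq
      ((hid X f).map (φ X ≫ ψ X).functor) (hid X f) ?_
    clear f y
    revert x
    intro y
    obtain ⟨i, t, rfl⟩ := hsurj X y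
    exact (congrArg (ψ X).functor.obj (hφt X t)).trans (hψ X t)
  · refine hom_ext_disc fun y => ?_
    obtain ⟨⟨i, o⟩⟩ := y
    obtain ⟨t, rfl⟩ := orbit_surjective o
    exact (congrArg (φ X).functor.obj (hψ X t)).trans (hφt X t)
  · refine hom_ext_disc fun y => ?_
    obtain ⟨i, t, rfl⟩ := hsurj X y
    have h₁ := CatOver.obj_eq (q.naturality (CatOver.discMap f)) t.toLab
    refine (congrArg (φ Y).functor.obj h₁.symm).trans ?_
    refine (hφt Y (t.map fun i x => f i x)).trans ?_
    exact (congrArg (CatOver.discMap (T.standardMonad.map f)).functor.obj (hφt X t)).symm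
  · refine hom_ext_disc fun y => ?_
    obtain ⟨⟨i, x⟩⟩ := y
    have h₁ := CatOver.obj_eq (q.unit_app (CatOver.disc X)) ⟨⟨i, x⟩⟩
    exact (congrArg (φ X).functor.obj h₁.symm).trans (hφt X (Term.var x))
  · let qQ : T.labOver (Q.T.obj (CatOver.disc X)) ⟶ Q.T.obj (Q.T.obj (CatOver.disc X)) := q.app _
    refine hom_ext_disc fun y => ?_
    -- Every object of the twofold `Q` comes from a term in terms `s`. On it one side gives the
    -- orbit of the substitution, the other the product of the orbit of orbits, and these agree by
    -- `Orbits.mul_orbit`.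
    obtain ⟨w, rfl⟩ := (hq (Q.T.obj (CatOver.disc X))).obj_surj y
    obtain ⟨z, rfl⟩ := (isFullSurj_labMap (T := T) (q := qX X) (hq _).toIsFullSurj).obj_surj w
    obtain ⟨i, s, rfl⟩ := exists_term₂ z
    have h₁ := CatOver.obj_eq (q.mult_app (CatOver.disc X)) s.toLab₂
    refine (congrArg (φ X).functor.obj h₁.symm).trans ((hφt X s.subst).trans ?_)
    have h₂ := CatOver.obj_eq (q.naturality (φ X)) ((T.labMap (qX X)).functor.obj s.toLab₂)
    have h₃ : (T.labMap (φ X)).functor.obj ((T.labMap (qX X)).functor.obj s.toLab₂) =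
        (s.map fun _ => Term.orbit).toLab :=
      CatOver.obj_eq (congrArg T.labMap (hφ X)) s.toLab₂
    have h₄ := h₂.symm.trans (congrArg (qX (T.Orbits X)).functor.obj h₃)
    refine Eq.trans ?_ (congrArg (CatOver.discMap (T.standardMonad.μ.app X)).functor.obj
      ((congrArg (φ (T.Orbits X)).functor.obj h₄).trans
        (hφt (T.Orbits X) (s.map fun _ => Term.orbit)))).symm
    exact congrArg (fun o : T.Orbits X i => (⟨⟨i, o⟩⟩ : CatOver.disc (T.Orbits X)))
      (Orbits.mul_orbit s).symm

end Standard

end Operad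

lemma SameArrow.trans_map_comp {C D : Type*} [Category* C] [Category* D] (F : C ⥤ D) {x y z : C}
    {f : x ⟶ y} {g : y ⟶ z} {u v : D} {k : u ⟶ v} (h : SameArrow k (F.map f ≫ F.map g)) :
    SameArrow k (F.map (f ≫ g)) := by
  rwa [F.map_comp]

/-! ## Fibres -/

namespace CatOver

variable {I : Type u} {H : CatOver I} {i : I}

/-- An object of `H` over `i`, regarded as an object of the fibre. -/
def fibreMk (x : H) (h : H.col x = i) : H.Fibre i := ⟨x, congrArg Discrete.mk h⟩

/-- Arrows between objects of the fibre are arrows in the fibre. -/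
def fibreHom {x y : H.Fibre i} (f : (H.incl i).obj x ⟶ (H.incl i).obj y) : x ⟶ y :=
  ⟨f, IsHomLift.of_commsq _ _ _ x.2 y.2 (Subsingleton.elim _ _)⟩

lemma col_eq_of_hom {x y : H} (f : x ⟶ y) : H.col x = H.col y :=
  Discrete.eq_of_hom (H.proj.map f)

lemma sameArrow_of_incl {x y x' y' : H.Fibre i} {f : x ⟶ y} {g : x' ⟶ y'}
    (h : SameArrow ((H.incl i).map f) ((H.incl i).map g)) : SameArrow f g := by
  obtain rfl : x = x' := Functor.Fiber.fiberInclusion_obj_inj h.src_eq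
  obtain rfl : y = y' := Functor.Fiber.fiberInclusion_obj_inj h.tgt_eq
  exact SameArrow.of_eq (Functor.Fiber.hom_ext h.eq)

lemma isIdentity_incl_iff {x y : H.Fibre i} {f : x ⟶ y} :
    IsIdentity ((H.incl i).map f) ↔ IsIdentity f := by
  refine ⟨fun h => ?_, fun h => h.map _⟩
  obtain rfl : x = y := Functor.Fiber.fiberInclusion_obj_inj h.src_eq_tgt
  refine ⟨rfl, Functor.Fiber.hom_ext (h.eq ?_)⟩
  exact (isIdentity_id x).map (H.incl i)

lemma isIso_incl_iff {x y : H.Fibre i} {f : x ⟶ y} : IsIso ((H.incl i).map f) ↔ IsIso f := by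
  refine ⟨fun h => ⟨fibreHom (inv ((H.incl i).map f)), Functor.Fiber.hom_ext ?_,
    Functor.Fiber.hom_ext ?_⟩, fun h => inferInstance⟩
  · exact (Functor.map_comp _ _ _).trans
      ((IsIso.hom_inv_id ((H.incl i).map f)).trans ((H.incl i).map_id x).symm)
  · exact (Functor.map_comp _ _ _).trans
      ((IsIso.inv_hom_id ((H.incl i).map f)).trans ((H.incl i).map_id y).symm)

lemma isIso_cell_iff {X Y : CatOver I} {F G : X ⟶ Y} (θ : F ⟶ G) :
    IsIso θ ↔ ∀ x, IsIso (θ.nat.app x) := by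
  constructor
  · rintro ⟨θ', h, h'⟩ x
    exact ⟨θ'.nat.app x, congrArg (fun θ : F ⟶ F => θ.nat.app x) h,
      congrArg (fun θ : G ⟶ G => θ.nat.app x) h'⟩
  · intro h
    have := NatIso.isIso_of_isIso_app θ.nat
    exact ⟨⟨inv θ.nat⟩, Cell.ext (IsIso.hom_inv_id θ.nat), Cell.ext (IsIso.inv_hom_id θ.nat)⟩

lemma isIdentity_cell_iff {X Y : CatOver I} {F G : X ⟶ Y} (θ : F ⟶ G) :
    IsIdentity θ ↔ ∀ x, IsIdentity (θ.nat.app x) :=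
  ⟨fun h x => isIdentity_app h x, isIdentity_cell θ⟩

/-- This is the shape of the composites in the axioms of a lax algebra, where an equality 2-cell
joins two coherence 2-cells. -/
lemma sameArrow_comp_eqToHom_comp {X Y : CatOver I} {F G G' K : X ⟶ Y} {θ : F ⟶ G} (h : G = G')
    {θ' : G' ⟶ K} {x : X} {u v t : Y} {f : u ⟶ v} {g : v ⟶ t} (hf : SameArrow (θ.nat.app x) f)
    (hg : SameArrow (θ'.nat.app x) g) :
    SameArrow (Cell.nat (θ ≫ eqToHom h ≫ θ') |>.app x) (f ≫ g) := by
  subst h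
  refine SameArrow.comp hf (SameArrow.trans ?_ hg)
  exact SameArrow.of_eq (Category.id_comp _)

end CatOver

lemma natTrans_isIso_iff {C D : Type*} [Category* C] [Category* D] {F G : C ⥤ D} (θ : F ⟶ G) :
    IsIso θ ↔ ∀ x, IsIso (θ.app x) :=
  ⟨fun _ _ => inferInstance, fun _ => NatIso.isIso_of_isIso_app θ⟩

lemma natTrans_isIdentity_iff {C D : Type*} [Category* C] [Category* D] {F G : C ⥤ D}
    (θ : F ⟶ G) : IsIdentity θ ↔ ∀ x, IsIdentity (θ.app x) :=
  ⟨fun h => h.natTrans_app, isIdentity_natTrans θ⟩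

/-! ## Algebras and morphisms without axioms -/

/-- The data of a lax algebra. -/
structure PreAlgebra {I : Type u} (Q : TwoMonad (CatOver I)) (H : CatOver I) where
  a : Q.T.obj H ⟶ H
  a₀ : 𝟙 H ⟶ Q.unit H ≫ a
  a₂ : Q.T.map a ≫ a ⟶ Q.mult H ≫ a

/-- The data of a lax morphism. -/
structure PreMorphism {I : Type u} (T : Operad I) (H : I → Type u) [∀ i, Category.{u} (H i)] where
  prod {n : ℕ} {c : Fin n → I} {i : I} (α : T.Hom c i) : (∀ j, H (c j)) ⥤ H i
  sym {m n : ℕ} {c : Fin n → I} {i : I} (α : T.Hom c i) (ρ : Fin m ≃ Fin n) :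
    permuteFactors c ρ ⋙ prod (T.act ρ α) ⟶ prod α
  unit (i : I) : 𝟭 (H i) ⟶ toUnary i ⋙ prod (T.one i)
  subst {n : ℕ} {c : Fin n → I} {i : I} {m : Fin n → ℕ} {d : ∀ j, Fin (m j) → I}
    (α : T.Hom c i) (β : ∀ j, T.Hom (d j) (c j)) :
    prodFunctor (fun j => prod (β j)) ⋙ prod α ⟶ concatFactors d ⋙ prod (T.comp α β)

/-- The data underlying a lax morphism. -/
def LaxMorphism.toPre {I : Type u} {T : Operad I} {H : I → Type u} [∀ i, Category.{u} (H i)]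
    (M : LaxMorphism T H) : PreMorphism T H where
  prod := M.prod
  sym := M.sym
  unit := M.unit
  subst := M.subst

lemma LaxMorphism.toPre_injective {I : Type u} {T : Operad I} {H : I → Type u}
    [∀ i, Category.{u} (H i)] {M N : LaxMorphism T H} (h : M.toPre = N.toPre) : M = N := by
  obtain ⟨h₁, h₂, h₃, h₄⟩ := PreMorphism.mk.inj h
  exact LaxMorphism.ext h₁ h₂ h₃ h₄

/-- The data underlying a lax algebra. -/
def TwoMonad.LaxAlgebra.toPre {I : Type u} {Q : TwoMonad (CatOver I)} {H : CatOver I}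
    (A : Q.LaxAlgebra H) : PreAlgebra Q H where
  a := A.a
  a₀ := A.a₀
  a₂ := A.a₂

lemma TwoMonad.LaxAlgebra.toPre_injective {I : Type u} {Q : TwoMonad (CatOver I)} {H : CatOver I}
    {A B : Q.LaxAlgebra H} (h : A.toPre = B.toPre) : A = B := by
  obtain ⟨a, a₀, a₂, _, _, _⟩ := A
  obtain ⟨b, b₀, b₂, _, _, _⟩ := B
  obtain ⟨h₁, h₂, h₃⟩ := PreAlgebra.mk.inj h
  obtain rfl : a = b := h₁
  obtain rfl : a₀ = b₀ := eq_of_heq h₂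
  obtain rfl : a₂ = b₂ := eq_of_heq h₃
  rfl

section
variable {I : Type u} {H : CatOver I} {Q : TwoMonad (CatOver I)}

lemma PreAlgebra.left_eq (A : PreAlgebra Q H) :
    A.a ≫ Q.unit H ≫ A.a = Q.unit (Q.T.obj H) ≫ Q.T.map A.a ≫ A.a := by
  rw [← Strict.assoc, Q.unit_naturality, Strict.assoc]

lemma PreAlgebra.right_eq (A : PreAlgebra Q H) : Q.T.map (Q.unit H ≫ A.a) ≫ A.a =
    Q.T.map (Q.unit H) ≫ Q.T.map A.a ≫ A.a := by
  rw [Q.T.map_comp, Strict.assoc]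

lemma PreAlgebra.assoc_eq₁ (A : PreAlgebra Q H) : Q.T.map (Q.T.map A.a) ≫ Q.mult H ≫ A.a =
    Q.mult (Q.T.obj H) ≫ Q.T.map A.a ≫ A.a := by
  rw [← Strict.assoc, Q.mult_naturality, Strict.assoc]

lemma PreAlgebra.assoc_eq₂ (A : PreAlgebra Q H) : Q.T.map (Q.mult H ≫ A.a) ≫ A.a =
    Q.T.map (Q.mult H) ≫ Q.T.map A.a ≫ A.a := by
  rw [Q.T.map_comp, Strict.assoc]

end

namespace Operad

variable {I : Type u} {T : Operad I} {H : CatOver I} {Q : TwoMonad (CatOver I)}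

/-- The components of a morphism of 2-monads with source `T`. -/
abbrev homApp (q : TwoMonad.Hom T.twoMonad Q) (X : CatOver I) : T.labOver X ⟶ Q.T.obj X := q.app X

/-- The map `TTX ⟶ QQX` induced by a morphism of 2-monads `T ⟶ Q`. -/
abbrev homApp₂ (q : TwoMonad.Hom T.twoMonad Q) (X : CatOver I) :
    T.labOver (T.labOver X) ⟶ Q.T.obj (Q.T.obj X) :=
  T.labMap (homApp q X) ≫ homApp q (Q.T.obj X)

/-- The data of an algebra and the data of a morphism correspond to each other. -/
structure PreCorresponds (q : TwoMonad.Hom T.twoMonad Q) (A : PreAlgebra Q H)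
    (M : PreMorphism T H.Fibre) : Prop where
  prod_obj {n : ℕ} {c : Fin n → I} {i : I} (α : T.Hom c i) (x : ∀ j, H.Fibre (c j)) :
    (H.incl i).obj ((M.prod α).obj x) = (homApp q H ≫ A.a).functor.obj (lab α x)
  prod_map {n : ℕ} {c : Fin n → I} {i : I} (α : T.Hom c i) {x y : ∀ j, H.Fibre (c j)}
    (γ : x ⟶ y) :
    SameArrow ((H.incl i).map ((M.prod α).map γ))
      ((homApp q H ≫ A.a).functor.map (labLevelwise α γ))
  sym {m n : ℕ} {c : Fin n → I} {i : I} (α : T.Hom c i) (ρ : Fin m ≃ Fin n)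
    (x : ∀ j, H.Fibre (c j)) :
    SameArrow ((H.incl i).map ((M.sym α ρ).app x))
      ((homApp q H ≫ A.a).functor.map (labPermutative α ρ x))
  unit {i : I} (x : H.Fibre i) :
    SameArrow ((H.incl i).map ((M.unit i).app x)) (A.a₀.nat.app ((H.incl i).obj x))
  subst {n : ℕ} {c : Fin n → I} {i : I} {m : Fin n → ℕ} {d : ∀ j, Fin (m j) → I}
    (α : T.Hom c i) (β : ∀ j, T.Hom (d j) (c j)) (x : ∀ j k, H.Fibre (d j k)) :
    SameArrow ((H.incl i).map ((M.subst α β).app x))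
      (A.a₂.nat.app ((homApp₂ q H).functor.obj (lab₂ α β x)))

/-- The correspondence involves only the data. So data can be constructed and compared first, and
the axioms translated afterwards. -/
lemma corresponds_iff {q : TwoMonad.Hom T.twoMonad Q} {A : Q.LaxAlgebra H}
    {M : LaxMorphism T H.Fibre} : Corresponds q A M ↔ PreCorresponds q A.toPre M.toPre :=
  ⟨fun h => ⟨h.prod_obj, h.prod_map, h.sym, h.unit, h.subst⟩,
    fun h => ⟨h.prod_obj, h.prod_map, h.sym, h.unit, h.subst⟩⟩

lemma lab_eta (w : T.labOver H) : ∃ (n : ℕ) (c : Fin n → I) (i : I) (α : T.Hom c i)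
    (x : ∀ j, H.Fibre (c j)), w = lab α x :=
  ⟨_, _, _, w.arr.hom, fun j => CatOver.fibreMk (w.label j) (w.col_label j), rfl⟩

/-- The inner operations must have targets equal to the colours of the outer one; substituting this
equality brings any object into the form in which a lax morphism can be evaluated. -/
lemma lab₂_eta (z : T.labOver (T.labOver H)) : ∃ (n : ℕ) (c : Fin n → I) (i : I) (m : Fin n → ℕ)
    (d : ∀ j, Fin (m j) → I) (α : T.Hom c i) (β : ∀ j, T.Hom (d j) (c j))
    (x : ∀ j k, H.Fibre (d j k)), z = lab₂ α β x := by
  obtain ⟨⟨n, c, i, α⟩, l, hl⟩ := z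
  change Fin n → T.labOver H at l
  choose m d k β x hx using fun j => lab_eta (l j)
  obtain rfl : l = fun j => lab (β j) (x j) := funext hx
  have hk : k = c := funext hl
  subst hk
  exact ⟨n, k, i, m, d, α, β, x, rfl⟩

/-- The object `(α, (β_j, (γ_jk, (x_jkl)_l)_k)_j)` of `TTTH`. -/
def lab₃ {n : ℕ} {c : Fin n → I} {i : I} {m : Fin n → ℕ} {d : ∀ j, Fin (m j) → I}
    {p : ∀ j, Fin (m j) → ℕ} {e : ∀ j k, Fin (p j k) → I}
    (α : T.Hom c i) (β : ∀ j, T.Hom (d j) (c j)) (γ : ∀ j k, T.Hom (e j k) (d j k))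
    (x : ∀ j k l, H.Fibre (e j k l)) : T.labOver (T.labOver (T.labOver H)) :=
  (⟨toArr α, fun j => lab₂ (β j) (γ j) (x j), fun _ => rfl⟩ : T.Lab (T.labOver (T.labOver H)))

lemma lab₃_eta (z : T.labOver (T.labOver (T.labOver H))) :
    ∃ (n : ℕ) (c : Fin n → I) (i : I) (m : Fin n → ℕ)
    (d : ∀ j, Fin (m j) → I) (p : ∀ j, Fin (m j) → ℕ) (e : ∀ j k, Fin (p j k) → I)
    (α : T.Hom c i) (β : ∀ j, T.Hom (d j) (c j)) (γ : ∀ j k, T.Hom (e j k) (d j k))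
    (x : ∀ j k l, H.Fibre (e j k l)), z = lab₃ α β γ x := by
  obtain ⟨⟨n, c, i, α⟩, l, hl⟩ := z
  change Fin n → T.labOver (T.labOver H) at l
  choose m d k p e β γ x hx using fun j => lab₂_eta (l j)
  obtain rfl : l = fun j => lab₂ (β j) (γ j) (x j) := funext hx
  have hk : k = c := funext hl
  subst hk
  exact ⟨n, k, i, m, d, p, e, α, β, γ, x, rfl⟩

lemma labUnit_incl {i : I} (x : H.Fibre i) :
    (T.labUnit H).functor.obj ((H.incl i).obj x) = lab (T.one i) ((toUnary i).obj x) := by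
  obtain ⟨x, hx⟩ := x
  obtain rfl : H.col x = i := congrArg Discrete.as hx
  rfl

lemma labMap_labUnit_lab {n : ℕ} {c : Fin n → I} {i : I} (α : T.Hom c i)
    (x : ∀ j, H.Fibre (c j)) : (T.labMap (T.labUnit H)).functor.obj (lab α x) =
      lab₂ α (fun j => T.one (c j)) (fun j => (toUnary (c j)).obj (x j)) :=
  Lab.ext' rfl fun j k h => by
    obtain rfl := Fin.ext h
    exact labUnit_incl (x j)

/-! ### Naturality of the comparison maps on objects -/

section
variable (q : TwoMonad.Hom T.twoMonad Q)

lemma homApp_unit (X : CatOver I) (w : T.labOver X) :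
    (Q.unit (Q.T.obj X)).functor.obj ((homApp q X).functor.obj w) =
      (homApp₂ q X).functor.obj ((T.labUnit (T.labOver X)).functor.obj w) := by
  refine (CatOver.obj_eq (q.unit_app (Q.T.obj X)) ((homApp q X).functor.obj w)).symm.trans ?_
  exact congrArg (homApp q (Q.T.obj X)).functor.obj
    (CatOver.obj_eq (T.labUnit_naturality (homApp q X)) w)

lemma homApp_map {X Y : CatOver I} (F : X ⟶ Y) (w : T.labOver X) :
    (Q.T.map F).functor.obj ((homApp q X).functor.obj w) =
      (homApp q Y).functor.obj ((T.labMap F).functor.obj w) :=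
  (CatOver.obj_eq (q.naturality F) w).symm

lemma homApp_map₂ {X Y : CatOver I} {F G : X ⟶ Y} (θ : F ⟶ G) (w : T.labOver X) :
    SameArrow ((Q.T.map₂ θ).nat.app ((homApp q X).functor.obj w))
      ((homApp q Y).functor.map ((T.labMap₂ θ).nat.app w)) :=
  (CatOver.sameArrow_app (q.naturality₂ θ) w).symm

lemma homApp_map_unit (X : CatOver I) (w : T.labOver X) :
    (Q.T.map (Q.unit X)).functor.obj ((homApp q X).functor.obj w) =
      (homApp₂ q X).functor.obj ((T.labMap (T.labUnit X)).functor.obj w) := by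
  rw [homApp_map]
  exact congrArg (homApp q (Q.T.obj X)).functor.obj
    (CatOver.obj_eq (congrArg T.labMap (q.unit_app X)).symm w)

lemma homApp_mult (X : CatOver I) (z : T.labOver (T.labOver X)) :
    (Q.mult X).functor.obj ((homApp₂ q X).functor.obj z) =
      (homApp q X).functor.obj ((T.labMult X).functor.obj z) :=
  (CatOver.obj_eq (q.mult_app X) z).symm

/-- The map `TTTX ⟶ QQQX` induced by a morphism of 2-monads `T ⟶ Q`. -/
abbrev homApp₃ (X : CatOver I) :
    T.labOver (T.labOver (T.labOver X)) ⟶ Q.T.obj (Q.T.obj (Q.T.obj X)) :=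
  T.labMap (homApp₂ q X) ≫ homApp q (Q.T.obj (Q.T.obj X))

lemma homApp₃_mult (X : CatOver I) (z : T.labOver (T.labOver (T.labOver X))) :
    (Q.mult (Q.T.obj X)).functor.obj ((homApp₃ q X).functor.obj z) =
      (homApp₂ q X).functor.obj ((T.labMult (T.labOver X)).functor.obj z) := by
  refine (homApp_mult q (Q.T.obj X) ((T.labMap (T.labMap (homApp q X))).functor.obj z)).trans ?_
  exact congrArg (homApp q (Q.T.obj X)).functor.obj
    (CatOver.obj_eq (T.labMult_naturality (homApp q X)) z)

lemma homApp₃_map_mult (X : CatOver I) (z : T.labOver (T.labOver (T.labOver X))) :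
    (Q.T.map (Q.mult X)).functor.obj ((homApp₃ q X).functor.obj z) =
      (homApp₂ q X).functor.obj ((T.labMap (T.labMult X)).functor.obj z) := by
  refine (homApp_map q (Q.mult X) ((T.labMap (homApp₂ q X)).functor.obj z)).trans ?_
  exact congrArg (homApp q (Q.T.obj X)).functor.obj
    (CatOver.obj_eq (congrArg T.labMap (q.mult_app X)).symm z)

lemma homApp₂_map_map {X Y : CatOver I} (F : X ⟶ Y) (z : T.labOver (T.labOver X)) :
    (Q.T.map (Q.T.map F)).functor.obj ((homApp₂ q X).functor.obj z) =
      (homApp₂ q Y).functor.obj ((T.labMap (T.labMap F)).functor.obj z) := by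
  refine (homApp_map q (Q.T.map F) ((T.labMap (homApp q X)).functor.obj z)).trans ?_
  exact congrArg (homApp q (Q.T.obj Y)).functor.obj
    (CatOver.obj_eq (congrArg T.labMap (q.naturality F)).symm z)

lemma homApp₃_map_map {X Y : CatOver I} (F : Q.T.obj X ⟶ Y)
    (z : T.labOver (T.labOver (T.labOver X))) :
    (Q.T.map (Q.T.map F)).functor.obj ((homApp₃ q X).functor.obj z) =
      (homApp₂ q Y).functor.obj ((T.labMap (T.labMap (homApp q X ≫ F))).functor.obj z) :=
  homApp₂_map_map q F ((T.labMap (T.labMap (homApp q X))).functor.obj z)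

end

/-! ### Translation of the axioms -/

section
variable {A : PreAlgebra Q H} {q : TwoMonad.Hom T.twoMonad Q} {M : PreMorphism T H.Fibre}
  (h : PreCorresponds q A M)
include h

/-- At the image of `(α, x)`, the unit of `Q` at `QH` gives the image of `(1_i, (α, x))`. So this
composite is the one in the axiom `one_subst`. -/
lemma PreCorresponds.left_unit {n : ℕ} {c : Fin n → I} {i : I} (α : T.Hom c i)
    (x : ∀ j, H.Fibre (c j)) :
    SameArrow (CatOver.Cell.nat (A.a ◁ A.a₀ ≫ eqToHom A.left_eq ≫ Q.unit (Q.T.obj H) ◁ A.a₂) |>.app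
        ((homApp q H).functor.obj (lab α x)))
      ((H.incl i).map ((M.unit i).app ((M.prod α).obj x) ≫
        (M.subst (T.one i) (fun _ => α)).app (fun _ => x))) := by
  refine SameArrow.trans_map_comp (H.incl i) ?_
  refine CatOver.sameArrow_comp_eqToHom_comp A.left_eq ?_ ?_
  · exact (CatOver.sameArrow_app_of_eq A.a₀ (h.prod_obj α x).symm).trans (h.unit _).symm
  · exact (CatOver.sameArrow_app_of_eq A.a₂ (homApp_unit q H (lab α x))).trans
      (h.subst (T.one i) (fun _ => α) (fun _ => x)).symm

/-- Here the unit is inserted at the labels: at the image of `(α, x)`, applying `Q` to `a₀` gives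
the levelwise arrow of units, and the object becomes `(α, (1, x_j)_j)`. This is the composite in
`subst_one`. -/
lemma PreCorresponds.right_unit {n : ℕ} {c : Fin n → I} {i : I} (α : T.Hom c i)
    (x : ∀ j, H.Fibre (c j)) :
    SameArrow (CatOver.Cell.nat (Q.T.map₂ A.a₀ ▷ A.a ≫ eqToHom A.right_eq ≫
        Q.T.map (Q.unit H) ◁ A.a₂) |>.app ((homApp q H).functor.obj (lab α x)))
      ((H.incl i).map ((M.prod α).map (fun j => (M.unit (c j)).app (x j)) ≫
        (M.subst α (fun j => T.one (c j))).app (fun j => (toUnary (c j)).obj (x j)))) := by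
  refine SameArrow.trans_map_comp (H.incl i) ?_
  refine CatOver.sameArrow_comp_eqToHom_comp A.right_eq ?_ ?_
  · refine SameArrow.trans (SameArrow.map A.a.functor (homApp_map₂ q A.a₀ (lab α x)))
      (SameArrow.trans ?_ (h.prod_map α (fun j => (M.unit (c j)).app (x j))).symm)
    refine SameArrow.map (homApp q H ≫ A.a).functor (Lab.sameArrow rfl rfl (fun j k hjk => hjk)
      fun j k hjk => ?_)
    obtain rfl := Fin.ext hjk
    exact (h.unit (x j)).symm
  · exact (CatOver.sameArrow_app_of_eq A.a₂ ((homApp_map_unit q H (lab α x)).trans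
      (congrArg (homApp₂ q H).functor.obj (labMap_labUnit_lab α x)))).trans (h.subst _ _ _).symm

lemma PreCorresponds.labMap_lab₂ {n : ℕ} {c : Fin n → I} {i : I} {m : Fin n → ℕ}
    {d : ∀ j, Fin (m j) → I} (α : T.Hom c i) (β : ∀ j, T.Hom (d j) (c j))
    (x : ∀ j k, H.Fibre (d j k)) : (T.labMap (homApp q H ≫ A.a)).functor.obj (lab₂ α β x) =
      lab α (fun j => (M.prod (β j)).obj (x j)) :=
  Lab.ext' rfl fun j k hjk => by
    obtain rfl := Fin.ext hjk
    exact (h.prod_obj _ _).symm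

lemma PreCorresponds.labMap_labMap_lab₃ {n : ℕ} {c : Fin n → I} {i : I} {m : Fin n → ℕ}
    {d : ∀ j, Fin (m j) → I} {p : ∀ j, Fin (m j) → ℕ} {e : ∀ j k, Fin (p j k) → I}
    (α : T.Hom c i) (β : ∀ j, T.Hom (d j) (c j)) (γ : ∀ j k, T.Hom (e j k) (d j k))
    (x : ∀ j k l, H.Fibre (e j k l)) :
    (T.labMap (T.labMap (homApp q H ≫ A.a))).functor.obj (lab₃ α β γ x) =
      lab₂ α β (fun j k => (M.prod (γ j k)).obj (x j k)) :=
  Lab.ext' rfl fun j k hjk => by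
    obtain rfl := Fin.ext hjk
    exact h.labMap_lab₂ _ _ _

/-- Applying `a` at the innermost level and then multiplying the outer two levels first corresponds
to substituting the `β_j` into `α` before the `γ_jk`. -/
lemma PreCorresponds.assoc₁ {n : ℕ} {c : Fin n → I} {i : I} {m : Fin n → ℕ}
    {d : ∀ j, Fin (m j) → I} {p : ∀ j, Fin (m j) → ℕ} {e : ∀ j k, Fin (p j k) → I}
    (α : T.Hom c i) (β : ∀ j, T.Hom (d j) (c j)) (γ : ∀ j k, T.Hom (e j k) (d j k))
    (x : ∀ j k l, H.Fibre (e j k l)) :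
    SameArrow (CatOver.Cell.nat (Q.T.map (Q.T.map A.a) ◁ A.a₂ ≫ eqToHom A.assoc_eq₁ ≫
        Q.mult (Q.T.obj H) ◁ A.a₂) |>.app ((homApp₃ q H).functor.obj (lab₃ α β γ x)))
      ((H.incl i).map ((M.subst α β).app (fun j k => (M.prod (γ j k)).obj (x j k)) ≫
        (M.subst (T.comp α β)
          (fun l => γ (finSigmaFinEquiv.symm l).1 (finSigmaFinEquiv.symm l).2)).app
          (fun l => x (finSigmaFinEquiv.symm l).1 (finSigmaFinEquiv.symm l).2))) := by
  refine SameArrow.trans_map_comp (H.incl i) ?_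
  refine CatOver.sameArrow_comp_eqToHom_comp A.assoc_eq₁ ?_ ?_
  · exact (CatOver.sameArrow_app_of_eq A.a₂ ((homApp₃_map_map q A.a _).trans
      (congrArg (homApp₂ q H).functor.obj (h.labMap_labMap_lab₃ α β γ x)))).trans
      (h.subst _ _ _).symm
  · exact (CatOver.sameArrow_app_of_eq A.a₂ (homApp₃_mult q H _)).trans (h.subst _ _ _).symm

/-- The other order: applying `Q` to `a₂` substitutes the `γ_jk` into the `β_j` under `H_α`, and the
outer substitution follows. -/
lemma PreCorresponds.assoc₂ {n : ℕ} {c : Fin n → I} {i : I} {m : Fin n → ℕ}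
    {d : ∀ j, Fin (m j) → I} {p : ∀ j, Fin (m j) → ℕ} {e : ∀ j k, Fin (p j k) → I}
    (α : T.Hom c i) (β : ∀ j, T.Hom (d j) (c j)) (γ : ∀ j k, T.Hom (e j k) (d j k))
    (x : ∀ j k l, H.Fibre (e j k l)) :
    SameArrow (CatOver.Cell.nat (Q.T.map₂ A.a₂ ▷ A.a ≫ eqToHom A.assoc_eq₂ ≫
        Q.T.map (Q.mult H) ◁ A.a₂) |>.app ((homApp₃ q H).functor.obj (lab₃ α β γ x)))
      ((H.incl i).map ((M.prod α).map (fun j => (M.subst (β j) (γ j)).app (x j)) ≫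
        (M.subst α (fun j => T.comp (β j) (γ j))).app
          (fun j => (concatFactors (e j)).obj (x j)))) := by
  refine SameArrow.trans_map_comp (H.incl i) ?_
  refine CatOver.sameArrow_comp_eqToHom_comp A.assoc_eq₂ ?_ ?_
  · refine SameArrow.trans (SameArrow.map A.a.functor (homApp_map₂ q A.a₂ _))
      (SameArrow.trans ?_ (h.prod_map α (fun j => (M.subst (β j) (γ j)).app (x j))).symm)
    refine SameArrow.map (homApp q H ≫ A.a).functor (Lab.sameArrow rfl rfl (fun j k hjk => hjk)
      fun j k hjk => ?_)
    obtain rfl := Fin.ext hjk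
    exact (h.subst (β j) (γ j) (x j)).symm
  · exact (CatOver.sameArrow_app_of_eq A.a₂ (homApp₃_map_mult q H _)).trans (h.subst _ _ _).symm

end

end Operad

namespace Operad

variable {I : Type u} {T : Operad I} {H : CatOver I} {Q : TwoMonad (CatOver I)}

/-! ### Generating arrows of `TH` and `TTH` -/

lemma labLevelwise_comp {n : ℕ} {c : Fin n → I} {i : I} (α : T.Hom c i)
    {x y z : ∀ j, H.Fibre (c j)} (γ : x ⟶ y) (δ : y ⟶ z) :
    labLevelwise α (γ ≫ δ) = labLevelwise α γ ≫ labLevelwise α δ :=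
  Lab.hom_ext (fun _ => rfl) fun _ => SameArrow.rfl

/-- The levelwise arrow `(1, (1, (γ_jk)_k)_j)` of `TTH`. -/
def lab₂Levelwise {n : ℕ} {c : Fin n → I} {i : I} {m : Fin n → ℕ} {d : ∀ j, Fin (m j) → I}
    (α : T.Hom c i) (β : ∀ j, T.Hom (d j) (c j)) {x y : ∀ j k, H.Fibre (d j k)} (γ : x ⟶ y) :
    lab₂ α β x ⟶ lab₂ α β y :=
  (⟨Equiv.refl (Fin n), fun j => labLevelwise (β j) (γ j), (actArr_refl _).symm⟩ :
    Lab.Hom (lab₂ α β x) (lab₂ α β y))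

lemma labMult_lab₂Levelwise {n : ℕ} {c : Fin n → I} {i : I} {m : Fin n → ℕ}
    {d : ∀ j, Fin (m j) → I} (α : T.Hom c i) (β : ∀ j, T.Hom (d j) (c j))
    {x y : ∀ j k, H.Fibre (d j k)} (γ : x ⟶ y) :
    SameArrow ((T.labMult H).functor.map (lab₂Levelwise α β γ))
      (labLevelwise (T.comp α β) ((concatFactors d).map γ)) :=
  Lab.sameArrow rfl rfl
    (fun j k hjk => by
      obtain rfl := Fin.ext hjk
      exact congrArg Fin.val (finSigmaFinEquiv.apply_symm_apply j))
    fun j k hjk => by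
      obtain rfl := Fin.ext hjk
      exact sameArrow_comp_eqToHom _ _

/-- The arrow `(ρ, (ρ_j, (1)_k)_j)` of `TTH`. -/
def lab₂Permutative {n n' : ℕ} {c : Fin n → I} {i : I} {m : Fin n → ℕ} {d : ∀ j, Fin (m j) → I}
    {m' : Fin n' → ℕ} (α : T.Hom c i) (β : ∀ j, T.Hom (d j) (c j))
    (ρ : Fin n' ≃ Fin n) (ρs : ∀ j, Fin (m' j) ≃ Fin (m (ρ j))) (x : ∀ j k, H.Fibre (d j k)) :
    lab₂ (T.act ρ α) (fun j => T.act (ρs j) (β (ρ j))) (fun j k => x (ρ j) (ρs j k)) ⟶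
      lab₂ α β x :=
  (⟨ρ, fun j => labPermutative (β (ρ j)) (ρs j) (x (ρ j)), rfl⟩ :
    Lab.Hom (lab₂ (T.act ρ α) (fun j => T.act (ρs j) (β (ρ j))) (fun j k => x (ρ j) (ρs j k)))
      (lab₂ α β x))

lemma permutative_labPermutative {m n : ℕ} {c : Fin n → I} {i : I} (α : T.Hom c i)
    (ρ : Fin m ≃ Fin n) (x : ∀ j, H.Fibre (c j)) : T.permutative H (labPermutative α ρ x) :=
  fun j => isIdentity_id _

/-- The permutation of `f` determines the operation of its source as `βρ`; the components of `f`
then form the levelwise factor. A functor on `TH` is therefore known from its levelwise and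
permutative values. -/
lemma lab_factor {n : ℕ} {c : Fin n → I} {i : I} (β : T.Hom c i) (x : ∀ j, H.Fibre (c j))
    {w : T.labOver H} (f : w ⟶ lab β x) :
    ∃ (m : ℕ) (ρ : Fin m ≃ Fin n) (y : ∀ j, H.Fibre ((c ∘ ρ) j))
      (γ : y ⟶ (permuteFactors c ρ).obj x), w = lab (T.act ρ β) y ∧
        SameArrow f (labLevelwise _ γ ≫ labPermutative β ρ x) := by
  obtain ⟨⟨m, c', i', α⟩, l, hl⟩ := w
  obtain ⟨ρ, h, e⟩ := f
  change Fin m ≃ Fin n at ρ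
  obtain ⟨-, h₂, h₃, h₄⟩ := Arr.mk.inj e
  obtain rfl : i' = i := h₃
  obtain rfl : c' = c ∘ ρ := eq_of_heq h₂
  obtain rfl : α = T.act ρ β := eq_of_heq h₄
  refine ⟨m, ρ, fun j => CatOver.fibreMk (l j) (hl j), fun j => CatOver.fibreHom (h j), rfl,
    Lab.sameArrow rfl rfl (fun j k hjk => ?_) fun j k hjk => ?_⟩
  · obtain rfl := Fin.ext hjk
    rfl
  · obtain rfl := Fin.ext hjk
    exact SameArrow.of_eq (Category.comp_id _).symm

/-- Each component of `f` is factored by `lab_factor`. Naturality on `TTH` thereby reduces to arrows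
with trivial permutations in both layers and arrows with identities at the bottom. -/
lemma lab₂_factor {n : ℕ} {c : Fin n → I} {i : I} {m : Fin n → ℕ} {d : ∀ j, Fin (m j) → I}
    (α : T.Hom c i) (β : ∀ j, T.Hom (d j) (c j)) (x : ∀ j k, H.Fibre (d j k))
    {z : T.labOver (T.labOver H)} (f : z ⟶ lab₂ α β x) :
    ∃ (n' : ℕ) (ρ : Fin n' ≃ Fin n) (m' : Fin n' → ℕ) (ρs : ∀ j, Fin (m' j) ≃ Fin (m (ρ j)))
      (y : ∀ j k, H.Fibre (d (ρ j) (ρs j k))) (γ : y ⟶ fun j k => x (ρ j) (ρs j k)),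
      z = lab₂ (T.act ρ α) (fun j => T.act (ρs j) (β (ρ j))) y ∧
        SameArrow f (lab₂Levelwise _ _ γ ≫ lab₂Permutative α β ρ ρs x) := by
  obtain ⟨⟨n', c', i', α'⟩, l, hl⟩ := z
  obtain ⟨ρ, h, e⟩ := f
  change Fin n' ≃ Fin n at ρ
  obtain ⟨-, h₂, h₃, h₄⟩ := Arr.mk.inj e
  obtain rfl : i' = i := h₃
  obtain rfl : c' = c ∘ ρ := eq_of_heq h₂
  obtain rfl : α' = T.act ρ α := eq_of_heq h₄
  change Fin n' → T.labOver H at l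
  change ∀ j, l j ⟶ lab (β (ρ j)) (x (ρ j)) at h
  choose m' ρs y γ hz hf using fun j => lab_factor (β (ρ j)) (x (ρ j)) (h j)
  obtain rfl : l = fun j => lab (T.act (ρs j) (β (ρ j))) (y j) := funext hz
  refine ⟨n', ρ, m', ρs, y, γ, rfl, Lab.sameArrow rfl rfl (fun j k hjk => ?_) fun j k hjk => ?_⟩
  · obtain rfl := Fin.ext hjk
    rfl
  · obtain rfl := Fin.ext hjk
    exact hf j

/-! ### The morphism determined by an algebra -/

section
variable (q : TwoMonad.Hom T.twoMonad Q) (A : PreAlgebra Q H)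

lemma exists_unit : ∃ ν : ∀ (i : I) (x : H.Fibre i), (H.incl i).obj x ⟶
    (homApp q H ≫ A.a).functor.obj (lab (T.one i) ((toUnary i).obj x)),
    ∀ i x, SameArrow (ν i x) (A.a₀.nat.app ((H.incl i).obj x)) := by
  have h (i : I) (x : H.Fibre i) : (Q.unit H ≫ A.a).functor.obj ((H.incl i).obj x) =
      (homApp q H ≫ A.a).functor.obj (lab (T.one i) ((toUnary i).obj x)) := by
    rw [← labUnit_incl]
    exact (congrArg A.a.functor.obj (CatOver.obj_eq (q.unit_app H) ((H.incl i).obj x))).symm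
  exact ⟨fun i x => A.a₀.nat.app ((H.incl i).obj x) ≫ eqToHom (h i x),
    fun i x => sameArrow_comp_eqToHom _ _⟩

lemma homApp₂_map (z : T.labOver (T.labOver H)) :
    (Q.T.map A.a ≫ A.a).functor.obj ((homApp₂ q H).functor.obj z) =
      (homApp q H ≫ A.a).functor.obj ((T.labMap (homApp q H ≫ A.a)).functor.obj z) :=
  congrArg A.a.functor.obj (homApp_map q A.a ((T.labMap (homApp q H)).functor.obj z))

/-- The functors `H_α` determined by the action of an algebra. -/
def algProd {n : ℕ} {c : Fin n → I} {i : I} (α : T.Hom c i) :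
    (∀ j, H.Fibre (c j)) ⥤ H.Fibre i where
  obj x := ⟨(homApp q H ≫ A.a).functor.obj (lab α x),
    Functor.congr_obj (homApp q H ≫ A.a).w (lab α x)⟩
  map γ := CatOver.fibreHom ((homApp q H ≫ A.a).functor.map (labLevelwise α γ))
  map_id x := Functor.Fiber.hom_ext ((homApp q H ≫ A.a).functor.map_id (lab α x))
  map_comp γ δ := Functor.Fiber.hom_ext ((congrArg (homApp q H ≫ A.a).functor.map
    (labLevelwise_comp α γ δ)).trans ((homApp q H ≫ A.a).functor.map_comp _ _))

/-- The components of `a₂` have the right endpoints only up to equality and are adjusted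
accordingly. Naturality is that of `a₂` along the image of a levelwise arrow, with both sides
rewritten by `e₁` and `e₂`, which express compatibility of `q` with `a` and with the
multiplications. -/
lemma exists_subst {n : ℕ} {c : Fin n → I} {i : I} {m : Fin n → ℕ} {d : ∀ j, Fin (m j) → I}
    (α : T.Hom c i) (β : ∀ j, T.Hom (d j) (c j)) :
    ∃ σ : prodFunctor (H := H.Fibre) (fun j => algProd q A (β j)) ⋙ algProd q A α ⟶
      concatFactors d ⋙ algProd q A (T.comp α β), ∀ x,
      SameArrow ((H.incl i).map (σ.app x)) (A.a₂.nat.app ((homApp₂ q H).functor.obj (lab₂ α β x))) := by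
  have h₂ (x : ∀ j k, H.Fibre (d j k)) :
      (Q.mult H ≫ A.a).functor.obj ((homApp₂ q H).functor.obj (lab₂ α β x)) =
      (homApp q H ≫ A.a).functor.obj ((T.labMult H).functor.obj (lab₂ α β x)) :=
    congrArg A.a.functor.obj (homApp_mult q H (lab₂ α β x))
  refine ⟨{ app := fun x => CatOver.fibreHom (eqToHom (homApp₂_map q A (lab₂ α β x)).symm ≫
              A.a₂.nat.app ((homApp₂ q H).functor.obj (lab₂ α β x)) ≫ eqToHom (h₂ x))
            naturality := fun x y γ => ?_ }, fun x => ?_⟩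
  · refine CatOver.sameArrow_of_incl ?_ |>.eq
    have nat := A.a₂.nat.naturality ((homApp₂ q H).functor.map (lab₂Levelwise α β γ))
    have e (x) : SameArrow (eqToHom (homApp₂_map q A (lab₂ α β x)).symm ≫
      A.a₂.nat.app ((homApp₂ q H).functor.obj (lab₂ α β x)) ≫ eqToHom (h₂ x))
      (A.a₂.nat.app ((homApp₂ q H).functor.obj (lab₂ α β x))) :=
      (sameArrow_eqToHom_comp _ _).trans (sameArrow_comp_eqToHom _ _)
    have e₁ : SameArrow
        ((Q.T.map A.a ≫ A.a).functor.map ((homApp₂ q H).functor.map (lab₂Levelwise α β γ)))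
        ((homApp q H ≫ A.a).functor.map
          ((T.labMap (homApp q H ≫ A.a)).functor.map (lab₂Levelwise α β γ))) :=
      SameArrow.functor_map (congrArg CatOver.Hom.functor (congrArg
        (fun F => T.labMap (homApp q H) ≫ F ≫ A.a) (q.naturality A.a).symm))
          (lab₂Levelwise α β γ)
    have e₂ : SameArrow
        ((Q.mult H ≫ A.a).functor.map ((homApp₂ q H).functor.map (lab₂Levelwise α β γ)))
        ((homApp q H ≫ A.a).functor.map ((T.labMult H).functor.map (lab₂Levelwise α β γ))) :=
      SameArrow.functor_map (congrArg CatOver.Hom.functor (congrArg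
        (fun F => F ≫ A.a) (q.mult_app H).symm)) (lab₂Levelwise α β γ)
    refine SameArrow.trans_map_comp (H.incl i) (SameArrow.symm
      (SameArrow.trans_map_comp (H.incl i) ?_))
    refine SameArrow.trans (SameArrow.comp (e x) (SameArrow.trans ?_ e₂.symm)) (SameArrow.trans
      (SameArrow.of_eq nat.symm) (SameArrow.comp (e₁.trans ?_) (e y).symm))
    · exact SameArrow.map (homApp q H ≫ A.a).functor (labMult_lab₂Levelwise α β γ).symm
    · exact SameArrow.map (homApp q H ≫ A.a).functor (Lab.sameArrow rfl rfl (fun j k hjk => hjk)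
        fun j k hjk => by
          obtain rfl := Fin.ext hjk
          rfl)
  · exact (sameArrow_eqToHom_comp _ _).trans (sameArrow_comp_eqToHom _ _)

lemma exists_preMorphism : ∃ M : PreMorphism T H.Fibre, PreCorresponds q A M := by
  obtain ⟨ν, hν⟩ := exists_unit q A
  choose σ hσ using @exists_subst I T H Q q A
  refine ⟨{ prod := algProd q A
            sym := fun {m n c i} α ρ =>
              { app := fun x => CatOver.fibreHom
                  ((homApp q H ≫ A.a).functor.map (labPermutative α ρ x))
                naturality := fun x y γ => Functor.Fiber.hom_ext ?_ }
            unit := fun i =>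
              { app := fun x => CatOver.fibreHom (ν i x)
                naturality := fun x y f => ?_ }
            subst := σ }, ⟨fun _ _ => rfl, fun _ _ _ _ => rfl, fun _ _ _ => rfl, fun x => hν _ x,
            hσ⟩⟩
  -- Naturality of the symmetries holds already in `TH`: both composites have permutation `ρ` and
  -- the permuted components of `γ`.
  · refine ((homApp q H ≫ A.a).functor.map_comp _ _).symm.trans
      (Eq.trans ?_ ((homApp q H ≫ A.a).functor.map_comp _ _))
    refine congrArg (homApp q H ≫ A.a).functor.map (Lab.hom_ext (fun _ => rfl) fun j => ?_)
    exact SameArrow.of_eq ((Category.comp_id _).trans (Category.id_comp _).symm)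
  · refine CatOver.sameArrow_of_incl ?_ |>.eq
    refine SameArrow.trans_map_comp (H.incl i) (SameArrow.symm
      (SameArrow.trans_map_comp (H.incl i) ?_))
    refine SameArrow.trans (SameArrow.comp (hν i x) ?_) (SameArrow.trans (SameArrow.of_eq
      (A.a₀.nat.naturality ((H.incl i).map f)).symm) (SameArrow.comp SameArrow.rfl (hν i y).symm))
    refine SameArrow.trans ?_ (SameArrow.map A.a.functor (SameArrow.functor_map
      (congrArg CatOver.Hom.functor (q.unit_app H)) ((H.incl i).map f)))
    refine SameArrow.map (homApp q H ≫ A.a).functor (Lab.sameArrow ?_ ?_ (fun j k hjk => hjk)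
      fun j k hjk => rfl)
    · exact (congrArg Lab.arr (labUnit_incl x)).symm
    · exact (congrArg Lab.arr (labUnit_incl y)).symm

end

end Operad

lemma isIdentity_pi {ι : Type*} {C : ι → Type u} [∀ j, Category.{v} (C j)] {x y : ∀ j, C j}
    {f : x ⟶ y} (h : ∀ j, IsIdentity (f j)) : IsIdentity f := by
  obtain rfl : x = y := funext fun j => (h j).src_eq_tgt
  exact ⟨rfl, funext fun j => (h j).eq (isIdentity_id _)⟩

/-! ### From lax algebras to commutative lax morphisms, and uniqueness -/

namespace Operad

variable {I : Type u} {T : Operad I} {H : CatOver I} {Q : TwoMonad (CatOver I)}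
  {q : TwoMonad.Hom T.twoMonad Q}

section
variable (hq : ∀ X, IsCoid (T.permutative X) (homApp q X).functor)
include hq

lemma isFullSurj_homApp₂ (X : CatOver I) : IsFullSurj (homApp₂ q X).functor :=
  (isFullSurj_labMap (hq X).toIsFullSurj).comp (hq _).toIsFullSurj

lemma isFullSurj_homApp₃ (X : CatOver I) : IsFullSurj (homApp₃ q X).functor :=
  (isFullSurj_labMap (isFullSurj_homApp₂ hq X)).comp (hq _).toIsFullSurj

/-- This is the source of commutativity: the symmetries are images of permutative arrows, which `q`
already sends to identities. -/
lemma PreCorresponds.isIdentity_sym {A : PreAlgebra Q H} {M : PreMorphism T H.Fibre}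
    (h : PreCorresponds q A M) {m n : ℕ} {c : Fin n → I} {i : I} (α : T.Hom c i)
    (ρ : Fin m ≃ Fin n) : IsIdentity (M.sym α ρ) :=
  isIdentity_natTrans _ fun x => CatOver.isIdentity_incl_iff.1 ((h.sym α ρ x).isIdentity_iff.2
    (((hq H).isIdentity _ (permutative_labPermutative α ρ x)).map A.a.functor))

/-- The inner permutations disappear under `T q`, which leaves a permutative arrow of the outer
layer, and that disappears under the next component of `q`. -/
lemma homApp₂_lab₂Permutative {n n' : ℕ} {c : Fin n → I} {i : I} {m : Fin n → ℕ}
    {d : ∀ j, Fin (m j) → I} {m' : Fin n' → ℕ} (α : T.Hom c i) (β : ∀ j, T.Hom (d j) (c j))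
    (ρ : Fin n' ≃ Fin n) (ρs : ∀ j, Fin (m' j) ≃ Fin (m (ρ j))) (x : ∀ j k, H.Fibre (d j k)) :
    IsIdentity ((homApp₂ q H).functor.map (lab₂Permutative α β ρ ρs x)) :=
  (hq _).isIdentity _ fun j =>
    (hq H).isIdentity _ (permutative_labPermutative (β (ρ j)) (ρs j) (x (ρ j)))

/-- The lax morphism determined by a lax algebra. -/
lemma exists_laxMorphism (A : Q.LaxAlgebra H) :
    ∃ M : LaxMorphism T H.Fibre, M.IsCommutative ∧ Corresponds q A M := by
  obtain ⟨M, h⟩ := exists_preMorphism q A.toPre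
  have hs := @PreCorresponds.isIdentity_sym I T H Q q hq _ _ h
  refine ⟨⟨M.prod, M.sym, M.unit, M.subst, fun α => hs α _, ?_, ?_, ?_, ?_, ?_⟩, hs,
    corresponds_iff.2 h⟩
  · intro l m n c i α ρ₁ ρ₂ x
    exact (((hs (T.act ρ₁ α) ρ₂).natTrans_app _).comp ((hs α ρ₁).natTrans_app x)).sameArrow_tgt.trans
      ((hs α (ρ₂.trans ρ₁)).natTrans_app x).sameArrow_tgt.symm
  · intro n c i α x
    exact CatOver.isIdentity_incl_iff.1 ((h.right_unit α x).isIdentity_iff.1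
      (CatOver.isIdentity_app A.right_unit _))
  · intro n c i α x
    exact CatOver.isIdentity_incl_iff.1 ((h.left_unit α x).isIdentity_iff.1
      (CatOver.isIdentity_app A.left_unit _))
  · intro n n' c i m d m' α β ρ ρs x
    -- The source and the target of the doubly permutative arrow have the same image in `QQH`, so
    -- `a₂` has the same component at both. Since all symmetries are identities, this is the whole
    -- content of the compatibility of substitutions with symmetries.
    have e : SameArrow ((M.subst (T.act ρ α) fun j => T.act (ρs j) (β (ρ j))).app
        (fun j k => x (ρ j) (ρs j k))) ((M.subst α β).app x) :=
      CatOver.sameArrow_of_incl ((h.subst _ _ _).trans ((CatOver.sameArrow_app_of_eq A.a₂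
        (homApp₂_lab₂Permutative hq α β ρ ρs x).src_eq_tgt).trans (h.subst α β x).symm))
    have e' := (hs (T.comp α β) (blockPerm ρ ρs)).natTrans_app ((concatFactors d).obj x)
    refine ⟨e.tgt_eq.trans e'.src_eq_tgt.symm, SameArrow.eq ?_⟩
    refine SameArrow.trans (SameArrow.isIdentity_comp _ (IsIdentity.map _ (isIdentity_pi
      fun j => (hs (β (ρ j)) (ρs j)).natTrans_app (x (ρ j))))) ?_
    refine SameArrow.trans (SameArrow.isIdentity_comp _ ((hs α ρ).natTrans_app _)) ?_
    refine SameArrow.trans e.symm (SameArrow.symm ?_)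
    exact SameArrow.comp_isIdentity _ ((isIdentity_eqToHom _).comp e')
  · intro n c i m d p e α β γ x
    exact CatOver.sameArrow_of_incl ((h.assoc₂ α β γ x).symm.trans
      ((CatOver.sameArrow_app A.assoc.symm _).trans (h.assoc₁ α β γ x)))

/-! ### Uniqueness -/

omit hq in
lemma PreCorresponds.morphism_unique {A : PreAlgebra Q H} {M N : PreMorphism T H.Fibre}
    (hM : PreCorresponds q A M) (hN : PreCorresponds q A N) : M = N := by
  obtain ⟨p, s, u, t⟩ := M
  obtain ⟨p', s', u', t'⟩ := N
  obtain rfl : @p = @p' := by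
    funext n c i α
    exact SameArrow.functor_ext fun γ => CatOver.sameArrow_of_incl
      ((hM.prod_map α γ).trans (hN.prod_map α γ).symm)
  obtain rfl : @s = @s' := by
    funext m n c i α ρ
    exact NatTrans.ext (funext fun x => (CatOver.sameArrow_of_incl
      ((hM.sym α ρ x).trans (hN.sym α ρ x).symm)).eq)
  obtain rfl : u = u' := by
    funext i
    exact NatTrans.ext (funext fun x => (CatOver.sameArrow_of_incl
      ((hM.unit x).trans (hN.unit x).symm)).eq)
  obtain rfl : @t = @t' := by
    funext n c i m d α β
    exact NatTrans.ext (funext fun x => (CatOver.sameArrow_of_incl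
      ((hM.subst α β x).trans (hN.subst α β x).symm)).eq)
  rfl

/-- The action is determined by its restriction to `TH`, hence by its values on levelwise and
permutative arrows (`lab_factor`). The 2-cell `a₂` is determined by its components at images of
objects of `TTH`. -/
lemma PreCorresponds.algebra_unique {A B : PreAlgebra Q H} {M : PreMorphism T H.Fibre}
    (hA : PreCorresponds q A M) (hB : PreCorresponds q B M) : A = B := by
  obtain ⟨a, a₀, a₂⟩ := A
  obtain ⟨b, b₀, b₂⟩ := B
  obtain rfl : a = b := by
    refine CatOver.epi_of_isFullSurj (hq H).toIsFullSurj (CatOver.hom_ext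
      (SameArrow.functor_ext fun {w w'} f => ?_))
    obtain ⟨n, c, i, β, x, rfl⟩ := lab_eta w'
    obtain ⟨m, ρ, y, γ, rfl, hf⟩ := lab_factor β x f
    obtain rfl := hf.eq
    refine SameArrow.trans_map_comp _ (SameArrow.symm (SameArrow.trans_map_comp _ ?_))
    exact SameArrow.comp ((hB.prod_map _ γ).symm.trans (hA.prod_map _ γ))
      ((hB.sym β ρ x).symm.trans (hA.sym β ρ x))
  obtain rfl : a₀ = b₀ := CatOver.cell_ext fun x =>
    ((hA.unit (CatOver.fibreMk x rfl)).symm.trans (hB.unit (CatOver.fibreMk x rfl))).eq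
  obtain rfl : a₂ = b₂ := CatOver.cell_ext_of_isFullSurj (isFullSurj_homApp₂ hq H) fun z => by
    obtain ⟨n, c, i, m, d, α, β, x, rfl⟩ := lab₂_eta z
    exact (hA.subst α β x).symm.trans (hB.subst α β x)
  rfl

/-! ### Pseudo and strict structures -/

/-- Invertibility is tested on components, and those of `a₂` at images of `lab₂ α β x` exhaust all
of them by surjectivity on objects. -/
lemma Corresponds.isPseudo_iff {A : Q.LaxAlgebra H} {M : LaxMorphism T H.Fibre}
    (h : Corresponds q A M) : A.IsPseudo ↔ M.IsPseudo := by
  refine and_congr ?_ ?_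
  · rw [CatOver.isIso_cell_iff]
    refine ⟨fun hA i => (natTrans_isIso_iff _).2 fun x =>
      CatOver.isIso_incl_iff.1 ((h.unit x).isIso_iff.2 (hA _)), fun hM x => ?_⟩
    exact (h.unit (CatOver.fibreMk x rfl)).isIso_iff.1
      (CatOver.isIso_incl_iff.2 ((natTrans_isIso_iff _).1 (hM _) _))
  · rw [CatOver.isIso_cell_iff]
    refine ⟨fun hA n c i m d α β => (natTrans_isIso_iff _).2 fun x =>
      CatOver.isIso_incl_iff.1 ((h.subst α β x).isIso_iff.2 (hA _)), fun hM z => ?_⟩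
    obtain ⟨z, rfl⟩ := (isFullSurj_homApp₂ hq H).obj_surj z
    obtain ⟨n, c, i, m, d, α, β, x, rfl⟩ := lab₂_eta z
    exact (h.subst α β x).isIso_iff.1
      (CatOver.isIso_incl_iff.2 ((natTrans_isIso_iff _).1 (hM α β) x))

lemma Corresponds.isStrict_iff {A : Q.LaxAlgebra H} {M : LaxMorphism T H.Fibre}
    (h : Corresponds q A M) : A.IsStrict ↔ M.IsStrict := by
  refine and_congr ?_ ?_
  · rw [CatOver.isIdentity_cell_iff]
    refine ⟨fun hA i => (natTrans_isIdentity_iff _).2 fun x =>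
      CatOver.isIdentity_incl_iff.1 ((h.unit x).isIdentity_iff.2 (hA _)), fun hM x => ?_⟩
    exact (h.unit (CatOver.fibreMk x rfl)).isIdentity_iff.1
      (CatOver.isIdentity_incl_iff.2 ((hM _).natTrans_app _))
  · rw [CatOver.isIdentity_cell_iff]
    refine ⟨fun hA n c i m d α β => (natTrans_isIdentity_iff _).2 fun x =>
      CatOver.isIdentity_incl_iff.1 ((h.subst α β x).isIdentity_iff.2 (hA _)), fun hM z => ?_⟩
    obtain ⟨z, rfl⟩ := (isFullSurj_homApp₂ hq H).obj_surj z
    obtain ⟨n, c, i, m, d, α, β, x, rfl⟩ := lab₂_eta z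
    exact (h.subst α β x).isIdentity_iff.1
      (CatOver.isIdentity_incl_iff.2 ((hM α β).natTrans_app x))

/-! ### The axioms of an algebra -/

/-- The axioms concern 2-cells out of `QH` and `QQQH`. They are tested at images of objects of `TH`
and `TTTH`, where they are the axioms of `M`. -/
lemma PreCorresponds.exists_laxAlgebra {A : PreAlgebra Q H} {M : LaxMorphism T H.Fibre}
    (h : PreCorresponds q A M.toPre) : ∃ B : Q.LaxAlgebra H, Corresponds q B M := by
  refine ⟨⟨A.a, A.a₀, A.a₂, CatOver.isIdentity_cell _ fun w => ?_,
    CatOver.isIdentity_cell _ fun w => ?_, CatOver.sameArrow_of_isFullSurj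
      (isFullSurj_homApp₃ hq H) ?_ ?_ fun z => ?_⟩, corresponds_iff.2 h⟩
  · obtain ⟨w, rfl⟩ := (hq H).obj_surj w
    obtain ⟨n, c, i, α, x, rfl⟩ := lab_eta w
    exact (h.left_unit α x).isIdentity_iff.2 (CatOver.isIdentity_incl_iff.2 (M.one_subst α x))
  · obtain ⟨w, rfl⟩ := (hq H).obj_surj w
    obtain ⟨n, c, i, α, x, rfl⟩ := lab_eta w
    exact (h.right_unit α x).isIdentity_iff.2 (CatOver.isIdentity_incl_iff.2 (M.subst_one α x))
  · rw [Q.T.map_comp, Strict.assoc]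
  · rw [← Strict.assoc, ← Strict.assoc, Q.assoc]
  · obtain ⟨n, c, i, m, d, p, e, α, β, γ, x, rfl⟩ := lab₃_eta z
    exact (h.assoc₁ α β γ x).trans (((M.subst_subst α β γ x).symm.map (H.incl i)).trans
      (h.assoc₂ α β γ x).symm)

end

end Operad

lemma CatOver.hom_eta {I : Type u} {H : CatOver I} {x y : H} (f : x ⟶ y) :
    ∃ (i : I) (x' y' : H.Fibre i) (f' : x' ⟶ y'), x = (H.incl i).obj x' ∧
      y = (H.incl i).obj y' ∧ SameArrow f ((H.incl i).map f') :=
  ⟨H.col x, fibreMk x rfl, fibreMk y (col_eq_of_hom f).symm, fibreHom f, rfl, rfl, rfl⟩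

/-! ### From commutative lax morphisms to lax algebras -/

namespace Operad

variable {I : Type u} {T : Operad I} {H : CatOver I} {Q : TwoMonad (CatOver I)}
  {q : TwoMonad.Hom T.twoMonad Q}

/-- The functor `b : TH ⟶ H` has the products of `M` as its values at objects and levelwise
arrows, and it sends the permutative arrows to identities. -/
structure IsLabAction (M : LaxMorphism T H.Fibre) (b : T.labOver H ⟶ H) : Prop where
  obj_lab {n : ℕ} {c : Fin n → I} {i : I} (α : T.Hom c i) (x : ∀ j, H.Fibre (c j)) :
    b.functor.obj (lab α x) = (H.incl i).obj ((M.prod α).obj x)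
  map_labLevelwise {n : ℕ} {c : Fin n → I} {i : I} (α : T.Hom c i) {x y : ∀ j, H.Fibre (c j)}
    (γ : x ⟶ y) :
    SameArrow (b.functor.map (labLevelwise α γ)) ((H.incl i).map ((M.prod α).map γ))
  isIdentity {w w' : T.labOver H} (p : w ⟶ w') :
    T.permutative H p → IsIdentity (b.functor.map p)

section
variable {M : LaxMorphism T H.Fibre} (hM : M.IsCommutative)
include hM

lemma prod_act {m n : ℕ} {c : Fin n → I} {i : I} (α : T.Hom c i) (ρ : Fin m ≃ Fin n) :
    permuteFactors c ρ ⋙ M.prod (T.act ρ α) = M.prod α := (hM α ρ).src_eq_tgt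

/-- Products are invariant under permutations, in terms of arrows with unspecified sources. -/
lemma prod_actArr {a b : Arr T.Hom} (ρ : Fin a.n ≃ Fin b.n) (h : a = T.actArr b ρ)
    {y y' : Fin b.n → H} (hy : ∀ j, H.col (y j) = b.src j) (hy' : ∀ j, H.col (y' j) = b.src j)
    (hz : ∀ j, H.col (y (ρ j)) = a.src j) (hz' : ∀ j, H.col (y' (ρ j)) = a.src j)
    (δ : ∀ j, y j ⟶ y' j) :
    SameArrow
      ((H.incl _).map ((M.prod a.hom).map (X := fun j => CatOver.fibreMk (y (ρ j)) (hz j))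
        (Y := fun j => CatOver.fibreMk (y' (ρ j)) (hz' j)) fun j => CatOver.fibreHom (δ (ρ j))))
      ((H.incl _).map ((M.prod b.hom).map (X := fun j => CatOver.fibreMk (y j) (hy j))
        (Y := fun j => CatOver.fibreMk (y' j) (hy' j)) fun j => CatOver.fibreHom (δ j))) := by
  obtain ⟨m, c', i', α⟩ := a
  obtain ⟨n, c, i, β⟩ := b
  change Fin m ≃ Fin n at ρ
  obtain ⟨-, h₂, h₃, h₄⟩ := Arr.mk.inj h
  obtain rfl : i' = i := h₃
  obtain rfl : c' = c ∘ ρ := eq_of_heq h₂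
  obtain rfl : α = T.act ρ β := eq_of_heq h₄
  let δ' : (fun j => CatOver.fibreMk (y j) (hy j) : ∀ j, H.Fibre (c j)) ⟶
    fun j => CatOver.fibreMk (y' j) (hy' j) := fun j => CatOver.fibreHom (δ j)
  exact (SameArrow.functor_map (prod_act hM β ρ) δ').map (H.incl i')

/-- An arrow `(ρ, γ)` from `α = βρ` to `β` is sent to `H_α(γ)`, followed by the equality `H_{βρ} c_ρ
= H_β` given by commutativity. -/
lemma exists_isLabAction : ∃ b : T.labOver H ⟶ H, IsLabAction M b := by
  have hc {w w' : T.labOver H} (f : w ⟶ w') (j : Fin w.arr.n) :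
      H.col (w'.label (f.perm j)) = w.arr.src j :=
    (CatOver.col_eq_of_hom (f.hom j)).symm.trans (w.col_label j)
  let obj (w : T.labOver H) : H := (H.incl _).obj ((M.prod w.arr.hom).obj
    fun j => CatOver.fibreMk (w.label j) (w.col_label j))
  have hobj {w w' : T.labOver H} (f : w ⟶ w') : (H.incl _).obj ((M.prod w.arr.hom).obj
      fun j => CatOver.fibreMk (w'.label (f.perm j)) (hc f j)) = obj w' :=
    (prod_actArr hM f.perm f.arr_eq w'.col_label w'.col_label (hc f) (hc f) fun j => 𝟙 _).src_eq
  let map {w w' : T.labOver H} (f : w ⟶ w') : obj w ⟶ obj w' :=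
    (H.incl _).map ((M.prod w.arr.hom).map
      (X := fun j => CatOver.fibreMk (w.label j) (w.col_label j))
      (Y := fun j => CatOver.fibreMk (w'.label (f.perm j)) (hc f j))
      fun j => CatOver.fibreHom (f.hom j)) ≫ eqToHom (hobj f)
  have hmap {w w' : T.labOver H} (f : w ⟶ w') : SameArrow (map f)
      ((H.incl _).map ((M.prod w.arr.hom).map
        (X := fun j => CatOver.fibreMk (w.label j) (w.col_label j))
        (Y := fun j => CatOver.fibreMk (w'.label (f.perm j)) (hc f j))
        fun j => CatOver.fibreHom (f.hom j))) := sameArrow_comp_eqToHom _ _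
  have hperm {w w' : T.labOver H} (p : w ⟶ w') (hp : T.permutative H p) : IsIdentity (map p) :=
    (hmap p).isIdentity_iff.2 (IsIdentity.map _ (IsIdentity.map _ (isIdentity_pi fun j =>
      CatOver.isIdentity_incl_iff.1 (hp j))))
  refine ⟨⟨{ obj := obj, map := map, map_id := fun w => ?_, map_comp := fun {w w' w''} f g => ?_ },
    CategoryTheory.Functor.ext (fun w => ?_) fun _ _ _ => Subsingleton.elim _ _⟩,
    fun _ _ => rfl, fun _ _ _ _ => hmap _, hperm⟩
  · exact (hperm (𝟙 w) fun j => isIdentity_id _).eq (isIdentity_id _)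
  -- The components of `g` are evaluated under the product of its own source. `prod_actArr` moves
  -- them to the product of the source of `f`, where functoriality of that product applies.
  · refine SameArrow.eq ((hmap (f ≫ g)).trans (SameArrow.trans ?_ (SameArrow.comp (hmap f)
      ((hmap g).trans (prod_actArr hM f.perm f.arr_eq w'.col_label (hc g) (hc f) (hc (f ≫ g))
        g.hom).symm)).symm))
    refine SameArrow.of_eq (Eq.trans ?_ ((H.incl _).map_comp _ _))
    refine congrArg (H.incl _).map (Eq.trans ?_ ((M.prod w.arr.hom).map_comp _ _))
    exact congrArg (M.prod w.arr.hom).map (funext fun j => Functor.Fiber.hom_ext rfl)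
  · exact ((M.prod w.arr.hom).obj _).2

end

section
variable {M : LaxMorphism T H.Fibre} {b : T.labOver H ⟶ H} (hb : IsLabAction M b)
include hb

lemma IsLabAction.exists_unit : ∃ a₀ : 𝟙 H ⟶ T.labUnit H ≫ b, ∀ (i : I) (x : H.Fibre i),
    SameArrow (a₀.nat.app ((H.incl i).obj x)) ((H.incl i).map ((M.unit i).app x)) := by
  let ν (x : H) : x ⟶ (T.labUnit H ≫ b).functor.obj x :=
    (H.incl _).map ((M.unit (H.col x)).app (CatOver.fibreMk x rfl)) ≫
      eqToHom (hb.obj_lab (T.one _) ((toUnary _).obj (CatOver.fibreMk x rfl))).symm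
  have hν (i : I) (x : H.Fibre i) : SameArrow (ν ((H.incl i).obj x))
      ((H.incl i).map ((M.unit i).app x)) := by
    obtain ⟨x, hx⟩ := x
    obtain rfl : H.col x = i := congrArg Discrete.as hx
    exact sameArrow_comp_eqToHom _ _
  refine ⟨CatOver.Cell.mk { app := ν, naturality := fun x y f => ?_ }, hν⟩
  obtain ⟨i, x, y, f', rfl, rfl, hf⟩ := CatOver.hom_eta f
  obtain rfl := hf.eq
  have e : SameArrow ((T.labUnit H ≫ b).functor.map ((H.incl i).map f'))
      ((H.incl i).map ((toUnary i ⋙ M.prod (T.one i)).map f')) := by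
    refine SameArrow.trans (SameArrow.map b.functor ?_)
      (hb.map_labLevelwise (T.one i) ((toUnary i).map f'))
    exact Lab.sameArrow (congrArg Lab.arr (labUnit_incl x)) (congrArg Lab.arr (labUnit_incl y))
      (fun j k hjk => hjk) fun j k hjk => rfl
  refine SameArrow.eq ((SameArrow.comp SameArrow.rfl (hν i y)).trans (SameArrow.trans ?_
    (SameArrow.comp (hν i x) e).symm))
  refine SameArrow.of_eq (((H.incl i).map_comp _ _).symm.trans (Eq.trans ?_
    ((H.incl i).map_comp _ _)))
  exact congrArg (H.incl i).map ((M.unit i).naturality f')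

lemma IsLabAction.labMap_obj {n : ℕ} {c : Fin n → I} {i : I} {m : Fin n → ℕ}
    {d : ∀ j, Fin (m j) → I} (α : T.Hom c i) (β : ∀ j, T.Hom (d j) (c j))
    (x : ∀ j k, H.Fibre (d j k)) :
    (T.labMap b).functor.obj (lab₂ α β x) = lab α ((prodFunctor fun j => M.prod (β j)).obj x) :=
  Lab.ext' rfl fun j k hjk => by
    obtain rfl := Fin.ext hjk
    exact hb.obj_lab (β j) (x j)

lemma IsLabAction.labMap_map {n : ℕ} {c : Fin n → I} {i : I} {m : Fin n → ℕ}
    {d : ∀ j, Fin (m j) → I} (α : T.Hom c i) (β : ∀ j, T.Hom (d j) (c j))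
    {x y : ∀ j k, H.Fibre (d j k)} (γ : x ⟶ y) :
    SameArrow ((T.labMap b).functor.map (lab₂Levelwise α β γ))
      (labLevelwise α ((prodFunctor fun j => M.prod (β j)).map γ)) :=
  Lab.sameArrow rfl rfl (fun j k hjk => hjk) fun j k hjk => by
    obtain rfl := Fin.ext hjk
    exact hb.map_labLevelwise (β j) (γ j)

/-- Naturality is checked on the two factors of `lab₂_factor`: on levelwise arrows it is naturality
of the substitutions (`nat₁`), on permutative ones it is their compatibility with the symmetries
(`nat₂`). -/
lemma IsLabAction.exists_subst (hM : M.IsCommutative) :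
    ∃ a₂ : T.labMap b ≫ b ⟶ T.labMult H ≫ b,
      ∀ {n : ℕ} {c : Fin n → I} {i : I} {m : Fin n → ℕ} {d : ∀ j, Fin (m j) → I}
        (α : T.Hom c i) (β : ∀ j, T.Hom (d j) (c j)) (x : ∀ j k, H.Fibre (d j k)),
        SameArrow (a₂.nat.app (lab₂ α β x)) ((H.incl i).map ((M.subst α β).app x)) := by
  -- To have a component at every object, the inner operations are transported to the colours of the
  -- outer one. At objects of the form `lab₂ α β x` this transport is trivial.
  let op (z : T.labOver (T.labOver H)) (j : Fin z.arr.n) :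
      T.Hom (z.label j).arr.src (z.arr.src j) := z.col_label j ▸ (z.label j).arr.hom
  let lb (z : T.labOver (T.labOver H)) (j : Fin z.arr.n) (k : Fin (z.label j).arr.n) :
      H.Fibre ((z.label j).arr.src k) :=
    CatOver.fibreMk ((z.label j).label k) ((z.label j).col_label k)
  have h₁ (z : T.labOver (T.labOver H)) : (T.labMap b ≫ b).functor.obj z =
      (H.incl _).obj ((M.prod z.arr.hom).obj fun j => (M.prod (op z j)).obj (lb z j)) := by
    obtain ⟨n, c, i, m, d, α, β, x, rfl⟩ := lab₂_eta z
    exact (congrArg b.functor.obj (hb.labMap_obj α β x)).trans (hb.obj_lab _ _)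
  have h₂ (z : T.labOver (T.labOver H)) :
      (H.incl _).obj ((M.prod (T.comp z.arr.hom (op z))).obj ((concatFactors _).obj (lb z))) =
        (T.labMult H ≫ b).functor.obj z := by
    obtain ⟨n, c, i, m, d, α, β, x, rfl⟩ := lab₂_eta z
    exact (hb.obj_lab _ _).symm
  let σ (z : T.labOver (T.labOver H)) :
      (T.labMap b ≫ b).functor.obj z ⟶ (T.labMult H ≫ b).functor.obj z :=
    eqToHom (h₁ z) ≫ (H.incl _).map ((M.subst z.arr.hom (op z)).app (lb z)) ≫ eqToHom (h₂ z)
  have hσ {n : ℕ} {c : Fin n → I} {i : I} {m : Fin n → ℕ} {d : ∀ j, Fin (m j) → I}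
      (α : T.Hom c i) (β : ∀ j, T.Hom (d j) (c j)) (x : ∀ j k, H.Fibre (d j k)) :
      SameArrow (σ (lab₂ α β x)) ((H.incl i).map ((M.subst α β).app x)) :=
    (sameArrow_eqToHom_comp _ _).trans (sameArrow_comp_eqToHom _ _)
  have nat₁ {n : ℕ} {c : Fin n → I} {i : I} {m : Fin n → ℕ} {d : ∀ j, Fin (m j) → I}
      (α : T.Hom c i) (β : ∀ j, T.Hom (d j) (c j)) {x y : ∀ j k, H.Fibre (d j k)} (γ : x ⟶ y) :
      (T.labMap b ≫ b).functor.map (lab₂Levelwise α β γ) ≫ σ (lab₂ α β y) =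
        σ (lab₂ α β x) ≫ (T.labMult H ≫ b).functor.map (lab₂Levelwise α β γ) := by
    refine SameArrow.eq ((SameArrow.comp (((hb.labMap_map α β γ).map b.functor).trans
      (hb.map_labLevelwise _ _)) (hσ α β y)).trans (SameArrow.trans ?_ (SameArrow.comp (hσ α β x)
        (((labMult_lab₂Levelwise α β γ).map b.functor).trans (hb.map_labLevelwise _ _))).symm))
    refine SameArrow.of_eq (((H.incl i).map_comp _ _).symm.trans (Eq.trans ?_
      ((H.incl i).map_comp _ _)))
    exact congrArg (H.incl i).map ((M.subst α β).naturality γ)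
  have nat₂ {n n' : ℕ} {c : Fin n → I} {i : I} {m : Fin n → ℕ} {d : ∀ j, Fin (m j) → I}
      {m' : Fin n' → ℕ} (α : T.Hom c i) (β : ∀ j, T.Hom (d j) (c j)) (ρ : Fin n' ≃ Fin n)
      (ρs : ∀ j, Fin (m' j) ≃ Fin (m (ρ j))) (x : ∀ j k, H.Fibre (d j k)) :
      (T.labMap b ≫ b).functor.map (lab₂Permutative α β ρ ρs x) ≫ σ (lab₂ α β x) =
        σ _ ≫ (T.labMult H ≫ b).functor.map (lab₂Permutative α β ρ ρs x) := by
    have hp (j) : T.permutative H ((lab₂Permutative α β ρ ρs x).hom j) :=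
      permutative_labPermutative (β (ρ j)) (ρs j) (x (ρ j))
    have i₁ : IsIdentity ((T.labMap b ≫ b).functor.map (lab₂Permutative α β ρ ρs x)) :=
      hb.isIdentity _ fun j => hb.isIdentity _ (hp j)
    have i₂ : IsIdentity ((T.labMult H ≫ b).functor.map (lab₂Permutative α β ρ ρs x)) :=
      hb.isIdentity _ (permutative_labMult hp)
    refine SameArrow.eq ((SameArrow.isIdentity_comp _ i₁).trans (SameArrow.trans ?_
      (SameArrow.comp_isIdentity _ i₂).symm))
    refine (hσ α β x).trans (SameArrow.trans ?_ (hσ _ _ _).symm)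
    refine SameArrow.map (H.incl i) ?_
    -- All symmetries in this equation are identities; what remains is that the two substitutions
    -- coincide.
    obtain ⟨h, e⟩ := M.subst_sym α β ρ ρs x
    refine SameArrow.trans (SameArrow.symm (SameArrow.trans (SameArrow.isIdentity_comp _
      (IsIdentity.map _ (isIdentity_pi fun j => (hM (β (ρ j)) (ρs j)).natTrans_app (x (ρ j)))))
      (SameArrow.isIdentity_comp _ ((hM α ρ).natTrans_app _)))) ((SameArrow.of_eq e).trans ?_)
    exact SameArrow.comp_isIdentity _ ((isIdentity_eqToHom _).comp ((hM _ _).natTrans_app _))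
  refine ⟨CatOver.Cell.mk { app := σ, naturality := fun z z' f => ?_ }, hσ⟩
  obtain ⟨n, c, i, m, d, α, β, x, rfl⟩ := lab₂_eta z'
  obtain ⟨n', ρ, m', ρs, y, γ, rfl, hf⟩ := lab₂_factor α β x f
  obtain rfl := hf.eq
  rw [Functor.map_comp, Functor.map_comp, Category.assoc, nat₂, ← Category.assoc, nat₁,
    Category.assoc]

end

section
variable (hq : ∀ X, IsCoid (T.permutative X) (homApp q X).functor)
include hq

/-- The lax algebra determined by a commutative lax morphism. -/
lemma exists_laxAlgebra {M : LaxMorphism T H.Fibre} (hM : M.IsCommutative) :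
    ∃ A : Q.LaxAlgebra H, Corresponds q A M := by
  obtain ⟨b, hb⟩ := exists_isLabAction hM
  -- Since `b` sends permutative arrows to identities, it factors through `q`. The factor is the
  -- action of the algebra.
  obtain ⟨a, rfl⟩ := CatOver.exists_desc (hq H) b hb.isIdentity
  have e₀ : Q.unit H ≫ a = T.labUnit H ≫ homApp q H ≫ a :=
    congrArg (· ≫ a) (q.unit_app H).symm
  obtain ⟨a₀, h₀⟩ : ∃ a₀ : 𝟙 H ⟶ Q.unit H ≫ a, ∀ (i : I) (x : H.Fibre i),
      SameArrow (a₀.nat.app ((H.incl i).obj x)) ((H.incl i).map ((M.unit i).app x)) := by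
    rw [e₀]
    exact hb.exists_unit
  obtain ⟨θ, hθ⟩ := hb.exists_subst hM
  obtain ⟨a₂, h₂⟩ := CatOver.exists_cell (isFullSurj_homApp₂ hq H) (F := Q.T.map a ≫ a)
    (G := Q.mult H ≫ a) (congrArg (fun F => T.labMap (homApp q H) ≫ F ≫ a) (q.naturality a).symm)
    (congrArg (· ≫ a) (q.mult_app H).symm) θ
  refine PreCorresponds.exists_laxAlgebra hq (A := ⟨a, a₀, a₂⟩) ⟨fun α x => (hb.obj_lab α x).symm,
    fun α _ _ γ => (hb.map_labLevelwise α γ).symm, fun α ρ x => ?_, fun x => (h₀ _ x).symm,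
    fun α β x => ((h₂ _).trans (hθ α β x)).symm⟩
  -- The symmetry of `M` and the value of the action at the permutative arrow are both identities,
  -- and their targets agree.
  exact ((((hM α ρ).natTrans_app x).map (H.incl _)).sameArrow_tgt.trans
    (congrArg (fun y => Arrow.mk (𝟙 y)) (hb.obj_lab α x).symm)).trans
      (hb.isIdentity _ (permutative_labPermutative α ρ x)).sameArrow_tgt.symm

end

end Operad

end CatOperads

theorem mainTheorem6 {I : Type u} (T : CatOperads.Operad I) :
    CatOperads.TwoMonad.IsReflexive T.permCell ∧
    (∃ (Q : CatOperads.TwoMonad (CatOperads.CatOver I)) (q : CatOperads.TwoMonad.Hom T.twoMonad Q),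
      CatOperads.TwoMonad.IsCoidentifier T.permCell q) ∧
    ∀ (Q : CatOperads.TwoMonad (CatOperads.CatOver I)) (q : CatOperads.TwoMonad.Hom T.twoMonad Q),
      CatOperads.TwoMonad.IsCoidentifier T.permCell q →
      (∀ H : CatOperads.CatOver I,
        ∃ e : Q.LaxAlgebra H ≃ {M : CatOperads.LaxMorphism T H.Fibre // M.IsCommutative},
          ∀ A : Q.LaxAlgebra H, CatOperads.Operad.Corresponds q A (e A).1 ∧
            (A.IsPseudo ↔ (e A).1.IsPseudo) ∧ (A.IsStrict ↔ (e A).1.IsStrict)) ∧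
      CatOperads.Operad.AgreesWithStandardMonad q := by
  refine ⟨T.isReflexive_permCell, ⟨T.quotMonad, T.quotHom, T.isCoidentifier_quotHom⟩,
    fun Q q h => ?_⟩
  have hq := CatOperads.Operad.isCoid_of_isCoidentifier h
  refine ⟨fun H => ?_, CatOperads.Operad.agreesWithStandardMonad hq⟩
  choose M hM hc using CatOperads.Operad.exists_laxMorphism (H := H) hq
  -- Injectivity holds because a morphism determines the corresponding algebra. For surjectivity,
  -- take an algebra corresponding to `N`; the morphism chosen for it is `N`, since an algebra
  -- determines the corresponding morphism.
  refine ⟨Equiv.ofBijective (fun A => ⟨M A, hM A⟩) ⟨fun A B hAB => ?_, fun N => ?_⟩,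
    fun A => ⟨hc A, (hc A).isPseudo_iff hq, (hc A).isStrict_iff hq⟩⟩
  · have e : M A = M B := congrArg Subtype.val hAB
    have hA := CatOperads.Operad.corresponds_iff.1 (hc A)
    rw [e] at hA
    exact CatOperads.TwoMonad.LaxAlgebra.toPre_injective
      (hA.algebra_unique hq (CatOperads.Operad.corresponds_iff.1 (hc B)))
  · obtain ⟨A, hA⟩ := CatOperads.Operad.exists_laxAlgebra hq N.2
    exact ⟨A, Subtype.ext (CatOperads.LaxMorphism.toPre_injective
      ((CatOperads.Operad.corresponds_iff.1 (hc A)).morphism_unique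
        (CatOperads.Operad.corresponds_iff.1 hA)))⟩
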